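/- Let $m\ge 2$ and let $(a_1,\dots,a_m)$ be integers with $a_i\ge 2$, $\gcd(a_1,\dots,a_m)=1$ and, with $d_i=\gcd(a_1,\dots,a_i)$, $\frac{a_i}{d_i}\in\frac{a_1}{d_{i-1}}\mathbb Z_{\ge0}+\cdots+\frac{a_{i-1}}{d_{i-1}}\mathbb Z_{\ge0}$ for $2\le i\le m$. Let $$B=\{(\ell_1,\dots,\ell_m)\in\mathbb Z_{\ge0}^m \mid \ell_i\le d_{i-1}/d_i-1 \text{ for } 2\le i\le m\},$$ and for $2\le i\le m$ let $(\ell_{i,1},\dots,\ell_{i,m})$ be the unique element of $B$ with $\sum_j a_j\ell_{i,j}=a_id_{i-1}/d_i$ (then $\ell_{i,j}=0$ for $j\ge i$). For $2\le i\le m$ put $$F_i(x)=x_i^{d_{i-1}/d_i}-\prod_{j<i}x_j^{\ell_{i,j}}-\sum\lambda^{(i)}_{j_1,\dots,j_m}x_1^{j_1}\cdots x_m^{j_m},\qquad \lambda^{(i)}_{j_1,\dots,j_m}\in\mathbb C,$$ the sum being over the $(j_1,\dots,j_m)\in B$ with $\sum_k a_kj_k<a_id_{i-1}/d_i$. Assume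 that the affine curve $X^{\mathrm{aff}}=\{F_2=\cdots=F_m=0\}\subset\mathbb C^m$ is nonsingular (the matrix $G$ below has rank $m-1$ at each of its points), and let $X=X^{\mathrm{aff}}\cup\{\infty\}$ be the corresponding compact Riemann surface, of genus $g$. Let $\varphi_1=1,\varphi_2,\dots$ be the monomials $x^\alpha=x_1^{\alpha_1}\cdots x_m^{\alpha_m}$, $\alpha\in B$, ordered by increasing order of the pole at $\infty$. Let $G=(\partial F_i/\partial x_j)_{2\le i\le m,\,1\le j\le m}$, let $G_1$ be $G$ without its first column, and let $$du_i=-\frac{\varphi_{g+1-i}}{\det G_1}\,dx_1,\qquad 1\le i\le g.$$ For points $P=(x_1,\dots,x_m)$ and $Q=(y_1,\dots,y_m)$ of $X$ let $H(P,Q)=(h_{ij})_{2\le i,j\le m}$ with $$h_{ij}=\frac{F_i(y_1,\dots,y_{j-1},x_j,x_{j+1},\dots,x_m)-F_i(y_1,\dots,y_{j-1},y_j,x_{j+1},\dots,x_m)}{x_j-y_j},$$ and let $$\Omega(P,Q)=\frac{\det H(P,Q)}{(x_1-y_1)\det G_1(P)}\,dx_1,\qquad \widehat\omega(P,Q)=d_Q\Omega(P,Q)+\sum_{i=1}^g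 du_i(P)\,dr_i(Q),$$ where $dr_1,\dots,dr_g$ are differentials of the second kind on $X$ with a pole only at $\infty$ (meromorphic one-forms on $X$ that are holomorphic on $X\setminus\{\infty\}$). Suppose that $dr_1,\dots,dr_g$ are chosen so that $\widehat\omega(P,Q)=\widehat\omega(Q,P)$. Then there is exactly one finite family of complex numbers $c_{\alpha;\beta}$, $\alpha,\beta\in B$, such that $$\sum_{i=1}^g du_i(P)\,dr_i(Q)=\frac{\sum_{\alpha,\beta\in B} c_{\alpha;\beta}\,x^\alpha y^\beta}{\det G_1(P)\det G_1(Q)}\,dx_1\,dy_1,$$ and if $\varphi_g(P)=x_1^{k_1}\cdots x_m^{k_m}$ and $\varphi_{g+1}(Q)=y_1^{\ell_1}\cdots y_m^{\ell_m}$ with $(k_1,\dots,k_m),(\ell_1,\dots,\ell_m)\in B$, then $$c_{k_1,\dots,k_m;\ell_1,\dots,\ell_m}=1.$$ -/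

import Mathlib

open scoped TensorProduct
open MvPolynomial KaehlerDifferential

noncomputable section

namespace Telescopic

/-! ### Telescopic sequences

A sequence `(a_1, …, a_m)` with `m = n + 1` is a function `a : Fin (n + 1) → ℕ`; the index `k` here
is the index `k + 1` of the usual notation. The indices `2 ≤ i ≤ m` correspond to `i.succ`,
`i : Fin n`, and then `i - 1` corresponds to `i.castSucc`. -/

section Sequence

variable {n : ℕ} (a : Fin (n + 1) → ℕ)

/-- `d_k = gcd (a_1, …, a_k)`. -/
def d (k : Fin (n + 1)) : ℕ := (Finset.Iic k).gcd a

/-- `d_{i-1} / d_i` for `2 ≤ i ≤ m` (an exact division). -/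
def ratio (i : Fin n) : ℕ := d a i.castSucc / d a i.succ

/-- The conditions on `(a_1, …, a_m)`: `m ≥ 2`, `gcd = 1`, `a_k ≥ 2`, and for `2 ≤ i ≤ m` the number
`a_i / d_i` is a combination of `a_1 / d_{i-1}, …, a_{i-1} / d_{i-1}` with coefficients in `ℤ_{≥ 0}`
(all the divisions are exact). -/
structure IsTelescopic : Prop where
  two_le_length : 2 ≤ n + 1
  gcd_eq_one : Finset.univ.gcd a = 1
  two_le : ∀ k, 2 ≤ a k
  mem_semigroup : ∀ i : Fin n, ∃ c : Fin (n + 1) → ℕ,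
    a i.succ / d a i.succ = ∑ k ∈ Finset.Iic i.castSucc, a k / d a i.castSucc * c k

/-- The weight `∑ a_k α_k` of an exponent. -/
def weight (α : Fin (n + 1) → ℕ) : ℕ := ∑ k, a k * α k

/-- The set `B(A_m)` of the exponents with `0 ≤ α_i ≤ d_{i-1} / d_i - 1` for `2 ≤ i ≤ m`. -/
def B : Set (Fin (n + 1) → ℕ) := {α | ∀ i : Fin n, α i.succ < ratio a i}

/-- `(ℓ_{i,1}, …, ℓ_{i,m})`: the element of `B(A_m)` (it exists and is unique for a telescopic
sequence) with `∑ a_j ℓ_{i,j} = a_i d_{i-1} / d_i`. -/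
def ell (i : Fin n) : Fin (n + 1) → ℕ :=
  Classical.epsilon fun α => α ∈ B a ∧ weight a α = a i.succ * ratio a i

open Classical in
/-- The finite set of the `α ∈ B(A_m)` of weight less than `a_i d_{i-1} / d_i`. Since `a_k ≥ 1`, the
entries of such an `α` are less than this bound too. -/
def lowerExponents (i : Fin n) : Finset (Fin (n + 1) → ℕ) :=
  (Fintype.piFinset fun _ => Finset.range (a i.succ * ratio a i)).filter
    fun α => α ∈ B a ∧ weight a α < a i.succ * ratio a i

end Sequence

/-! ### Points and differentials of the compact Riemann surface with function field `K`

The points of a compact Riemann surface `X` with field of meromorphic functions `K` are the discrete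
valuation rings of `K` that contain `ℂ`. -/

section Points

variable (K : Type) [CommRing K] [Algebra ℂ K]

/-- A point of the compact Riemann surface with function field `K`, given by the ring of the
functions that are holomorphic at the point. -/
structure Point where
  ring : Subalgebra ℂ K
  isDomain : IsDomain ring
  isDiscreteValuationRing : IsDiscreteValuationRing ring
  isFractionRing : IsFractionRing ring K

attribute [instance] Point.isDomain Point.isDiscreteValuationRing Point.isFractionRing

variable {K}

/-- The order of the pole of `f` at `p` (`0` if `f` is holomorphic at `p`): the least `k` such that
`t ^ k * f` is holomorphic at `p` for a function `t` that vanishes at `p` to first order. -/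
def Point.poleOrder (p : Point K) (f : K) : ℕ :=
  sInf {k : ℕ | ∀ t ∈ IsLocalRing.maximalIdeal p.ring ^ k, (t : K) * f ∈ p.ring}

/-- The meromorphic one-forms that are holomorphic at `p`: the sums of `f dh` with `f` and `h`
holomorphic at `p`. -/
def Point.holomorphicAt (p : Point K) : Submodule ℂ Ω[K⁄ℂ] :=
  (Submodule.span p.ring {w : Ω[K⁄ℂ] | ∃ h ∈ p.ring, w = D ℂ K h}).restrictScalars ℂ

variable (K)

/-- The space of the holomorphic one-forms. -/
def holomorphicForms : Submodule ℂ Ω[K⁄ℂ] := ⨅ p : Point K, p.holomorphicAt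

/-- The genus: the dimension of the space of the holomorphic one-forms. -/
def genus : ℕ := Module.finrank ℂ (holomorphicForms K)

end Points

/-! ### Two-forms in a pair of points

A ring homomorphism `P : K →ₐ[ℂ] L` is a point of the curve with coordinates in `L`, and `P f` is
the value `f(P)`. -/

section TwoForms

variable {K L : Type} [CommRing K] [Algebra ℂ K] [CommRing L] [Algebra ℂ L]

/-- The one-form `w(P)` with coefficients in `L`, where the elements of `S` count as constants. -/
def evalForm (P : K →ₐ[ℂ] L) (S : Subalgebra ℂ L) : Ω[K⁄ℂ] →+ Ω[L⁄S] :=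
  letI : Algebra K L := P.toRingHom.toAlgebra
  haveI : IsScalarTower ℂ K L := IsScalarTower.of_algebraMap_eq fun z => (P.commutes z).symm
  haveI : SMulCommClass S K L := ⟨fun s k l => by
    simp only [Algebra.smul_def, mul_left_comm]⟩
  (KaehlerDifferential.map ℂ S K L).toAddMonoidHom

/-- The two-forms in `P` and `Q`: sums of products of a one-form in `P` (functions of `Q` are
constants) and a one-form in `Q` (functions of `P` are constants). -/
abbrev TwoForm (P Q : K →ₐ[ℂ] L) : Type := Ω[L⁄Q.range] ⊗[L] Ω[L⁄P.range]

/-- The two-form `u(P) v(Q)`. -/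
def prodForm (P Q : K →ₐ[ℂ] L) (u v : Ω[K⁄ℂ]) : TwoForm P Q :=
  evalForm P Q.range u ⊗ₜ[L] evalForm Q P.range v

/-- `d_Q (f(P,Q) u(P))`, the differential being taken in `Q` with `P` fixed. -/
def dQ (P Q : K →ₐ[ℂ] L) (f : L) (u : Ω[K⁄ℂ]) : TwoForm P Q :=
  evalForm P Q.range u ⊗ₜ[L] D P.range L f

end TwoForms

/-! ### The telescopic curve -/

section Curve

variable {n : ℕ} (a : Fin (n + 1) → ℕ) (lam : Fin n → (Fin (n + 1) → ℕ) → ℂ)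

/-- The defining polynomials `F_i`, `2 ≤ i ≤ m`. -/
def F (i : Fin n) : MvPolynomial (Fin (n + 1)) ℂ :=
  X i.succ ^ ratio a i - ∏ j ∈ Finset.Iio i.succ, X j ^ ell a i j
    - ∑ α ∈ lowerExponents a i, C (lam i α) * ∏ k, X k ^ α k

/-- The matrix `G = (∂F_i / ∂x_k)`, `2 ≤ i ≤ m`, `1 ≤ k ≤ m`. -/
def G : Matrix (Fin n) (Fin (n + 1)) (MvPolynomial (Fin (n + 1)) ℂ) :=
  Matrix.of fun i k => pderiv k (F a lam i)

/-- `det G_k`, where `G_k` is `G` without its `k`-th column. -/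
def detG (k : Fin (n + 1)) : MvPolynomial (Fin (n + 1)) ℂ :=
  ((G a lam).submatrix id k.succAbove).det

/-- The affine curve `F_2 = ⋯ = F_m = 0` is nonsingular. -/
def IsNonsingular : Prop :=
  ∀ p : Fin (n + 1) → ℂ, (∀ i, eval p (F a lam i) = 0) → ((G a lam).map (eval p)).rank = n

/-- The coordinate ring of the affine curve. -/
abbrev CoordRing : Type := MvPolynomial (Fin (n + 1)) ℂ ⧸ Ideal.span (Set.range (F a lam))

/-- The field of the meromorphic functions on the compact Riemann surface `X`. -/
abbrev FunField : Type := FractionRing (CoordRing a lam)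

/-- The field of the rational functions on `X × X`. -/
abbrev FunField₂ : Type := FractionRing (FunField a lam ⊗[ℂ] FunField a lam)

/-- The first of the two generic points `P, Q` of `X`: `f ↦ f(P)`. -/
def fstPt : FunField a lam →ₐ[ℂ] FunField₂ a lam :=
  (IsScalarTower.toAlgHom ℂ (FunField a lam ⊗[ℂ] FunField a lam) (FunField₂ a lam)).comp
    Algebra.TensorProduct.includeLeft

/-- The second of the two generic points `P, Q` of `X`: `f ↦ f(Q)`. -/
def sndPt : FunField a lam →ₐ[ℂ] FunField₂ a lam :=
  (IsScalarTower.toAlgHom ℂ (FunField a lam ⊗[ℂ] FunField a lam) (FunField₂ a lam)).comp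
    Algebra.TensorProduct.includeRight

/-- The coordinate function `x_k` on `X`. -/
def x (k : Fin (n + 1)) : FunField a lam :=
  algebraMap (CoordRing a lam) (FunField a lam) (Ideal.Quotient.mk _ (X k))

/-- The function `x_1 ^ α_1 ⋯ x_m ^ α_m` on `X`. -/
def mon (α : Fin (n + 1) → ℕ) : FunField a lam := ∏ k, x a lam k ^ α k

/-- The function `det G_1` on `X`. -/
def detG₁ : FunField a lam := aeval (x a lam) (detG a lam 0)

/-- The one-form `dx_1`. -/
def dx₁ : Ω[FunField a lam⁄ℂ] := D ℂ (FunField a lam) (x a lam 0)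

/-- `p` lies on the affine curve: the regular functions of the affine curve are holomorphic at
`p`. -/
def IsAffinePoint (p : Point (FunField a lam)) : Prop :=
  ∀ f : CoordRing a lam, algebraMap (CoordRing a lam) (FunField a lam) f ∈ p.ring

/-- The one-forms that are holomorphic on `X` away from infinity. -/
def formsWithPoleOnlyAtInfinity : Submodule ℂ Ω[FunField a lam⁄ℂ] :=
  ⨅ (p : Point (FunField a lam)) (_ : IsAffinePoint a lam p), p.holomorphicAt

/-- `φ` enumerates the exponents in `B(A_m)` according to the order of the pole of the corresponding
monomials at the point `infty`. The enumeration starts with `0`: the monomial `φ_i`, `i ≥ 1`, of the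
usual notation has the exponent `φ (i - 1)`. -/
structure IsEnumeration (infty : Point (FunField a lam)) (φ : ℕ → Fin (n + 1) → ℕ) : Prop where
  range_eq : Set.range φ = B a
  strictMono : StrictMono fun i => infty.poleOrder (mon a lam (φ i))

/-- The one-form `du_{i+1} = - φ_{g-i} / det G_1 dx_1`, `0 ≤ i < g`; here `φ_{g-i}` is the monomial
with the exponent `φ (g - 1 - i)`. (`FunField` and `FunField₂` are fields, so that `Ring.inverse` is
the ordinary inverse.) -/
def du (φ : ℕ → Fin (n + 1) → ℕ) {g : ℕ} (i : Fin g) : Ω[FunField a lam⁄ℂ] :=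
  -((mon a lam (φ (g - 1 - i)) * Ring.inverse (detG₁ a lam)) • dx₁ a lam)

variable {a lam}

/-- The matrix `H(P,Q)`: with `x = x(P)` and `y = x(Q)`, the entry `h_{ij}` is
`(F_i(y_1,…,y_{j-1},x_j,x_{j+1},…,x_m) - F_i(y_1,…,y_{j-1},y_j,x_{j+1},…,x_m)) / (x_j - y_j)`. -/
def H (P Q : FunField a lam →ₐ[ℂ] FunField₂ a lam) : Matrix (Fin n) (Fin n) (FunField₂ a lam) :=
  Matrix.of fun i j =>
    (aeval (fun k => if k < j.succ then Q (x a lam k) else P (x a lam k)) (F a lam i)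
      - aeval (fun k => if k ≤ j.succ then Q (x a lam k) else P (x a lam k)) (F a lam i))
      * Ring.inverse (P (x a lam j.succ) - Q (x a lam j.succ))

/-- The function `det H(P,Q) / ((x_1 - y_1) det G_1(P))`, the coefficient of `dx_1` in `Ω(P,Q)`. -/
def coeffΩ (P Q : FunField a lam →ₐ[ℂ] FunField₂ a lam) : FunField₂ a lam :=
  (H P Q).det * Ring.inverse ((P (x a lam 0) - Q (x a lam 0)) * P (detG₁ a lam))

/-- `∑ du_i(P) dr_i(Q)`. -/
def sumForm (φ : ℕ → Fin (n + 1) → ℕ) {g : ℕ} (dr : Fin g → Ω[FunField a lam⁄ℂ])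
    (P Q : FunField a lam →ₐ[ℂ] FunField₂ a lam) : TwoForm P Q :=
  ∑ i, prodForm P Q (du a lam φ i) (dr i)

/-- The two-form `ω̂(P,Q) = d_Q Ω(P,Q) + ∑ du_i(P) dr_i(Q)`. -/
def omegaHat (φ : ℕ → Fin (n + 1) → ℕ) {g : ℕ} (dr : Fin g → Ω[FunField a lam⁄ℂ])
    (P Q : FunField a lam →ₐ[ℂ] FunField₂ a lam) : TwoForm P Q :=
  dQ P Q (coeffΩ P Q) (dx₁ a lam) + sumForm φ dr P Q

/-- `ω̂(P,Q) = ω̂(Q,P)`, where `u(Q) v(P)` and `v(P) u(Q)` are identified. -/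
def OmegaHatSymmetric (φ : ℕ → Fin (n + 1) → ℕ) {g : ℕ}
    (dr : Fin g → Ω[FunField a lam⁄ℂ]) : Prop :=
  omegaHat φ dr (fstPt a lam) (sndPt a lam) =
    TensorProduct.comm (FunField₂ a lam) _ _ (omegaHat φ dr (sndPt a lam) (fstPt a lam))

/-- `c` is the family of the coefficients `c_{α;β}`, `α, β ∈ B(A_m)`, in
`∑ du_i(P) dr_i(Q) = (∑ c_{α;β} x^α y^β) / (det G_1(P) det G_1(Q)) dx_1 dy_1`. -/
def IsExpansion (φ : ℕ → Fin (n + 1) → ℕ) {g : ℕ}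
    (dr : Fin g → Ω[FunField a lam⁄ℂ])
    (c : ((Fin (n + 1) → ℕ) × (Fin (n + 1) → ℕ)) →₀ ℂ) : Prop :=
  (∀ p ∈ c.support, p.1 ∈ B a ∧ p.2 ∈ B a) ∧
  sumForm φ dr (fstPt a lam) (sndPt a lam) =
    ((c.sum fun p z => z • (fstPt a lam (mon a lam p.1) * sndPt a lam (mon a lam p.2)))
      * Ring.inverse (fstPt a lam (detG₁ a lam) * sndPt a lam (detG₁ a lam))) •
      prodForm (fstPt a lam) (sndPt a lam) (dx₁ a lam) (dx₁ a lam)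

end Curve

end Telescopic

end

/-! Give x_k the weight a_k. The weights of the exponents in B are pairwise distinct and form a
numerical semigroup. By uniqueness of normal forms this semigroup is symmetric about c = `frob a`:
an integer m is a weight if and only if c - m is not. So c is a gap, while c - 1 and c + 1 are
weights, because 1 and -1 are not.

On the coordinate ring T the monomials with exponents in B form a basis, and the weight is the pole
order at infinity. The signed minors of G define a derivation δ of T. By nonsingularity there is a
form η on the affine curve with df = δ(f) η, so every one-form is a function times η. The
holomorphic forms are the f η with f of degree at most c - 1. Hence φ_g has weight c - 1, φ_{g+1}
has weight c + 1, and du_i = -φ_{g+1-i} η. The dr_i are W_i η with W_i in T. The wanted coefficients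
are therefore those of s = -∑ φ_{g+1-i} ⊗ W_i in the product basis of T ⊗ T, and they exist and are
unique.

Let A = s(Q,P) - s(P,Q). Symmetry of the two-form says that (x_1 - y_1)^2 A is an explicit
expression in det H and its derivatives (`symmetryDefect_eq`). Now pass to leading terms for the
total weight, recording x^α y^β as u^k with k the weight of β. The leading term of det H is the
numerator N = (1 - u^{a_1}) E, where E is the generating series of the semigroup. On leading terms δ
multiplies by the weight. Dividing by (1 - u^{a_1})^2, the part of A in degree 2c is u^{c+1} E' + c
E - u E'. Its coefficient at u^{c+1} is E_1 + c E_{c+1} - (c + 1) E_{c+1} = -1, since E_1 = 0 and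
E_{c+1} = 1 (`coeff_eq_neg_one`, `repr_symmetryDefect`). This is the coefficient of A at (φ_g,
φ_{g+1}). The first factors of s are only φ_1, …, φ_g, so the term s(Q,P) contributes nothing there,
and the coefficient of s is 1 (`IsCurve.expansion`). -/

noncomputable section

namespace Telescopic

/-! ### Normal forms and the symmetric semigroup of a telescopic sequence. -/

section Sequence

variable {n : ℕ} {a : Fin (n + 1) → ℕ}

lemma d_zero : d a 0 = a 0 := by
  have : (Finset.Iic (0 : Fin (n + 1))) = {0} := by
    ext k; simp
  simp [d, this]

lemma d_succ (i : Fin n) : d a i.succ = Nat.gcd (a i.succ) (d a i.castSucc) := by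
  have : Finset.Iic i.succ = insert i.succ (Finset.Iic i.castSucc) := by
    ext k
    simp only [Finset.mem_Iic, Finset.mem_insert, Fin.le_def, Fin.ext_iff, Fin.val_succ,
      Fin.val_castSucc]
    omega
  rw [d, this, Finset.gcd_insert]
  rfl

lemma d_dvd {j k : Fin (n + 1)} (h : j ≤ k) : d a k ∣ a j :=
  Finset.gcd_dvd (Finset.mem_Iic.2 h)

lemma IsTelescopic.pos (ha : IsTelescopic a) (k : Fin (n + 1)) : 0 < a k :=
  lt_of_lt_of_le two_pos (ha.two_le k)

lemma IsTelescopic.d_pos (ha : IsTelescopic a) (k : Fin (n + 1)) : 0 < d a k :=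
  Nat.pos_of_dvd_of_pos (d_dvd le_rfl) (ha.pos k)

lemma d_succ_dvd (i : Fin n) : d a i.succ ∣ d a i.castSucc := by
  rw [d_succ]; exact Nat.gcd_dvd_right _ _

lemma ratio_mul_d (i : Fin n) : ratio a i * d a i.succ = d a i.castSucc :=
  Nat.div_mul_cancel (d_succ_dvd i)

lemma IsTelescopic.ratio_pos (ha : IsTelescopic a) (i : Fin n) : 0 < ratio a i :=
  Nat.pos_of_mul_pos_right (by rw [ratio_mul_d]; exact ha.d_pos _) 

lemma IsTelescopic.d_last (ha : IsTelescopic a) : d a (Fin.last n) = 1 := by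
  have : Finset.Iic (Fin.last n) = Finset.univ := by
    ext k; simp [Fin.le_last]
  rw [d, this, ha.gcd_eq_one]

/-- The product of the quotients d_{i-1} / d_i telescopes from d_1 = a_1 down to d_m = 1. -/
lemma IsTelescopic.prod_ratio (ha : IsTelescopic a) : ∏ i, ratio a i = a 0 := by
  have key : ∀ k : Fin (n + 1), (∏ i : Fin n with i.castSucc < k, ratio a i) * d a k = a 0 := by
    intro k
    induction k using Fin.induction with
    | zero => simp [d_zero]
    | succ i ih =>
      have : ({j : Fin n | j.castSucc < i.succ} : Finset (Fin n)) =
          insert i ({j : Fin n | j.castSucc < i.castSucc} : Finset (Fin n)) := by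
        ext j
        simp only [Finset.mem_filter, Finset.mem_insert, Fin.lt_def, Fin.ext_iff, Fin.val_succ,
          Fin.val_castSucc, Finset.mem_univ, true_and]
        omega
      rw [this, Finset.prod_insert (by simp), ← ih, ← ratio_mul_d i]
      ring
  have := key (Fin.last n)
  rw [ha.d_last, mul_one] at this
  rw [← this]
  congr 1
  ext j
  simp [Fin.castSucc_lt_last]

lemma IsTelescopic.coprime (ha : IsTelescopic a) (i : Fin n) :
    Nat.Coprime (ratio a i) (a i.succ / d a i.succ) := by
  have h := Nat.coprime_div_gcd_div_gcd (m := a i.succ) (n := d a i.castSucc)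
    (by rw [← d_succ]; exact ha.d_pos _)
  rw [← d_succ] at h
  exact h.symm

lemma weight_add (α β : Fin (n + 1) → ℕ) : weight a (α + β) = weight a α + weight a β := by
  simp [weight, mul_add, Finset.sum_add_distrib]

lemma weight_single (k : Fin (n + 1)) (e : ℕ) : weight a (Pi.single k e) = a k * e := by
  rw [weight, Finset.sum_eq_single k] <;> simp +contextual

lemma weight_smul (e : ℕ) (α : Fin (n + 1) → ℕ) : weight a (e • α) = e * weight a α := by
  simp only [weight, Finset.mul_sum, Pi.smul_apply, smul_eq_mul]
  exact Finset.sum_congr rfl fun _ _ => by ring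

/-- An integral relation between the `a_k` whose entries are small vanishes. -/
lemma IsTelescopic.eq_zero_of_sum_eq_zero (ha : IsTelescopic a) (z : Fin (n + 1) → ℤ)
    (hz : ∑ k, (a k : ℤ) * z k = 0) (hlt : ∀ i : Fin n, |z i.succ| < ratio a i) : z = 0 := by
  suffices key : ∀ k : Fin (n + 1), (∀ j, k < j → z j = 0) → ∀ j, z j = 0 from
    funext (key (Fin.last n) fun j hj => absurd hj (not_lt.2 (Fin.le_last j)))
  -- The entries are eliminated from the last to the first; the induction runs over the largest
  -- index at which z may still be nonzero.
  intro k
  induction k using Fin.induction with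
  | zero =>
    intro h0
    have : ∀ j, j ≠ 0 → z j = 0 := fun j hj => h0 j (Fin.pos_of_ne_zero hj)
    rw [Finset.sum_eq_single 0 (fun j _ hj => by rw [this j hj, mul_zero]) (by simp)] at hz
    have h00 : z 0 = 0 := by
      rcases mul_eq_zero.1 hz with h | h
      · have := ha.pos 0; omega
      · exact h
    intro j
    by_cases hj : j = 0
    · rw [hj, h00]
    · exact this j hj
  | succ i ih =>
    intro h0
    apply ih
    -- All other surviving terms are divisible by d_{i-1}. Hence r_i divides (a_i / d_i) z_i, so by
    -- coprimality it divides z_i, whose absolute value is less than r_i.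
    have hi : z i.succ = 0 := by
      have h1 : (d a i.castSucc : ℤ) ∣ a i.succ * z i.succ := by
        have h2 := Finset.add_sum_erase Finset.univ (fun k => (a k : ℤ) * z k)
          (Finset.mem_univ i.succ)
        rw [hz] at h2
        rw [eq_neg_of_add_eq_zero_left h2, dvd_neg]
        refine Finset.dvd_sum fun j hj => ?_
        by_cases hj' : i.succ < j
        · rw [h0 j hj', mul_zero]; exact dvd_zero _
        · have : j ≤ i.castSucc := by
            have h3 := (Finset.mem_erase.1 hj).1
            simp only [Fin.lt_def, Fin.le_def, Ne, Fin.ext_iff, Fin.val_succ,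
              Fin.val_castSucc] at *
            omega
          exact Dvd.dvd.mul_right (Int.natCast_dvd_natCast.2 (d_dvd this)) _
      have h4 : (ratio a i : ℤ) ∣ ((a i.succ / d a i.succ : ℕ) : ℤ) * z i.succ := by
        have hd : (d a i.succ : ℤ) ≠ 0 := by exact_mod_cast (ha.d_pos i.succ).ne'
        apply Int.dvd_of_mul_dvd_mul_left hd
        rw [← mul_assoc, ← Nat.cast_mul, ← Nat.cast_mul,
          Nat.mul_div_cancel' (d_dvd (le_refl i.succ)), mul_comm (d a i.succ), ratio_mul_d]
        exact h1
      have h5 : (ratio a i : ℤ) ∣ z i.succ :=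
        IsCoprime.dvd_of_dvd_mul_left (Nat.isCoprime_iff_coprime.2 (ha.coprime i)) h4
      exact Int.eq_zero_of_abs_lt_dvd h5 (hlt i)
    intro j hj
    by_cases hj' : j = i.succ
    · rw [hj', hi]
    · apply h0
      simp only [Fin.lt_def, Fin.ext_iff, Fin.val_succ, Fin.val_castSucc] at *
      omega

lemma IsTelescopic.weight_injOn (ha : IsTelescopic a) : Set.InjOn (weight a) (B a) := by
  intro α hα β hβ h
  have := ha.eq_zero_of_sum_eq_zero (fun k => (α k : ℤ) - β k)
    (by
      have h' : ((weight a α : ℕ) : ℤ) = weight a β := by rw [h]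
      simp only [weight, Nat.cast_sum, Nat.cast_mul] at h'
      simp only [mul_sub, Finset.sum_sub_distrib, h', sub_self])
    (fun i => by
      have h1 := hα i
      have h2 := hβ i
      rw [abs_lt]; constructor <;> omega)
  funext k
  have := congrFun this k
  simp only [Pi.zero_apply] at this
  omega

/-- The semigroup condition multiplied by d_{i-1} = r_i d_i. -/
lemma IsTelescopic.exists_weight_eq (ha : IsTelescopic a) (i : Fin n) :
    ∃ γ : Fin (n + 1) → ℕ, (∀ j, i.castSucc < j → γ j = 0) ∧
      weight a γ = a i.succ * ratio a i := by
  obtain ⟨c, hc⟩ := ha.mem_semigroup i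
  refine ⟨fun k => if k ≤ i.castSucc then c k else 0, fun j hj => if_neg (not_le.2 hj), ?_⟩
  have h1 : a i.succ * ratio a i = d a i.castSucc * (a i.succ / d a i.succ) := by
    conv_lhs => rw [← Nat.div_mul_cancel (d_dvd (a := a) (le_refl i.succ))]
    rw [← ratio_mul_d i]
    ring
  rw [h1, hc, Finset.mul_sum, weight]
  simp only [mul_ite, mul_zero]
  rw [← Finset.sum_filter]
  refine Finset.sum_congr (by ext; simp) fun k hk => ?_
  rw [← mul_assoc, Nat.mul_div_cancel' (d_dvd (by simpa using hk))]

/-- Replacing an exponent by one of the same weight with small entries at the places `≤ k`; at each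
step `r_i` factors `x_i` are replaced by a monomial in the previous variables. -/
lemma IsTelescopic.reduce_induction (ha : IsTelescopic a)
    (γ₀ : Fin n → Fin (n + 1) → ℕ) (h₀ : ∀ i j, i.castSucc < j → γ₀ i j = 0)
    (hw : ∀ i, weight a (γ₀ i) = a i.succ * ratio a i)
    (r : (Fin (n + 1) → ℕ) → (Fin (n + 1) → ℕ) → Prop) (hrefl : ∀ α, r α α)
    (htrans : ∀ α β γ, r α β → r β γ → r α γ)
    (hstep : ∀ (i : Fin n) (γ : Fin (n + 1) → ℕ) , 
      r (γ + Pi.single i.succ (ratio a i)) (γ + γ₀ i))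
    (k : Fin (n + 1)) (γ : Fin (n + 1) → ℕ) :
    ∃ α : Fin (n + 1) → ℕ, r γ α ∧ weight a α = weight a γ ∧ (∀ j, k < j → α j = γ j) ∧
      ∀ i : Fin n, i.succ ≤ k → α i.succ < ratio a i := by
  induction k using Fin.induction generalizing γ with
  | zero =>
    refine ⟨γ, hrefl γ, rfl, fun _ _ => rfl, fun i hi => absurd hi ?_⟩
    simp
  | succ i ih =>
    have hmul : ∀ (q : ℕ) (γ' : Fin (n + 1) → ℕ),
        r (γ' + q • Pi.single i.succ (ratio a i)) (γ' + q • γ₀ i) := by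
      intro q
      induction q with
      | zero => intro γ'; simpa using hrefl γ'
      | succ q ihq =>
        intro γ'
        have h1 := hstep i (γ' + q • Pi.single i.succ (ratio a i))
        have h2 := ihq (γ' + γ₀ i)
        rw [succ_nsmul, succ_nsmul, ← add_assoc, ← add_assoc]
        refine htrans _ _ _ h1 ?_
        convert h2 using 1 <;> abel
    set γ' : Fin (n + 1) → ℕ := Function.update γ i.succ (γ i.succ % ratio a i) with hγ'
    set q := γ i.succ / ratio a i
    have hγ : γ = γ' + q • Pi.single i.succ (ratio a i) := by
      funext j
      by_cases hj : j = i.succ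
      · subst hj
        simp only [hγ', Pi.add_apply, Function.update_self, Pi.smul_apply, Pi.single_eq_same,
          smul_eq_mul]
        rw [mul_comm]
        exact (Nat.mod_add_div _ _).symm
      · simp [hγ', Function.update_of_ne hj, Pi.single_eq_of_ne hj]
    -- The i-th entry is already the remainder modulo r_i, and the previous places to which the
    -- induction hypothesis applies do not affect it, since γ₀ i is supported there.
    obtain ⟨α, h1, h2, h3, h4⟩ := ih (γ' + q • γ₀ i)
    refine ⟨α, htrans _ _ _ (by conv => arg 1; rw [hγ]
                                exact hmul q γ') h1, ?_, ?_, ?_⟩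
    · rw [h2]
      conv_rhs => rw [hγ]
      rw [weight_add, weight_add, weight_smul, weight_smul, hw, weight_single]
    · intro j hj
      have hj' : i.castSucc < j := lt_trans (Fin.castSucc_lt_succ) hj
      rw [h3 j hj']
      simp [h₀ i j hj', hγ', Function.update_of_ne hj.ne']
    · intro i' hi'
      by_cases h : i' = i
      · subst h
        rw [h3 _ (Fin.castSucc_lt_succ)]
        simp only [hγ', Pi.add_apply, Function.update_self, Pi.smul_apply,
          h₀ _ _ (Fin.castSucc_lt_succ (i := i'))]
        simpa using Nat.mod_lt _ (ha.ratio_pos i')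
      · apply h4
        simp only [Fin.le_def, Fin.ext_iff, Fin.val_succ, Fin.val_castSucc] at *
        omega

/-- Only the bookkeeping of exponents matters here, so the relation in `reduce_induction` is
trivial. With congruence modulo lower weight, the same reduction later gives normal forms of
functions. -/
lemma IsTelescopic.exists_mem_B (ha : IsTelescopic a) (k : Fin (n + 1)) (γ : Fin (n + 1) → ℕ)
    (hγ : ∀ j, k < j → γ j = 0) :
    ∃ α ∈ B a, weight a α = weight a γ ∧ ∀ j, k < j → α j = 0 := by
  choose γ₀ h₀ hw using ha.exists_weight_eq
  obtain ⟨α, -, h2, h3, h4⟩ := ha.reduce_induction γ₀ h₀ hw (fun _ _ => True) (fun _ => trivial)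
    (fun _ _ _ _ _ => trivial) (fun _ _ => trivial) k γ
  have h5 : ∀ j, k < j → α j = 0 := fun j hj => by rw [h3 j hj, hγ j hj]
  refine ⟨α, fun i => ?_, h2, h5⟩
  by_cases hi : i.succ ≤ k
  · exact h4 i hi
  · rw [h5 _ (not_le.1 hi)]
    exact ha.ratio_pos i

/-- The support condition is not part of the definition of `ell`. It follows from uniqueness, since
the reduction of a combination of the previous variables involves only these. -/
lemma IsTelescopic.ell_spec (ha : IsTelescopic a) (i : Fin n) :
    ell a i ∈ B a ∧ weight a (ell a i) = a i.succ * ratio a i ∧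
      ∀ j, i.castSucc < j → ell a i j = 0 := by
  obtain ⟨γ, h1, h2⟩ := ha.exists_weight_eq i
  obtain ⟨α, hα, h3, h4⟩ := ha.exists_mem_B i.castSucc γ h1
  have h5 : ell a i ∈ B a ∧ weight a (ell a i) = a i.succ * ratio a i :=
    Classical.epsilon_spec (p := fun α => α ∈ B a ∧ weight a α = a i.succ * ratio a i)
      ⟨α, hα, h3.trans h2⟩
  have h6 : ell a i = α := ha.weight_injOn h5.1 hα (by rw [h5.2, h3, h2])
  exact ⟨h5.1, h5.2, by rw [h6]; exact h4⟩

/-- Every integer is a combination of the `a_k` with small coefficients at the places `≥ 2`. -/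
lemma IsTelescopic.exists_int_repr (ha : IsTelescopic a) (m : ℤ) :
    ∃ z : Fin (n + 1) → ℤ, ∑ k, (a k : ℤ) * z k = m ∧
      ∀ i : Fin n, 0 ≤ z i.succ ∧ z i.succ < ratio a i := by
  suffices key : ∀ (k : Fin (n + 1)) (m : ℤ), (d a k : ℤ) ∣ m →
      ∃ z : Fin (n + 1) → ℤ, ∑ k, (a k : ℤ) * z k = m ∧
      (∀ i : Fin n, 0 ≤ z i.succ ∧ z i.succ < ratio a i) ∧ ∀ j, k < j → z j = 0 by
    obtain ⟨z, h1, h2, -⟩ := key (Fin.last n) m (by rw [ha.d_last]; simp)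
    exact ⟨z, h1, h2⟩
  intro k
  induction k using Fin.induction with
  | zero =>
    rintro m ⟨q, hq⟩
    refine ⟨Pi.single 0 q, ?_, fun i => ?_, fun j hj => Pi.single_eq_of_ne hj.ne' _⟩
    · rw [Finset.sum_eq_single 0 (fun j _ hj => by rw [Pi.single_eq_of_ne hj, mul_zero])
        (by simp), Pi.single_eq_same, hq, d_zero]
    · rw [Pi.single_eq_of_ne (Fin.succ_ne_zero i)]
      have := ha.ratio_pos i
      omega
  | succ i ih =>
    rintro m ⟨q, hq⟩
    have hb := Int.gcd_eq_gcd_ab (a i.succ) (d a i.castSucc)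
    rw [Int.gcd_natCast_natCast, ← d_succ] at hb
    set u := Int.gcdA (a i.succ) (d a i.castSucc)
    set v := Int.gcdB (a i.succ) (d a i.castSucc)
    have hr : (0 : ℤ) < ratio a i := by exact_mod_cast ha.ratio_pos i
    -- With the Bézout relation d_i = a_i u + d_{i-1} v and m = q d_i, the coefficient u q of a_i
    -- may be reduced modulo r_i, because a_i r_i is a multiple of d_{i-1}.
    have hdvd : (d a i.castSucc : ℤ) ∣ m - a i.succ * (u * q % ratio a i) := by
      have h1 : (a i.succ : ℤ) * ratio a i = d a i.castSucc * (a i.succ / d a i.succ : ℕ) := by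
        rw [← ratio_mul_d i]
        conv_lhs => rw [← Nat.div_mul_cancel (d_dvd (a := a) (le_refl i.succ))]
        push_cast; ring
      have h2 := Int.emod_add_mul_ediv (u * q) (ratio a i)
      refine ⟨v * q + (a i.succ / d a i.succ : ℕ) * (u * q / ratio a i), ?_⟩
      have : (m : ℤ) = (a i.succ * u + d a i.castSucc * v) * q := by rw [hq, hb]
      rw [this, mul_add, ← mul_assoc (d a i.castSucc : ℤ) ((a i.succ / d a i.succ : ℕ) : ℤ), ← h1]
      linear_combination (-(a i.succ : ℤ)) * h2
    obtain ⟨z, h1, h2, h3⟩ := ih _ hdvd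
    have hz : z i.succ = 0 := h3 _ Fin.castSucc_lt_succ
    refine ⟨z + Pi.single i.succ (u * q % ratio a i), ?_, fun i' => ?_, fun j hj => ?_⟩
    · simp only [Pi.add_apply, mul_add, Finset.sum_add_distrib, h1]
      rw [Finset.sum_eq_single i.succ (fun j _ hj => by rw [Pi.single_eq_of_ne hj, mul_zero])
        (by simp), Pi.single_eq_same]
      ring
    · by_cases h : i' = i
      · subst h
        simp only [Pi.add_apply, hz, Pi.single_eq_same, zero_add]
        exact ⟨Int.emod_nonneg _ hr.ne', Int.emod_lt_of_pos _ hr⟩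
      · have : i'.succ ≠ i.succ := fun h' => h (Fin.succ_injective _ h')
        simpa [Pi.single_eq_of_ne this] using h2 i'
    · rw [Pi.add_apply, h3 j (lt_trans Fin.castSucc_lt_succ hj),
        Pi.single_eq_of_ne hj.ne', zero_add]

variable (a) in
/-- The Frobenius number of the semigroup generated by the `a_k`. -/
def frob : ℤ := ∑ i : Fin n, (a i.succ : ℤ) * (ratio a i - 1) - a 0

/-- Write m = ∑ a_k z_k with 0 ≤ z_i < r_i for i ≥ 2. By uniqueness m is a weight exactly when z_1 ≥
0. The substitution z_1 ↦ -1 - z_1, z_i ↦ r_i - 1 - z_i turns m into `frob a - m`, and exactly one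
of z_1 and -1 - z_1 is nonnegative. -/
lemma IsTelescopic.exists_iff_not_exists (ha : IsTelescopic a) (m : ℤ) :
    (∃ α ∈ B a, (weight a α : ℤ) = m) ↔ ¬ ∃ α ∈ B a, (weight a α : ℤ) = frob a - m := by
  have huniq : ∀ (m : ℤ) (z : Fin (n + 1) → ℤ), ∑ k, (a k : ℤ) * z k = m →
      (∀ i : Fin n, 0 ≤ z i.succ ∧ z i.succ < ratio a i) →
      ((∃ α ∈ B a, (weight a α : ℤ) = m) ↔ 0 ≤ z 0) := by
    intro m z h1 h2
    constructor
    · rintro ⟨α, hα, h⟩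
      have := ha.eq_zero_of_sum_eq_zero (fun k => z k - α k)
        (by
          simp only [mul_sub, Finset.sum_sub_distrib, h1]
          rw [← h]; simp [weight])
        (fun i => by
          have h1 := hα i
          have h2 := h2 i
          rw [abs_lt]; constructor <;> omega)
      have := congrFun this 0
      simp only [Pi.zero_apply] at this
      omega
    · intro h0
      have hz : ∀ k, 0 ≤ z k := fun k => by
        refine Fin.cases h0 (fun i => (h2 i).1) k
      refine ⟨fun k => (z k).toNat, fun i => ?_, ?_⟩
      · have := h2 i
        simp only
        omega
      · rw [← h1, weight]
        push_cast
        exact Finset.sum_congr rfl fun k _ => by rw [Int.toNat_of_nonneg (hz k)]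
  obtain ⟨z, h1, h2⟩ := ha.exists_int_repr m
  rw [huniq m z h1 h2, huniq (frob a - m)
    (Fin.cons (-1 - z 0) fun i => ratio a i - 1 - z i.succ) ?_ ?_]
  · simp only [Fin.cons_zero]; omega
  · rw [← h1, Fin.sum_univ_succ, Fin.sum_univ_succ (n := n)]
    simp only [Fin.cons_zero, Fin.cons_succ, frob, mul_sub, Finset.sum_sub_distrib]
    ring
  · intro i
    have := h2 i
    simp only [Fin.cons_succ]
    omega

/-- This is the place where a_k ≥ 2, and not merely a_k ≥ 1, is needed. It makes `frob a - 1` a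
weight and removes the linear term of the generating series. -/
lemma IsTelescopic.weight_ne_one (ha : IsTelescopic a) (α : Fin (n + 1) → ℕ) :
    weight a α ≠ 1 := by
  intro h
  have h1 : ∃ k, α k ≠ 0 := by
    by_contra! h0
    simp [weight, h0] at h
  obtain ⟨k, hk⟩ := h1
  have h2 : a k * α k ≤ weight a α :=
    Finset.single_le_sum (f := fun k => a k * α k) (fun _ _ => Nat.zero_le _) (Finset.mem_univ k)
  have h3 := ha.two_le k
  have h4 : 1 ≤ α k := Nat.one_le_iff_ne_zero.2 hk
  nlinarith

lemma IsTelescopic.zero_mem_B (ha : IsTelescopic a) : (0 : Fin (n + 1) → ℕ) ∈ B a :=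
  fun i => ha.ratio_pos i

lemma IsTelescopic.exists_mem_B_weight_frob_sub_one (ha : IsTelescopic a) :
    ∃ α ∈ B a, (weight a α : ℤ) = frob a - 1 := by
  by_contra h
  obtain ⟨α, -, h⟩ := (ha.exists_iff_not_exists 1).2 h
  exact ha.weight_ne_one α (by exact_mod_cast h)

lemma IsTelescopic.exists_mem_B_weight_frob_add_one (ha : IsTelescopic a) :
    ∃ α ∈ B a, (weight a α : ℤ) = frob a + 1 := by
  by_contra h
  obtain ⟨α, -, h⟩ := (ha.exists_iff_not_exists (-1)).2 (by rwa [sub_neg_eq_add])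
  omega

lemma IsTelescopic.weight_ne_frob (ha : IsTelescopic a) {α : Fin (n + 1) → ℕ} (hα : α ∈ B a) :
    (weight a α : ℤ) ≠ frob a := by
  intro h
  exact (ha.exists_iff_not_exists 0).1 ⟨0, ha.zero_mem_B, by simp [weight]⟩
    ⟨α, hα, by rw [h, sub_zero]⟩

lemma IsTelescopic.frob_pos (ha : IsTelescopic a) : 1 ≤ frob a := by
  obtain ⟨α, -, h⟩ := ha.exists_mem_B_weight_frob_sub_one
  omega

end Sequence

/-! ### The weight filtration of the coordinate ring. -/

section Filtration

set_option linter.unusedSectionVars false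

variable {n : ℕ} (a : Fin (n + 1) → ℕ) (lam : Fin n → (Fin (n + 1) → ℕ) → ℂ)

variable {T : Type*} [CommRing T] [Algebra ℂ T] (ξ : Fin (n + 1) → T)

/-- The monomials in the elements `ξ_1, …, ξ_m` of a ring. -/
def monom (α : Fin (n + 1) → ℕ) : T := ∏ k, ξ k ^ α k

/-- `ξ_1, …, ξ_m` generate the `ℂ`-algebra `T`, and the relations between them are those given
by the equations of the curve. -/
structure IsGenericPoint : Prop where
  aeval_F : ∀ i, aeval ξ (F a lam i) = 0
  mem_span : ∀ p, aeval (R := ℂ) ξ p = 0 → p ∈ Ideal.span (Set.range (F a lam))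
  surjective : Function.Surjective (aeval (R := ℂ) ξ)

lemma monom_add (α β : Fin (n + 1) → ℕ) :
    monom ξ (α + β) = monom ξ α * monom ξ β := by
  simp [monom, pow_add, Finset.prod_mul_distrib]

lemma monom_zero : monom ξ 0 = 1 := by simp [monom]

lemma monom_single (k : Fin (n + 1)) (e : ℕ) :
    monom ξ (Pi.single k e) = ξ k ^ e := by
  rw [monom, Finset.prod_eq_single k] <;> simp +contextual

lemma aeval_monomial_eq (α : Fin (n + 1) →₀ ℕ) (z : ℂ) :
    aeval ξ (monomial α z) = z • monom ξ α := by
  rw [aeval_monomial, Algebra.smul_def, Finsupp.prod_fintype _ _ (fun _ => pow_zero _)]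
  rfl

variable {a lam ξ}

lemma IsGenericPoint.span_range_monom (hξ : IsGenericPoint a lam ξ) :
    Submodule.span ℂ (Set.range (monom ξ)) = ⊤ := by
  rw [eq_top_iff]
  rintro f -
  obtain ⟨p, rfl⟩ := hξ.surjective f
  induction p using MvPolynomial.induction_on' with
  | monomial α z =>
    change aeval ξ (monomial α z) ∈ _
    rw [aeval_monomial_eq]
    exact Submodule.smul_mem _ _ (Submodule.subset_span ⟨_, rfl⟩)
  | add p q hp hq => rw [map_add]; exact Submodule.add_mem _ hp hq

variable (a ξ)

/-- The functions of pole order at most `e` at infinity: the span of the monomials of weight at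
most `e`. -/
def fil (e : ℤ) : Submodule ℂ T :=
  Submodule.span ℂ (monom ξ '' {γ | (weight a γ : ℤ) ≤ e})

variable {a}

lemma monom_mem_fil {γ : Fin (n + 1) → ℕ} {e : ℤ} (h : (weight a γ : ℤ) ≤ e) :
    monom ξ γ ∈ fil a ξ e := Submodule.subset_span ⟨γ, h, rfl⟩

lemma fil_mono {e e' : ℤ} (h : e ≤ e') : fil a ξ e ≤ fil a ξ e' :=
  Submodule.span_mono (Set.image_mono fun _ hγ => le_trans hγ h)

lemma mul_mem_fil {e e' : ℤ} {f g : T} (hf : f ∈ fil a ξ e)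
    (hg : g ∈ fil a ξ e') : f * g ∈ fil a ξ (e + e') := by
  induction hf, hg using Submodule.span_induction₂ with
  | mem_mem f g hf hg =>
    obtain ⟨γ, hγ, rfl⟩ := hf
    obtain ⟨δ, hδ, rfl⟩ := hg
    rw [← monom_add]
    apply monom_mem_fil
    rw [weight_add]
    push_cast
    exact add_le_add hγ hδ
  | zero_left => simp
  | zero_right => simp
  | add_left f f' g _ _ _ h h' => rw [add_mul]; exact add_mem h h'
  | add_right f g g' _ _ _ h h' => rw [mul_add]; exact add_mem h h'
  | smul_left z f g _ _ h => rw [smul_mul_assoc]; exact Submodule.smul_mem _ _ h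
  | smul_right z f g _ _ h => rw [mul_smul_comm]; exact Submodule.smul_mem _ _ h

variable {ξ} in
lemma IsGenericPoint.exists_mem_fil (hξ : IsGenericPoint a lam ξ) (f : T) :
    ∃ e : ℤ, f ∈ fil a ξ e := by
  have hf : f ∈ Submodule.span ℂ (Set.range (monom ξ)) := by
    rw [hξ.span_range_monom]; trivial
  induction hf using Submodule.span_induction with
  | mem f hf => obtain ⟨γ, rfl⟩ := hf; exact ⟨_, monom_mem_fil ξ le_rfl⟩
  | zero => exact ⟨0, zero_mem _⟩
  | add f g _ _ hf hg =>
    obtain ⟨e, he⟩ := hf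
    obtain ⟨e', he'⟩ := hg
    exact ⟨max e e', add_mem (fil_mono ξ (le_max_left _ _) he)
      (fil_mono ξ (le_max_right _ _) he')⟩
  | smul z f _ hf => obtain ⟨e, he⟩ := hf; exact ⟨e, Submodule.smul_mem _ _ he⟩

variable (a) {ξ}

/-- The leading relation `x_i ^ r_i - x ^ ℓ_i` and the lower terms of `F_i`. -/
lemma F_eq (ha : IsTelescopic a) (i : Fin n) :
    F a lam i = monomial (Finsupp.single i.succ (ratio a i)) 1
      - monomial (Finsupp.equivFunOnFinite.symm (ell a i)) 1
      - ∑ α ∈ lowerExponents a i, monomial (Finsupp.equivFunOnFinite.symm α) (lam i α) := by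
  have hm : ∀ (α : Fin (n + 1) → ℕ) (z : ℂ),
      monomial (Finsupp.equivFunOnFinite.symm α) z = C z * ∏ k, X k ^ α k := by
    intro α z
    rw [monomial_eq, Finsupp.prod_fintype _ _ (fun _ => pow_zero _)]
    rfl
  rw [F, X_pow_eq_monomial]
  simp_rw [hm]
  congr 2
  rw [C_1, one_mul]
  refine Finset.prod_subset (Finset.subset_univ _) fun j _ hj => ?_
  rw [(ha.ell_spec i).2.2 j, pow_zero]
  rw [Finset.mem_Iio, not_lt] at hj
  exact lt_of_lt_of_le Fin.castSucc_lt_succ hj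

variable {a}

lemma mem_lowerExponents {i : Fin n} {α : Fin (n + 1) → ℕ} (h : α ∈ lowerExponents a i) :
    α ∈ B a ∧ weight a α < a i.succ * ratio a i := by
  classical
  exact (Finset.mem_filter.1 h).2

lemma IsGenericPoint.pow_sub_monom_mem_fil (hξ : IsGenericPoint a lam ξ)
    (ha : IsTelescopic a) (i : Fin n) :
    ξ i.succ ^ ratio a i - monom ξ (ell a i) ∈
      fil a ξ (a i.succ * ratio a i - 1) := by
  have h := hξ.aeval_F i
  rw [F_eq a ha, map_sub, map_sub, map_sum] at h
  simp_rw [aeval_monomial_eq, one_smul] at h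
  rw [sub_eq_zero, Finsupp.single_eq_pi_single, monom_single] at h
  change _ - monom ξ (ell a i) = _ at h
  rw [h]
  refine Submodule.sum_mem _ fun α hα => Submodule.smul_mem _ _ (monom_mem_fil ξ ?_)
  have := (mem_lowerExponents hα).2
  change ((weight a α : ℕ) : ℤ) ≤ _
  zify at this
  omega

/-- Replacing x_i^{r_i} by x^{ℓ_i} keeps the weight and, by F_i = 0, changes a monomial only by
terms of lower weight. Repeating this leads into B. -/
lemma IsGenericPoint.exists_monom_sub_mem_fil (hξ : IsGenericPoint a lam ξ)
    (ha : IsTelescopic a) (γ : Fin (n + 1) → ℕ) :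
    ∃ α ∈ B a, weight a α = weight a γ ∧
      monom ξ γ - monom ξ α ∈ fil a ξ (weight a γ - 1) := by
  let r : (Fin (n + 1) → ℕ) → (Fin (n + 1) → ℕ) → Prop := fun α β =>
    weight a α = weight a β ∧ monom ξ α - monom ξ β ∈ fil a ξ (weight a α - 1)
  have hrefl : ∀ α, r α α := fun α => ⟨rfl, by rw [sub_self]; exact zero_mem _⟩
  have htrans : ∀ α β γ, r α β → r β γ → r α γ := by
    intro α β γ h h'
    refine ⟨h.1.trans h'.1, ?_⟩
    rw [← sub_add_sub_cancel _ (monom ξ β)]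
    have h2 := h'.2
    rw [← h.1] at h2
    exact add_mem h.2 h2
  have hstep : ∀ (i : Fin n) (γ : Fin (n + 1) → ℕ),
      r (γ + Pi.single i.succ (ratio a i)) (γ + ell a i) := by
    intro i γ
    refine ⟨by rw [weight_add, weight_add, weight_single, (ha.ell_spec i).2.1], ?_⟩
    rw [monom_add, monom_add, ← mul_sub, weight_add, weight_single, monom_single]
    have := mul_mem_fil ξ (monom_mem_fil ξ (le_refl (weight a γ : ℤ)))
      (hξ.pow_sub_monom_mem_fil ha i)
    push_cast
    rwa [add_sub_assoc]
  obtain ⟨α, h1, h2, -, h4⟩ := ha.reduce_induction (ell a) (fun i => (ha.ell_spec i).2.2)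
    (fun i => (ha.ell_spec i).2.1) r hrefl htrans hstep (Fin.last n) γ
  exact ⟨α, fun i => h4 i (Fin.le_last _), h2, h1.2⟩

/-- Strong induction on the weight: a monomial equals one with exponent in B up to an element of
lower filtration. -/
lemma IsGenericPoint.fil_eq_span (hξ : IsGenericPoint a lam ξ)
    (ha : IsTelescopic a) (e : ℤ) :
    fil a ξ e = Submodule.span ℂ (monom ξ '' {γ | γ ∈ B a ∧ (weight a γ : ℤ) ≤ e}) := by
  refine le_antisymm ?_ (Submodule.span_mono (Set.image_mono fun _ h => h.2))
  have hmono : ∀ e e' : ℤ, e ≤ e' →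
      Submodule.span ℂ (monom ξ '' {γ | γ ∈ B a ∧ (weight a γ : ℤ) ≤ e}) ≤
      Submodule.span ℂ (monom ξ '' {γ | γ ∈ B a ∧ (weight a γ : ℤ) ≤ e'}) := by
    intro e e' he
    refine Submodule.span_mono (Set.image_mono ?_)
    rintro δ ⟨hδ, hδ'⟩
    exact ⟨hδ, hδ'.trans he⟩
  suffices h : ∀ (w : ℕ) (γ : Fin (n + 1) → ℕ), weight a γ = w → monom ξ γ ∈
      Submodule.span ℂ (monom ξ '' {γ | γ ∈ B a ∧ (weight a γ : ℤ) ≤ w}) by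
    rw [fil, Submodule.span_le]
    rintro _ ⟨γ, hγ, rfl⟩
    exact hmono _ _ hγ (h _ γ rfl)
  intro w
  induction w using Nat.strong_induction_on with
  | _ w ih =>
    intro γ hγ
    obtain ⟨α, hα, h1, h2⟩ := hξ.exists_monom_sub_mem_fil ha γ
    rw [← sub_add_cancel (monom ξ γ) (monom ξ α)]
    refine add_mem ?_ (Submodule.subset_span ⟨α, ⟨hα, by rw [h1, hγ]⟩, rfl⟩)
    refine (Submodule.span_le.2 ?_ : fil a ξ (weight a γ - 1) ≤ _) h2
    rintro _ ⟨δ, hδ, rfl⟩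
    have hδ' : (weight a δ : ℤ) ≤ weight a γ - 1 := hδ
    exact hmono (weight a δ) w (by omega) (ih _ (by omega) δ rfl)

lemma IsGenericPoint.span_monom_B (hξ : IsGenericPoint a lam ξ)
    (ha : IsTelescopic a) :
    Submodule.span ℂ (Set.range fun α : B a => monom ξ α) = ⊤ := by
  rw [eq_top_iff]
  rintro f -
  obtain ⟨e, he⟩ := hξ.exists_mem_fil f
  rw [hξ.fil_eq_span ha] at he
  refine Submodule.span_mono ?_ he
  rintro _ ⟨γ, hγ, rfl⟩
  exact ⟨⟨γ, hγ.1⟩, rfl⟩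

end Filtration

/-! ### Filtered algebras with multiplicative leading terms -/

section Symbol

variable (T Γ : Type*) [CommRing T] [Algebra ℂ T] [CommRing Γ] [Algebra ℂ Γ]

/-- A filtration of an algebra `T` together with multiplicative leading terms in `Γ`. -/
structure Symbol where
  fil : ℤ → Submodule ℂ T
  top : ℤ → T →ₗ[ℂ] Γ
  mono : ∀ {e e'}, e ≤ e' → fil e ≤ fil e'
  one_mem : 1 ∈ fil 0
  top_one : top 0 1 = 1
  mul_mem : ∀ {e e' f g}, f ∈ fil e → g ∈ fil e' → f * g ∈ fil (e + e')
  top_mul : ∀ {e e' f g}, f ∈ fil e → g ∈ fil e' → top (e + e') (f * g) = top e f * top e' g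
  top_of_lt : ∀ {e e' f}, f ∈ fil e → e < e' → top e' f = 0

variable {T Γ}

/-- `f` has degree at most `e`, and `p` is its leading term in degree `e`. -/
def HasSymbol (σ : Symbol T Γ) (e : ℤ) (f : T) (p : Γ) : Prop := f ∈ σ.fil e ∧ σ.top e f = p

/-- Every nonzero element has a nonzero leading term. -/
def Symbol.IsSeparated (σ : Symbol T Γ) : Prop :=
  ∀ f : T, f ≠ 0 → ∃ e, f ∈ σ.fil e ∧ σ.top e f ≠ 0

namespace HasSymbol

variable {σ : Symbol T Γ} {e e' : ℤ} {f g : T} {p q : Γ}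

lemma congr (h : HasSymbol σ e f p) (he : e = e') (hp : p = q) : HasSymbol σ e' f q := by
  subst he hp; exact h

lemma unique (h : HasSymbol σ e f p) (h' : HasSymbol σ e f q) : p = q := h.2.symm.trans h'.2

lemma add (h : HasSymbol σ e f p) (h' : HasSymbol σ e g q) : HasSymbol σ e (f + g) (p + q) :=
  ⟨add_mem h.1 h'.1, by rw [map_add, h.2, h'.2]⟩

lemma sub (h : HasSymbol σ e f p) (h' : HasSymbol σ e g q) : HasSymbol σ e (f - g) (p - q) :=
  ⟨sub_mem h.1 h'.1, by rw [map_sub, h.2, h'.2]⟩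

lemma neg (h : HasSymbol σ e f p) : HasSymbol σ e (-f) (-p) :=
  ⟨neg_mem h.1, by rw [map_neg, h.2]⟩

lemma smul (z : ℂ) (h : HasSymbol σ e f p) : HasSymbol σ e (z • f) (z • p) :=
  ⟨Submodule.smul_mem _ _ h.1, by rw [map_smul, h.2]⟩

lemma mul (h : HasSymbol σ e f p) (h' : HasSymbol σ e' g q) :
    HasSymbol σ (e + e') (f * g) (p * q) :=
  ⟨σ.mul_mem h.1 h'.1, by rw [σ.top_mul h.1 h'.1, h.2, h'.2]⟩

variable (σ e) in
lemma zero : HasSymbol σ e 0 0 := ⟨zero_mem _, map_zero _⟩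

variable (σ) in
lemma one : HasSymbol σ 0 1 1 := ⟨σ.one_mem, σ.top_one⟩

lemma of_lt (h : HasSymbol σ e f p) (he : e < e') : HasSymbol σ e' f 0 :=
  ⟨σ.mono he.le h.1, σ.top_of_lt h.1 he⟩

lemma pow (h : HasSymbol σ e f p) (k : ℕ) : HasSymbol σ (k * e) (f ^ k) (p ^ k) := by
  induction k with
  | zero => simpa using one σ
  | succ k ih =>
    rw [pow_succ, pow_succ]
    exact (ih.mul h).congr (by push_cast; ring) rfl

lemma sum {ι : Type*} {s : Finset ι} {f : ι → T} {p : ι → Γ}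
    (h : ∀ i ∈ s, HasSymbol σ e (f i) (p i)) : HasSymbol σ e (∑ i ∈ s, f i) (∑ i ∈ s, p i) :=
  ⟨Submodule.sum_mem _ fun i hi => (h i hi).1, by
    rw [map_sum]; exact Finset.sum_congr rfl fun i hi => (h i hi).2⟩

lemma prod {ι : Type*} {s : Finset ι} {e : ι → ℤ} {f : ι → T} {p : ι → Γ}
    (h : ∀ i ∈ s, HasSymbol σ (e i) (f i) (p i)) :
    HasSymbol σ (∑ i ∈ s, e i) (∏ i ∈ s, f i) (∏ i ∈ s, p i) := by
  classical
  induction s using Finset.induction_on with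
  | empty => simpa using one σ
  | insert i s hi ih =>
    rw [Finset.sum_insert hi, Finset.prod_insert hi, Finset.prod_insert hi]
    exact (h i (Finset.mem_insert_self _ _)).mul
      (ih fun j hj => h j (Finset.mem_insert_of_mem hj))

/-- With a degree u_i for each row and -v_j for each column, every term of the Leibniz formula has
the same degree. -/
lemma det {ι : Type*} [Fintype ι] [DecidableEq ι] {u v : ι → ℤ} {M : Matrix ι ι T}
    {M' : Matrix ι ι Γ} (h : ∀ i j, HasSymbol σ (u i - v j) (M i j) (M' i j)) :
    HasSymbol σ (∑ i, u i - ∑ i, v i) M.det M'.det := by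
  rw [Matrix.det_apply, Matrix.det_apply]
  refine sum fun τ _ => ?_
  have h1 : HasSymbol σ (∑ i, (u (τ i) - v i)) (∏ i, M (τ i) i) (∏ i, M' (τ i) i) :=
    prod fun i _ => h _ _
  have h2 : ∑ i, (u (τ i) - v i) = ∑ i, u i - ∑ i, v i := by
    rw [Finset.sum_sub_distrib, Equiv.sum_comp τ u]
  rw [h2] at h1
  rcases Int.units_eq_one_or (Equiv.Perm.sign τ) with hs | hs <;> rw [hs]
  · simpa using h1
  · simpa using h1.neg

/-- If z had a degree D above d, then q times its leading term would be a nonzero leading term of w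
z in degree e + D, above e + d. So leading terms can be divided along with the elements. -/
lemma dvd_of_isSeparated [IsDomain Γ] (hσ : σ.IsSeparated) {w z : T} {r : Γ} {d : ℤ}
    (hw : HasSymbol σ e w q) (hq : q ≠ 0) (h : HasSymbol σ (e + d) (w * z) r) :
    ∃ p, HasSymbol σ d z p ∧ q * p = r := by
  by_cases hz : z = 0
  · subst hz
    refine ⟨0, zero σ d, ?_⟩
    rw [mul_zero] at h ⊢
    exact (zero σ _).unique h
  obtain ⟨D, h1, h2⟩ := hσ z hz
  have hD : D ≤ d := by
    by_contra! hD
    have h3 : HasSymbol σ (e + D) (w * z) (q * σ.top D z) := hw.mul ⟨h1, rfl⟩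
    exact mul_ne_zero hq h2 (h3.unique (h.of_lt (by omega)))
  refine ⟨σ.top d z, ⟨σ.mono hD h1, rfl⟩, ?_⟩
  exact (hw.mul (⟨σ.mono hD h1, rfl⟩ : HasSymbol σ d z _)).unique h

end HasSymbol

/-- The leading terms of two nonzero elements have a nonzero product. Applied to T ⊗ T, this shows
that the functions of two points form a domain. -/
lemma Symbol.IsSeparated.noZeroDivisors [IsDomain Γ] {σ : Symbol T Γ} (hσ : σ.IsSeparated) :
    NoZeroDivisors T where
  eq_zero_or_eq_zero_of_mul_eq_zero := by
    intro f g h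
    by_contra! hfg
    obtain ⟨e, h1, h2⟩ := hσ f hfg.1
    obtain ⟨e', h3, h4⟩ := hσ g hfg.2
    have h5 := σ.top_mul h1 h3
    rw [h, map_zero] at h5
    exact mul_ne_zero h2 h4 h5.symm

end Symbol

/-! ### The leading terms of functions on the curve -/

section CurveSymbol

variable {n : ℕ} {a : Fin (n + 1) → ℕ} {lam : Fin n → (Fin (n + 1) → ℕ) → ℂ}
variable {T : Type*} [CommRing T] [Algebra ℂ T] {ξ : Fin (n + 1) → T}

variable (a lam ξ) in
/-- The elements `ξ_k` present `T` as the coordinate ring of the curve, and the monomials with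
exponents in `B` are linearly independent. -/
structure IsCurve : Prop extends IsGenericPoint a lam ξ where
  telescopic : IsTelescopic a
  linearIndependent : LinearIndependent ℂ fun α : B a => monom ξ α

namespace IsCurve

variable (h : IsCurve a lam ξ)

/-- The basis of the monomials with exponents in `B`. -/
def basis : Module.Basis (B a) ℂ T :=
  Module.Basis.mk h.linearIndependent (h.toIsGenericPoint.span_monom_B h.telescopic).ge

lemma basis_apply (α : B a) : h.basis α = monom ξ α := Module.Basis.mk_apply _ _ _

/-- The coefficient of the monomial of weight `e`. -/
def lead (e : ℤ) : T →ₗ[ℂ] ℂ :=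
  h.basis.constr ℂ fun α => if (weight a α : ℤ) = e then 1 else 0

lemma lead_monom_B {α : Fin (n + 1) → ℕ} (hα : α ∈ B a) (e : ℤ) :
    h.lead e (monom ξ α) = if (weight a α : ℤ) = e then 1 else 0 := by
  rw [← h.basis_apply ⟨α, hα⟩, lead, Module.Basis.constr_basis]

lemma lead_of_lt {e e' : ℤ} {f : T} (hf : f ∈ fil a ξ e) (he : e < e') : h.lead e' f = 0 := by
  rw [h.toIsGenericPoint.fil_eq_span h.telescopic] at hf
  induction hf using Submodule.span_induction with
  | mem f hf =>
    obtain ⟨γ, hγ, rfl⟩ := hf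
    rw [h.lead_monom_B hγ.1, if_neg]
    have := hγ.2
    omega
  | zero => rw [map_zero]
  | add f g _ _ hf hg => rw [map_add, hf, hg, add_zero]
  | smul z f _ hf => rw [map_smul, hf, smul_zero]

/-- A monomial and its normal form differ by lower weight. The bound on the weight is essential:
`lead e` of a monomial of weight above e would see uncontrolled lower terms of its normal form. -/
lemma lead_monom {γ : Fin (n + 1) → ℕ} {e : ℤ} (he : (weight a γ : ℤ) ≤ e) :
    h.lead e (monom ξ γ) = if (weight a γ : ℤ) = e then 1 else 0 := by
  obtain ⟨α, hα, h1, h2⟩ := h.toIsGenericPoint.exists_monom_sub_mem_fil h.telescopic γ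
  rw [← sub_add_cancel (monom ξ γ) (monom ξ α), map_add, h.lead_monom_B hα, h1,
    h.lead_of_lt h2 (by omega), zero_add]

/-- The leading coefficients of the functions on the curve. -/
def symbol : Symbol T ℂ where
  fil := fil a ξ
  top := h.lead
  mono := fil_mono ξ
  one_mem := by
    rw [← monom_zero ξ]
    exact monom_mem_fil ξ (by simp [weight])
  top_one := by
    rw [← monom_zero ξ, h.lead_monom] <;> simp [weight]
  mul_mem := mul_mem_fil ξ
  top_mul := by
    intro e e' f g hf hg
    induction hf, hg using Submodule.span_induction₂ with
    | mem_mem f g hf hg =>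
      obtain ⟨γ, hγ, rfl⟩ := hf
      obtain ⟨δ, hδ, rfl⟩ := hg
      simp only [Set.mem_ofPred_eq] at hγ hδ
      rw [← monom_add, h.lead_monom hγ, h.lead_monom hδ,
        h.lead_monom (by rw [weight_add]; push_cast; omega), weight_add]
      push_cast
      split_ifs <;> first | (exfalso; omega) | simp
    | zero_left => simp
    | zero_right => simp
    | add_left f f' g _ _ _ h h' => rw [add_mul, map_add, map_add, h, h', add_mul]
    | add_right f g g' _ _ _ h h' => rw [mul_add, map_add, map_add, h, h', mul_add]
    | smul_left z f g _ _ h => rw [smul_mul_assoc, map_smul, map_smul, h, smul_mul_assoc]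
    | smul_right z f g _ _ h => rw [mul_smul_comm, map_smul, map_smul, h, mul_smul_comm]
  top_of_lt := h.lead_of_lt

lemma hasSymbol_monom (γ : Fin (n + 1) → ℕ) :
    HasSymbol h.symbol (weight a γ) (monom ξ γ) 1 :=
  ⟨monom_mem_fil ξ le_rfl, by
    change h.lead _ _ = _
    rw [h.lead_monom le_rfl, if_pos rfl]⟩

lemma hasSymbol_coord (k : Fin (n + 1)) : HasSymbol h.symbol (a k) (ξ k) 1 := by
  have := h.hasSymbol_monom (Pi.single k 1)
  rwa [monom_single, pow_one, weight_single, mul_one] at this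

lemma lead_eq_repr (f : T) (α : B a) : h.lead (weight a α) f = h.basis.repr f α := by
  have : h.lead (weight a α) = h.basis.coord α := by
    refine h.basis.ext fun β => ?_
    rw [Module.Basis.coord_apply, Module.Basis.repr_self, h.basis_apply, h.lead_monom_B β.2,
      Finsupp.single_apply]
    refine if_congr ⟨fun hw => Subtype.ext (h.telescopic.weight_injOn β.2 α.2 ?_), ?_⟩ rfl rfl
    · exact_mod_cast hw
    · rintro rfl; rfl
  rw [this]
  rfl

/-- The term of largest weight in the basis expansion cannot cancel, because distinct elements of B
have distinct weights. -/
lemma isSeparated : h.symbol.IsSeparated := by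
  intro f hf
  have hs : (h.basis.repr f).support.Nonempty := by
    rw [Finsupp.support_nonempty_iff]
    simpa using hf
  obtain ⟨α, hα, hmax⟩ := Finset.exists_max_image _ (fun α : B a => weight a α) hs
  refine ⟨weight a α, ?_, ?_⟩
  · rw [← h.basis.linearCombination_repr f, Finsupp.linearCombination_apply]
    refine Submodule.sum_mem _ fun β hβ => Submodule.smul_mem _ _ ?_
    rw [h.basis_apply]
    exact monom_mem_fil ξ (by exact_mod_cast hmax β hβ)
  · change h.lead _ _ ≠ 0
    rw [h.lead_eq_repr]
    exact Finsupp.mem_support_iff.1 hα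

end IsCurve

end CurveSymbol

section CurveSymbol

variable {n : ℕ} {a : Fin (n + 1) → ℕ} {lam : Fin n → (Fin (n + 1) → ℕ) → ℂ}
variable {T : Type*} [CommRing T] [Algebra ℂ T] {ξ : Fin (n + 1) → T}

namespace IsCurve

variable (h : IsCurve a lam ξ)

/-! ### Leading terms of functions of two points -/

/-- The basis of the products of a monomial in `P` and a monomial in `Q`. -/
def basis₂ : Module.Basis (B a × B a) ℂ (T ⊗[ℂ] T) := h.basis.tensorProduct h.basis

lemma basis₂_apply (p : B a × B a) : h.basis₂ p = monom ξ p.1 ⊗ₜ monom ξ p.2 := by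
  rw [basis₂, Module.Basis.tensorProduct_apply', h.basis_apply, h.basis_apply]

variable (a ξ) in
/-- The functions of total degree at most `e`. -/
def fil₂ (e : ℤ) : Submodule ℂ (T ⊗[ℂ] T) :=
  Submodule.span ℂ ((fun p : (Fin (n + 1) → ℕ) × (Fin (n + 1) → ℕ) =>
    monom ξ p.1 ⊗ₜ[ℂ] monom ξ p.2) '' {p | (weight a p.1 : ℤ) + weight a p.2 ≤ e})

lemma monom_tmul_mem_fil₂ {γ δ : Fin (n + 1) → ℕ} {e : ℤ}
    (he : (weight a γ : ℤ) + weight a δ ≤ e) : monom ξ γ ⊗ₜ[ℂ] monom ξ δ ∈ fil₂ a ξ e :=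
  Submodule.subset_span ⟨(γ, δ), he, rfl⟩

lemma fil₂_mono {e e' : ℤ} (h : e ≤ e') : fil₂ a ξ e ≤ fil₂ a ξ e' :=
  Submodule.span_mono (Set.image_mono fun _ hγ => le_trans hγ h)

lemma tmul_mem_fil₂ {e e' : ℤ} {f g : T} (hf : f ∈ fil a ξ e) (hg : g ∈ fil a ξ e') :
    f ⊗ₜ[ℂ] g ∈ fil₂ a ξ (e + e') := by
  induction hf, hg using Submodule.span_induction₂ with
  | mem_mem f g hf hg =>
    obtain ⟨γ, hγ, rfl⟩ := hf
    obtain ⟨δ, hδ, rfl⟩ := hg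
    exact monom_tmul_mem_fil₂ (add_le_add hγ hδ)
  | zero_left => simp
  | zero_right => simp
  | add_left f f' g _ _ _ h h' => rw [TensorProduct.add_tmul]; exact add_mem h h'
  | add_right f g g' _ _ _ h h' => rw [TensorProduct.tmul_add]; exact add_mem h h'
  | smul_left z f g _ _ h => rw [← TensorProduct.smul_tmul']; exact Submodule.smul_mem _ _ h
  | smul_right z f g _ _ h => rw [TensorProduct.tmul_smul]; exact Submodule.smul_mem _ _ h

/-- The leading terms of functions of two points: the part of degree `e`, where the monomial
`x ^ α y ^ β` counts as `u ^ k`, `k` being the weight of `β`. -/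
def lead₂ (e : ℤ) : T ⊗[ℂ] T →ₗ[ℂ] Polynomial ℂ :=
  h.basis₂.constr ℂ fun p =>
    if (weight a p.1 : ℤ) + weight a p.2 = e then Polynomial.X ^ weight a p.2 else 0

lemma lead₂_monom_B {α β : Fin (n + 1) → ℕ} (hα : α ∈ B a) (hβ : β ∈ B a) (e : ℤ) :
    h.lead₂ e (monom ξ α ⊗ₜ monom ξ β) =
      if (weight a α : ℤ) + weight a β = e then Polynomial.X ^ weight a β else 0 := by
  have := h.basis₂_apply (⟨α, hα⟩, ⟨β, hβ⟩)
  simp only at this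
  rw [← this, lead₂, Module.Basis.constr_basis]

/-- For negative j the exponent `j.toNat` is a dummy value: weights are nonnegative, so then g = 0
and the coefficient vanishes. -/
lemma lead₂_tmul_of_le {i j e : ℤ} {f g : T} (hf : f ∈ fil a ξ i) (hg : g ∈ fil a ξ j)
    (he : i + j ≤ e) : h.lead₂ e (f ⊗ₜ g) =
      if i + j = e then (h.lead i f * h.lead j g) • Polynomial.X ^ j.toNat else 0 := by
  rw [h.toIsGenericPoint.fil_eq_span h.telescopic] at hf hg
  induction hf, hg using Submodule.span_induction₂ with
  | mem_mem f g hf hg =>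
    obtain ⟨α, ⟨hα, hα'⟩, rfl⟩ := hf
    obtain ⟨β, ⟨hβ, hβ'⟩, rfl⟩ := hg
    rw [h.lead₂_monom_B hα hβ, h.lead_monom_B hα, h.lead_monom_B hβ]
    by_cases h1 : (weight a α : ℤ) = i
    · by_cases h2 : (weight a β : ℤ) = j
      · simp [h1, ← h2]
      · rw [if_neg (by omega)]
        simp [h2]
    · rw [if_neg (by omega)]
      simp [h1]
  | zero_left => simp
  | zero_right => simp
  | add_left f f' g _ _ _ h h' =>
    rw [TensorProduct.add_tmul, map_add, map_add, h, h', add_mul, add_smul]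
    split_ifs <;> simp
  | add_right f g g' _ _ _ h h' =>
    rw [TensorProduct.tmul_add, map_add, map_add, h, h', mul_add, add_smul]
    split_ifs <;> simp
  | smul_left z f g _ _ h =>
    rw [← TensorProduct.smul_tmul', map_smul, map_smul, h, smul_mul_assoc, smul_ite, smul_zero,
      ← smul_assoc]
  | smul_right z f g _ _ h =>
    rw [TensorProduct.tmul_smul, map_smul, map_smul, h, mul_smul_comm, smul_ite, smul_zero,
      ← smul_assoc]

lemma lead₂_monom {γ δ : Fin (n + 1) → ℕ} {e : ℤ} (he : (weight a γ : ℤ) + weight a δ ≤ e) :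
    h.lead₂ e (monom ξ γ ⊗ₜ monom ξ δ) =
      if (weight a γ : ℤ) + weight a δ = e then Polynomial.X ^ weight a δ else 0 := by
  rw [h.lead₂_tmul_of_le (monom_mem_fil ξ le_rfl) (monom_mem_fil ξ le_rfl) he,
    h.lead_monom le_rfl, h.lead_monom le_rfl]
  simp

/-- The leading terms of functions of two points. -/
def symbol₂ : Symbol (T ⊗[ℂ] T) (Polynomial ℂ) where
  fil := fil₂ a ξ
  top := h.lead₂
  mono := fil₂_mono
  one_mem := by
    have := monom_tmul_mem_fil₂ (a := a) (ξ := ξ) (γ := 0) (δ := 0) (e := 0) (by simp [weight])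
    rwa [monom_zero] at this
  top_one := by
    have := h.lead₂_monom (γ := 0) (δ := 0) (e := 0) (by simp [weight])
    rw [monom_zero] at this
    rw [Algebra.TensorProduct.one_def, this]
    simp [weight]
  mul_mem := by
    intro e e' f g hf hg
    induction hf, hg using Submodule.span_induction₂ with
    | mem_mem f g hf hg =>
      obtain ⟨⟨γ, δ⟩, hγ, rfl⟩ := hf
      obtain ⟨⟨γ', δ'⟩, hδ, rfl⟩ := hg
      simp only [Set.mem_ofPred_eq] at hγ hδ
      rw [Algebra.TensorProduct.tmul_mul_tmul, ← monom_add, ← monom_add]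
      refine monom_tmul_mem_fil₂ ?_
      rw [weight_add, weight_add]
      push_cast
      omega
    | zero_left => simp
    | zero_right => simp
    | add_left f f' g _ _ _ h h' => rw [add_mul]; exact add_mem h h'
    | add_right f g g' _ _ _ h h' => rw [mul_add]; exact add_mem h h'
    | smul_left z f g _ _ h => rw [smul_mul_assoc]; exact Submodule.smul_mem _ _ h
    | smul_right z f g _ _ h => rw [mul_smul_comm]; exact Submodule.smul_mem _ _ h
  top_mul := by
    intro e e' f g hf hg
    induction hf, hg using Submodule.span_induction₂ with
    | mem_mem f g hf hg =>
      obtain ⟨⟨γ, δ⟩, hγ, rfl⟩ := hf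
      obtain ⟨⟨γ', δ'⟩, hδ, rfl⟩ := hg
      simp only [Set.mem_ofPred_eq] at hγ hδ
      rw [Algebra.TensorProduct.tmul_mul_tmul, ← monom_add, ← monom_add, h.lead₂_monom hγ,
        h.lead₂_monom hδ, h.lead₂_monom (by rw [weight_add, weight_add]; push_cast; omega),
        weight_add, weight_add]
      push_cast
      split_ifs <;> first | (exfalso; omega) | simp [pow_add]
    | zero_left => simp
    | zero_right => simp
    | add_left f f' g _ _ _ h h' => rw [add_mul, map_add, map_add, h, h', add_mul]
    | add_right f g g' _ _ _ h h' => rw [mul_add, map_add, map_add, h, h', mul_add]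
    | smul_left z f g _ _ h => rw [smul_mul_assoc, map_smul, map_smul, h, smul_mul_assoc]
    | smul_right z f g _ _ h => rw [mul_smul_comm, map_smul, map_smul, h, mul_smul_comm]
  top_of_lt := by
    intro e e' f hf he
    induction hf using Submodule.span_induction with
    | mem f hf =>
      obtain ⟨⟨γ, δ⟩, hγ, rfl⟩ := hf
      have hγ : (weight a γ : ℤ) + weight a δ ≤ e := hγ
      change h.lead₂ e' (monom ξ γ ⊗ₜ monom ξ δ) = 0
      rw [h.lead₂_monom (by omega), if_neg (by omega)]
    | zero => rw [map_zero]
    | add f g _ _ hf hg => rw [map_add, hf, hg, add_zero]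
    | smul z f _ hf => rw [map_smul, hf, smul_zero]

lemma hasSymbol_tmul {i j : ℤ} {f g : T} {p q : ℂ} (hf : HasSymbol h.symbol i f p)
    (hg : HasSymbol h.symbol j g q) :
    HasSymbol h.symbol₂ (i + j) (f ⊗ₜ g) ((p * q) • Polynomial.X ^ j.toNat) := by
  refine ⟨tmul_mem_fil₂ hf.1 hg.1, ?_⟩
  change h.lead₂ _ _ = _
  rw [h.lead₂_tmul_of_le hf.1 hg.1 le_rfl, if_pos rfl, ← hf.2, ← hg.2]
  rfl

/-- The total degree together with the power of u determines both weights, and these determine the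
pair of exponents. -/
lemma coeff_lead₂ (f : T ⊗[ℂ] T) (p : B a × B a) :
    (h.lead₂ (weight a p.1 + weight a p.2) f).coeff (weight a p.2) = h.basis₂.repr f p := by
  have : (Polynomial.lcoeff ℂ (weight a p.2)).comp (h.lead₂ (weight a p.1 + weight a p.2)) =
      h.basis₂.coord p := by
    refine h.basis₂.ext fun q => ?_
    rw [LinearMap.comp_apply, Module.Basis.coord_apply, Module.Basis.repr_self, h.basis₂_apply,
      h.lead₂_monom_B q.1.2 q.2.2, Finsupp.single_apply, Polynomial.lcoeff_apply]
    by_cases hq : q = p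
    · subst hq; simp
    · rw [if_neg hq]
      split_ifs with h1
      · rw [Polynomial.coeff_X_pow, if_neg]
        intro h2
        rw [h2] at h1
        refine hq (Prod.ext (Subtype.ext (h.telescopic.weight_injOn q.1.2 p.1.2 ?_))
          (Subtype.ext (h.telescopic.weight_injOn q.2.2 p.2.2 h2.symm)))
        omega
      · simp
  rw [← Module.Basis.coord_apply, ← this]
  rfl

/-- Several pairs can share the maximal total weight, but they carry different powers of u, so the
leading polynomial is nonzero. -/
lemma isSeparated₂ : h.symbol₂.IsSeparated := by
  intro f hf
  have hs : (h.basis₂.repr f).support.Nonempty := by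
    rw [Finsupp.support_nonempty_iff]
    simpa using hf
  obtain ⟨p, hp, hmax⟩ := Finset.exists_max_image _
    (fun p : B a × B a => weight a p.1 + weight a p.2) hs
  refine ⟨weight a p.1 + weight a p.2, ?_, ?_⟩
  · have : ∀ q ∈ (h.basis₂.repr f).support,
        h.basis₂ q ∈ fil₂ a ξ (weight a p.1 + weight a p.2) := by
      intro q hq
      rw [h.basis₂_apply]
      exact monom_tmul_mem_fil₂ (by exact_mod_cast hmax q hq)
    change f ∈ fil₂ a ξ _
    rw [← h.basis₂.linearCombination_repr f, Finsupp.linearCombination_apply]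
    exact Submodule.sum_mem _ fun q hq => Submodule.smul_mem _ _ (this q hq)
  · intro h0
    have h1 := h.coeff_lead₂ f p
    change h.lead₂ _ _ = 0 at h0
    rw [h0, Polynomial.coeff_zero] at h1
    exact Finsupp.mem_support_iff.1 hp h1.symm

/-! ### Leading terms of derivatives -/

variable {h} {c : ℤ} {δ : Derivation ℂ T T}

/-- On leading terms δ is an Euler operator: by the Leibniz rule it multiplies a monomial by its
weight and raises the degree by c. -/
lemma hasSymbol_derivation_monom
    (hδ : ∀ k, HasSymbol h.symbol (a k + c) (δ (ξ k)) (a k : ℂ)) (γ : Fin (n + 1) → ℕ) :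
    HasSymbol h.symbol (weight a γ + c) (δ (monom ξ γ)) (weight a γ : ℂ) := by
  have hpow : ∀ k (e : ℕ), HasSymbol h.symbol ((a k * e : ℕ) + c)
      (δ (ξ k ^ e)) ((a k * e : ℕ) : ℂ) := by
    intro k e
    induction e with
    | zero => simpa using HasSymbol.zero h.symbol c
    | succ e ih =>
      rw [pow_succ, Derivation.leibniz, smul_eq_mul, smul_eq_mul]
      refine ((((h.hasSymbol_coord k).pow e).mul (hδ k)).congr ?_ rfl).add
        (((h.hasSymbol_coord k).mul ih).congr ?_ rfl) |>.congr rfl ?_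
      · push_cast; ring
      · push_cast; ring
      · push_cast; ring
  have hprod : ∀ s : Finset (Fin (n + 1)), HasSymbol h.symbol (∑ k ∈ s, (a k * γ k : ℕ) + c)
      (δ (∏ k ∈ s, ξ k ^ γ k)) (∑ k ∈ s, (a k * γ k : ℕ) : ℂ) := by
    intro s
    induction s using Finset.induction_on with
    | empty => simpa using HasSymbol.zero h.symbol c
    | insert k s hk ih =>
      have h1 : HasSymbol h.symbol (∑ k ∈ s, (a k * γ k : ℕ)) (∏ k ∈ s, ξ k ^ γ k)
          (∏ k ∈ s, 1) := HasSymbol.prod fun k _ =>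
        ((h.hasSymbol_coord k).pow (γ k)).congr (by push_cast; ring) (one_pow _)
      rw [Finset.prod_insert hk, Finset.sum_insert hk, Finset.sum_insert hk, Derivation.leibniz,
        smul_eq_mul, smul_eq_mul]
      refine ((((h.hasSymbol_coord k).pow (γ k)).mul ih).congr ?_ rfl).add
        ((h1.mul (hpow k (γ k))).congr ?_ rfl) |>.congr rfl ?_
      · push_cast; ring
      · push_cast; ring
      · simp; ring
  refine (hprod Finset.univ).congr ?_ ?_ <;> simp [weight]

lemma hasSymbol_derivation (hδ : ∀ k, HasSymbol h.symbol (a k + c) (δ (ξ k)) (a k : ℂ))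
    {e : ℤ} {f : T} {p : ℂ} (hf : HasSymbol h.symbol e f p) :
    HasSymbol h.symbol (e + c) (δ f) (e * p) := by
  obtain ⟨hf, rfl⟩ := hf
  change f ∈ fil a ξ e at hf
  induction hf using Submodule.span_induction with
  | mem f hf =>
    obtain ⟨γ, hγ, rfl⟩ := hf
    have h1 := hasSymbol_derivation_monom hδ γ
    change HasSymbol _ _ _ (e * h.lead _ _)
    rw [h.lead_monom hγ]
    split_ifs with h2
    · rw [← h2]; simpa using h1
    · have : (weight a γ : ℤ) ≤ e := hγ
      rw [mul_zero]
      exact h1.of_lt (by omega)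
  | zero => simpa using HasSymbol.zero h.symbol _
  | add f g _ _ hf hg => rw [map_add, map_add, mul_add]; exact hf.add hg
  | smul z f _ hf =>
    rw [δ.map_smul, map_smul, mul_smul_comm]
    exact hf.smul z

/-- The exponent of u is the weight in the second point, so the Euler operator is u d/du. The shift
of the degree takes place in the second point too, whence the extra factor u^c. -/
lemma hasSymbol_lTensor (hδ : ∀ k, HasSymbol h.symbol (a k + c) (δ (ξ k)) (a k : ℂ))
    (hc : 0 ≤ c) {e : ℤ} {f : T ⊗[ℂ] T} {p : Polynomial ℂ} (hf : HasSymbol h.symbol₂ e f p) :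
    HasSymbol h.symbol₂ (e + c) (LinearMap.lTensor T (δ : T →ₗ[ℂ] T) f)
      (Polynomial.X ^ (c.toNat + 1) * Polynomial.derivative p) := by
  obtain ⟨hf, rfl⟩ := hf
  change f ∈ fil₂ a ξ e at hf
  induction hf using Submodule.span_induction with
  | mem f hf =>
    obtain ⟨⟨γ, γ'⟩, hγ, rfl⟩ := hf
    have hγ : (weight a γ : ℤ) + weight a γ' ≤ e := hγ
    have h1 := h.hasSymbol_tmul (h.hasSymbol_monom γ) (hasSymbol_derivation_monom hδ γ')
    change HasSymbol _ _ _ (_ * Polynomial.derivative (h.lead₂ _ _))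
    rw [h.lead₂_monom hγ, LinearMap.lTensor_tmul]
    split_ifs with h2
    · refine h1.congr (by omega) ?_
      have h3 : ((weight a γ' : ℤ) + c).toNat = weight a γ' + c.toNat := by omega
      rw [h3, one_mul, Polynomial.derivative_X_pow, Polynomial.smul_eq_C_mul]
      rcases Nat.eq_zero_or_pos (weight a γ') with h0 | h0
      · simp [h0]
      · obtain ⟨w, hw⟩ := Nat.exists_eq_succ_of_ne_zero h0.ne'
        rw [hw]
        simp only [Nat.succ_eq_add_one, Nat.add_sub_cancel]
        ring
    · rw [map_zero, mul_zero]
      exact h1.of_lt (by omega)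
  | zero => simpa using HasSymbol.zero h.symbol₂ _
  | add f g _ _ hf hg => rw [map_add, map_add, map_add, mul_add]; exact hf.add hg
  | smul z f _ hf =>
    rw [map_smul, map_smul, Polynomial.derivative_smul, mul_smul_comm]
    exact hf.smul z

/-- The weight in the first point is e minus the exponent of u, so the Euler operator is e - u d/du.
The shift of the degree takes place in the first point and leaves u untouched. -/
lemma hasSymbol_rTensor (hδ : ∀ k, HasSymbol h.symbol (a k + c) (δ (ξ k)) (a k : ℂ))
    {e : ℤ} {f : T ⊗[ℂ] T} {p : Polynomial ℂ} (hf : HasSymbol h.symbol₂ e f p) :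
    HasSymbol h.symbol₂ (e + c) (LinearMap.rTensor T (δ : T →ₗ[ℂ] T) f)
      ((e : ℂ) • p - Polynomial.X * Polynomial.derivative p) := by
  obtain ⟨hf, rfl⟩ := hf
  change f ∈ fil₂ a ξ e at hf
  induction hf using Submodule.span_induction with
  | mem f hf =>
    obtain ⟨⟨γ, γ'⟩, hγ, rfl⟩ := hf
    have hγ : (weight a γ : ℤ) + weight a γ' ≤ e := hγ
    have h1 := h.hasSymbol_tmul (hasSymbol_derivation_monom hδ γ) (h.hasSymbol_monom γ')
    change HasSymbol _ _ _ (_ • h.lead₂ _ _ - _ * Polynomial.derivative (h.lead₂ _ _))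
    rw [h.lead₂_monom hγ, LinearMap.rTensor_tmul]
    split_ifs with h2
    · refine h1.congr (by omega) ?_
      rw [Int.toNat_natCast, mul_one, Polynomial.derivative_X_pow, ← h2,
        Polynomial.smul_eq_C_mul, Polynomial.smul_eq_C_mul]
      rcases Nat.eq_zero_or_pos (weight a γ') with h0 | h0
      · simp [h0]
      · obtain ⟨w, hw⟩ := Nat.exists_eq_succ_of_ne_zero h0.ne'
        rw [hw]
        simp only [Nat.succ_eq_add_one, Nat.add_sub_cancel]
        push_cast
        simp only [map_add, map_natCast, map_one]
        ring
    · rw [map_zero, mul_zero, smul_zero, sub_zero]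
      exact h1.of_lt (by omega)
  | zero => simpa using HasSymbol.zero h.symbol₂ _
  | add f g _ _ hf hg =>
    rw [map_add, map_add, map_add, mul_add, smul_add, add_sub_add_comm]; exact hf.add hg
  | smul z f _ hf =>
    rw [map_smul, map_smul, Polynomial.derivative_smul, mul_smul_comm, smul_comm, ← smul_sub]
    exact hf.smul z

end IsCurve

end CurveSymbol

/-! ### The signed maximal minors of an `n × (n + 1)` matrix -/

section Minors

variable {n : ℕ} {A : Type*} [CommRing A]

/-- The vector of the signed maximal minors. -/
def minors (M : Matrix (Fin n) (Fin (n + 1)) A) (k : Fin (n + 1)) : A :=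
  (-1) ^ (k : ℕ) * (M.submatrix id k.succAbove).det

lemma minors_map {A' : Type*} [CommRing A'] (f : A →+* A') (M : Matrix (Fin n) (Fin (n + 1)) A)
    (k : Fin (n + 1)) : minors (M.map f) k = f (minors M k) := by
  rw [minors, minors, map_mul, map_pow, map_neg, map_one, RingHom.map_det]
  rfl

lemma minors_zero (M : Matrix (Fin n) (Fin (n + 1)) A) :
    minors M 0 = (M.submatrix id Fin.succ).det := by
  simp [minors]

/-- The matrix `M` with a first row `r` added. -/
def consRow (r : Fin (n + 1) → A) (M : Matrix (Fin n) (Fin (n + 1)) A) :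
    Matrix (Fin (n + 1)) (Fin (n + 1)) A :=
  Matrix.of fun i k => Fin.cases (r k) (fun i => M i k) i

lemma det_consRow (M : Matrix (Fin n) (Fin (n + 1)) A) (r : Fin (n + 1) → A) :
    (consRow r M).det = ∑ k, r k * minors M k := by
  rw [Matrix.det_succ_row_zero]
  refine Finset.sum_congr rfl fun k _ => ?_
  change _ * r k * (M.submatrix id k.succAbove).det = r k * ((-1) ^ (k : ℕ) * _)
  ring

lemma sum_mul_minors (M : Matrix (Fin n) (Fin (n + 1)) A) (i : Fin n) :
    ∑ k, M i k * minors M k = 0 := by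
  rw [← det_consRow]
  refine Matrix.det_zero_of_row_eq (i := 0) (j := i.succ) (Fin.succ_ne_zero i).symm ?_
  ext k
  rfl

/-- Cramer's rule for M with the row r added on top. Applied to v this matrix has only its first
entry nonzero, and the first column of its adjugate consists of the signed minors. Thus the kernel
of M is spanned by the minors wherever these have no common zero. -/
lemma sum_smul_eq {V : Type*} [AddCommGroup V] [Module A V] (M : Matrix (Fin n) (Fin (n + 1)) A)
    {v : Fin (n + 1) → V} (hv : ∀ i, ∑ k, M i k • v k = 0) (r : Fin (n + 1) → A)
    (k : Fin (n + 1)) : (∑ l, r l * minors M l) • v k = minors M k • ∑ l, r l • v l := by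
  set N := consRow r M
  have hadj : N.adjugate k 0 = minors M k := by
    rw [Matrix.adjugate_fin_succ_eq_det_submatrix, minors]
    have : N.submatrix (0 : Fin (n + 1)).succAbove k.succAbove = M.submatrix id k.succAbove := by
      rw [Fin.succAbove_zero]; rfl
    rw [this]
    simp
  have h1 : ∑ i, N.adjugate k i • ∑ l, N i l • v l = N.det • v k := by
    simp_rw [Finset.smul_sum, smul_smul]
    rw [Finset.sum_comm]
    simp_rw [← Finset.sum_smul, ← Matrix.mul_apply, Matrix.adjugate_mul, Matrix.smul_apply,
      Matrix.one_apply, smul_eq_mul, mul_ite, mul_one, mul_zero, ite_smul, zero_smul]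
    simp
  rw [← det_consRow, ← h1, Fin.sum_univ_succ, hadj]
  have h2 : ∀ i : Fin n, ∑ l, N i.succ l • v l = 0 := fun i => by
    rw [← hv i]; rfl
  simp_rw [h2, smul_zero, Finset.sum_const_zero, add_zero]
  rfl

lemma minors_smul_comm {V : Type*} [AddCommGroup V] [Module A V]
    (M : Matrix (Fin n) (Fin (n + 1)) A) {v : Fin (n + 1) → V}
    (hv : ∀ i, ∑ k, M i k • v k = 0) (j k : Fin (n + 1)) :
    minors M j • v k = minors M k • v j := by
  have := sum_smul_eq M hv (Pi.single j 1) k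
  rwa [Finset.sum_eq_single j (fun l _ hl => by rw [Pi.single_eq_of_ne hl, zero_mul]) (by simp),
    Finset.sum_eq_single j (fun l _ hl => by rw [Pi.single_eq_of_ne hl, zero_smul]) (by simp),
    Pi.single_eq_same, one_mul, one_smul] at this

/-- Independent rows can be completed by one more row to an invertible matrix; expand its
determinant along that row. -/
lemma exists_minors_ne_zero {F : Type*} [Field F] (M : Matrix (Fin n) (Fin (n + 1)) F)
    (hM : M.rank = n) : ∃ k, minors M k ≠ 0 := by
  by_contra! h0
  have hrow : LinearIndependent F M.row := by
    rw [linearIndependent_iff_card_eq_finrank_span, Set.finrank, ← Matrix.rank_eq_finrank_span_row,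
      hM, Fintype.card_fin]
  obtain ⟨r, hr⟩ : ∃ r : Fin (n + 1) → F, r ∉ Submodule.span F (Set.range M.row) := by
    by_contra! h
    have h1 : Submodule.span F (Set.range M.row) = ⊤ := by
      rw [eq_top_iff]; exact fun r _ => h r
    have h2 := M.rank_eq_finrank_span_row
    rw [h1, hM, finrank_top, Module.finrank_fin_fun] at h2
    omega
  have hN : LinearIndependent F (consRow r M).row := by
    have h1 := linearIndependent_finCons.2 ⟨hrow, hr⟩
    have h2 : (consRow r M).row = Fin.cons r M.row := by
      funext i
      refine Fin.cases rfl (fun i => rfl) i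
    rw [h2]
    exact h1
  rw [Matrix.linearIndependent_rows_iff_isUnit, Matrix.isUnit_iff_isUnit_det, det_consRow] at hN
  simp [h0] at hN

end Minors

/-! ### Derivations of localizations -/

section Localization

lemma derivation_ext_of_isLocalization {A S S' : Type*} [CommRing A] [CommRing S]
    [CommRing S'] [Algebra A S'] [Algebra S S'] (M : Submonoid S) [IsLocalization M S']
    {V : Type*} [AddCommGroup V] [Module A V] [Module S' V]
    {δ δ' : Derivation A S' V}
    (h : ∀ s, δ (algebraMap S S' s) = δ' (algebraMap S S' s)) : δ = δ' := by
  ext f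
  obtain ⟨⟨s, m⟩, hs⟩ := IsLocalization.surj M f
  simp only at hs
  have h1 := congrArg δ hs
  have h2 := congrArg δ' hs
  rw [Derivation.leibniz] at h1 h2
  rw [h, h, ← h2] at h1
  have h3 := add_left_cancel h1
  exact (IsLocalization.map_units S' m).smul_left_cancel.1 h3

variable {A S S' : Type*} [CommRing A] [CommRing S] [CommRing S'] [Algebra A S] [Algebra A S']
  [Algebra S S'] [IsScalarTower A S S']

/-- Differentials commute with localization, so the linear form on `Ω[S⁄A]` belonging to δ extends.
-/
lemma exists_derivation_of_isLocalization (M : Submonoid S) [IsLocalization M S']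
    (δ : Derivation A S S) :
    ∃ δ' : Derivation A S' S', ∀ s, δ' (algebraMap S S' s) = algebraMap S S' (δ s) := by
  have := KaehlerDifferential.isLocalizedModule_map (R := A) (S := S) (T := S') M
  let g : Ω[S⁄A] →ₗ[S] S' := (Algebra.linearMap S S').comp δ.liftKaehlerDifferential
  have hu : ∀ m : M, IsUnit (algebraMap S (Module.End S S') m) := by
    intro m
    have h1 := (IsLocalization.map_units S' m).map (algebraMap S' (Module.End S' S'))
    rw [Module.End.isUnit_iff] at h1 ⊢
    convert h1 using 1
    ext x
    simp [Algebra.smul_def]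
  let l : Ω[S'⁄A] →ₗ[S'] S' := LinearMap.extendScalarsOfIsLocalization M S'
    (IsLocalizedModule.lift M (KaehlerDifferential.map A A S S') g hu)
  refine ⟨l.compDer (KaehlerDifferential.D A S'), fun s => ?_⟩
  have hD := KaehlerDifferential.map_D A A S S' s
  change IsLocalizedModule.lift M (KaehlerDifferential.map A A S S') g hu
    (KaehlerDifferential.D A S' (algebraMap S S' s)) = _
  rw [← hD, IsLocalizedModule.lift_apply]
  simp [g]

end Localization

/-! ### The tangent vector field of the curve and its leading terms. -/

section CurveDerivation

variable {n : ℕ} {a : Fin (n + 1) → ℕ} {lam : Fin n → (Fin (n + 1) → ℕ) → ℂ}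
variable {T : Type*} [CommRing T] [Algebra ℂ T] {ξ : Fin (n + 1) → T}


lemma derivation_aeval {V : Type*} [AddCommGroup V] [Module ℂ V] [Module T V] [IsScalarTower ℂ T V]
    (d : Derivation ℂ T V) (p : MvPolynomial (Fin (n + 1)) ℂ) :
    d (aeval ξ p) = ∑ k, aeval ξ (pderiv k p) • d (ξ k) := by
  induction p using MvPolynomial.induction_on with
  | C z => simp
  | add p q hp hq => simp only [map_add, hp, hq, add_smul, Finset.sum_add_distrib]
  | mul_X p j hp =>
    have hs : ∑ k, aeval ξ p • aeval ξ (pderiv k (X j : MvPolynomial (Fin (n + 1)) ℂ)) • d (ξ k) =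
        aeval ξ p • d (ξ j) := by
      rw [Finset.sum_eq_single j]
      · simp
      · intro k _ hk
        simp [pderiv_X_of_ne hk.symm]
      · simp
    simp only [map_mul, aeval_X, Derivation.leibniz, hp, map_add, smul_eq_mul, add_smul,
      Finset.sum_add_distrib, mul_smul]
    rw [hs, Finset.smul_sum]

variable (a lam ξ) in
/-- The components of a tangent vector field of the curve. -/
def tangent (k : Fin (n + 1)) : T := aeval ξ (minors (G a lam) k)

lemma tangent_eq (k : Fin (n + 1)) :
    tangent a lam ξ k = minors ((G a lam).map (aeval ξ)) k := by
  rw [tangent]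
  exact (minors_map (aeval ξ : MvPolynomial (Fin (n + 1)) ℂ →ₐ[ℂ] T).toRingHom (G a lam) k).symm

lemma tangent_zero : tangent a lam ξ 0 = aeval ξ (detG a lam 0) := by
  rw [tangent, minors, detG]
  simp

lemma IsGenericPoint.sum_smul_derivation (hξ : IsGenericPoint a lam ξ)
    {V : Type*} [AddCommGroup V] [Module ℂ V] [Module T V] [IsScalarTower ℂ T V]
    (d : Derivation ℂ T V) (i : Fin n) :
    ∑ k, (G a lam).map (aeval ξ) i k • d (ξ k) = 0 := by
  have := derivation_aeval (ξ := ξ) d (F a lam i)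
  rw [hξ.aeval_F, map_zero] at this
  exact this.symm

/-- The vector field whose components are the signed minors kills every F_i, as this is a
determinant with a repeated row. It therefore preserves the ideal and descends to T. -/
lemma IsGenericPoint.exists_derivation (hξ : IsGenericPoint a lam ξ) :
    ∃ δ : Derivation ℂ T T, ∀ k, δ (ξ k) = tangent a lam ξ k := by
  let d : Derivation ℂ (MvPolynomial (Fin (n + 1)) ℂ) (MvPolynomial (Fin (n + 1)) ℂ) :=
    mkDerivation ℂ (minors (G a lam))
  have hF : ∀ i, d (F a lam i) = 0 := by
    intro i
    have h1 := derivation_aeval (ξ := (X : Fin (n + 1) → MvPolynomial (Fin (n + 1)) ℂ)) d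
      (F a lam i)
    simp only [aeval_X_left_apply, smul_eq_mul] at h1
    rw [h1]
    have h2 : ∀ k, d (X k) = minors (G a lam) k := fun k => mkDerivation_X ℂ _ k
    simp_rw [h2]
    exact sum_mul_minors (G a lam) i
  have hd : ∀ p, aeval ξ p = 0 → aeval ξ (d p) = 0 := by
    intro p hp
    replace hp := hξ.mem_span p hp
    induction hp using Submodule.span_induction with
    | mem p hp =>
      obtain ⟨i, rfl⟩ := hp
      rw [hF, map_zero]
    | zero => simp
    | add p q _ _ hp hq => rw [map_add, map_add, hp, hq, add_zero]
    | smul q p hp' hp =>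
      have hp'' : aeval ξ p = 0 := by
        have hle : Ideal.span (Set.range (F a lam)) ≤
            RingHom.ker (aeval ξ : MvPolynomial (Fin (n + 1)) ℂ →ₐ[ℂ] T) := by
          rw [Ideal.span_le]
          rintro _ ⟨i, rfl⟩
          exact hξ.aeval_F i
        exact hle hp'
      rw [smul_eq_mul, Derivation.leibniz, map_add, smul_eq_mul, smul_eq_mul, map_mul, map_mul,
        hp, hp'', mul_zero, zero_mul, add_zero]
  refine ⟨Derivation.liftOfSurjective hξ.surjective hd, fun k => ?_⟩
  have := Derivation.liftOfSurjective_apply hξ.surjective hd (X k)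
  rw [aeval_X] at this
  rw [this, tangent]
  congr 1
  exact mkDerivation_X ℂ _ k

/-! ### Leading terms of the tangent vector field -/

lemma IsCurve.hasSymbol_pderiv_monomial (h : IsCurve a lam ξ) (k : Fin (n + 1))
    (s : Fin (n + 1) →₀ ℕ) (z : ℂ) :
    HasSymbol h.symbol (weight a s - a k) (aeval ξ (pderiv k (monomial s z))) (z * s k) := by
  rw [pderiv_monomial, aeval_monomial_eq]
  rcases Nat.eq_zero_or_pos (s k) with h0 | h0
  · rw [h0]
    simpa using HasSymbol.zero h.symbol _
  · have h1 : weight a s =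
        weight a ((s - Finsupp.single k 1 : Fin (n + 1) →₀ ℕ) : Fin (n + 1) → ℕ) + a k := by
      have h2 : (s : Fin (n + 1) → ℕ) =
          ((s - Finsupp.single k 1 : Fin (n + 1) →₀ ℕ) : Fin (n + 1) → ℕ) + Pi.single k 1 := by
        funext j
        by_cases hj : j = k
        · subst hj
          simp
          omega
        · simp [hj]
      conv_lhs => rw [h2, weight_add, weight_single, mul_one]
    refine ((h.hasSymbol_monom _).smul (z * s k)).congr ?_ (by simp)
    rw [h1]; push_cast; ring

variable (a) in
/-- The leading terms of the matrix `G`. -/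
def leadG : Matrix (Fin n) (Fin (n + 1)) ℂ :=
  Matrix.of fun i k => (Pi.single i.succ (ratio a i) : Fin (n + 1) → ℕ) k - ell a i k

lemma IsCurve.hasSymbol_G (h : IsCurve a lam ξ) (i : Fin n) (k : Fin (n + 1)) :
    HasSymbol h.symbol ((a i.succ * ratio a i : ℕ) - a k) ((G a lam).map (aeval ξ) i k)
      (leadG a i k) := by
  change HasSymbol _ _ (aeval ξ (pderiv k (F a lam i))) _
  have ha := h.telescopic
  rw [F_eq a ha, map_sub, map_sub, map_sum, map_sub, map_sub, map_sum]
  have h1 := h.hasSymbol_pderiv_monomial k (Finsupp.single i.succ (ratio a i)) 1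
  have h2 := h.hasSymbol_pderiv_monomial k (Finsupp.equivFunOnFinite.symm (ell a i)) 1
  have hw : weight a ⇑(Finsupp.equivFunOnFinite.symm (ell a i)) = a i.succ * ratio a i :=
    (ha.ell_spec i).2.1
  rw [Finsupp.single_eq_pi_single, weight_single] at h1
  rw [hw] at h2
  have h3 : ∀ α ∈ lowerExponents a i, HasSymbol h.symbol ((a i.succ * ratio a i : ℕ) - a k)
      (aeval ξ (pderiv k (monomial (Finsupp.equivFunOnFinite.symm α) (lam i α)))) 0 := by
    intro α hα
    refine (h.hasSymbol_pderiv_monomial k _ _).of_lt ?_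
    have := (mem_lowerExponents hα).2
    change ((weight a α : ℕ) : ℤ) - _ < _
    omega
  refine ((h1.sub h2).sub (HasSymbol.sum h3)).congr rfl ?_
  simp [leadG]

/-- The vector (a_k) lies in the kernel of `leadG`, since x_i^{r_i} and x^{ℓ_i} have equal weight;
so the minors are proportional to it. The first minor belongs to a lower triangular matrix with
diagonal r_i, whose product a_1 fixes the factor. -/
lemma IsTelescopic.minors_leadG (ha : IsTelescopic a) (k : Fin (n + 1)) :
    minors (leadG a) k = a k := by
  have h0 : minors (leadG a) 0 = a 0 := by
    rw [minors_zero, Matrix.det_of_isLowerTriangular]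
    · rw [← ha.prod_ratio, Nat.cast_prod]
      refine Finset.prod_congr rfl fun i _ => ?_
      simp [leadG, (ha.ell_spec i).2.2 i.succ Fin.castSucc_lt_succ]
    · intro i j hij
      have hij : i < j := hij
      have h1 : j.succ ≠ i.succ := fun h => hij.ne' (Fin.succ_injective _ h)
      have h2 : ell a i j.succ = 0 := (ha.ell_spec i).2.2 _ (by
        rw [Fin.lt_def, Fin.val_castSucc, Fin.val_succ]
        rw [Fin.lt_def] at hij
        omega)
      simp [leadG, Pi.single_eq_of_ne h1, h2]
  have hv : ∀ i, ∑ k, leadG a i k • (a k : ℂ) = 0 := by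
    intro i
    have h1 := (ha.ell_spec i).2.1
    rw [← weight_single, weight, weight] at h1
    have h2 : (∑ k, (a k : ℂ) * ell a i k) =
        ∑ k, (a k : ℂ) * (Pi.single i.succ (ratio a i) : Fin (n + 1) → ℕ) k := by
      exact_mod_cast h1
    simp only [leadG, Matrix.of_apply, smul_eq_mul, sub_mul, Finset.sum_sub_distrib]
    rw [sub_eq_zero]
    simp_rw [mul_comm _ (a _ : ℂ)]
    exact h2.symm
  have h1 := minors_smul_comm (leadG a) hv 0 k
  rw [h0, smul_eq_mul, smul_eq_mul, mul_comm] at h1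
  have h2 : (a 0 : ℂ) ≠ 0 := by exact_mod_cast (ha.pos 0).ne'
  exact (mul_right_cancel₀ h2 h1).symm

/-- The degree is the sum of the a_i r_i over i ≥ 2 minus the sum of the a_j over j ≠ k, which is
`frob a + a k`. -/
lemma IsCurve.hasSymbol_tangent (h : IsCurve a lam ξ) (k : Fin (n + 1)) :
    HasSymbol h.symbol (a k + frob a) (tangent a lam ξ k) (a k : ℂ) := by
  rw [tangent_eq, ← h.telescopic.minors_leadG, minors, minors]
  have h1 : HasSymbol h.symbol (∑ i : Fin n, ((a i.succ * ratio a i : ℕ) : ℤ) -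
      ∑ j : Fin n, (a (k.succAbove j) : ℤ)) (((G a lam).map (aeval ξ)).submatrix id k.succAbove).det
      ((leadG a).submatrix id k.succAbove).det :=
    HasSymbol.det fun i j => h.hasSymbol_G i (k.succAbove j)
  have h2 := ((HasSymbol.one h.symbol).neg.pow (k : ℕ)).mul h1
  refine h2.congr ?_ rfl
  have h3 := Fin.sum_univ_succAbove (fun j => (a j : ℤ)) k
  have h4 := Fin.sum_univ_succ (fun j => (a j : ℤ))
  have h5 : frob a = ∑ i : Fin n, ((a i.succ * ratio a i : ℕ) : ℤ) - ∑ j, (a j : ℤ) := by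
    rw [frob, h4]
    simp only [mul_sub, Finset.sum_sub_distrib, mul_one]
    push_cast
    ring
  rw [h5]
  linarith

end CurveDerivation

/-! ### Valuations that are not regular on the affine curve -/

section Valuation

set_option linter.unusedSectionVars false

variable {n : ℕ} {a : Fin (n + 1) → ℕ} {lam : Fin n → (Fin (n + 1) → ℕ) → ℂ}
variable {K : Type*} [Field K] [Algebra ℂ K] {ξ : Fin (n + 1) → K}
variable {Γ₀ : Type*} [LinearOrderedCommGroupWithZero Γ₀] {V : Valuation K Γ₀}

lemma valuation_algebraMap_eq_one (hV : ∀ z : ℂ, V (algebraMap ℂ K z) ≤ 1) {z : ℂ} (hz : z ≠ 0) :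
    V (algebraMap ℂ K z) = 1 := by
  refine le_antisymm (hV z) ?_
  have h1 : V (algebraMap ℂ K z) * V (algebraMap ℂ K z⁻¹) = 1 := by
    rw [← map_mul, ← map_mul, mul_inv_cancel₀ hz, map_one, map_one]
  calc (1 : Γ₀) = V (algebraMap ℂ K z) * V (algebraMap ℂ K z⁻¹) := h1.symm
    _ ≤ V (algebraMap ℂ K z) * 1 := mul_le_mul_right (hV _) _
    _ = _ := mul_one _

lemma valuation_smul_le (hV : ∀ z : ℂ, V (algebraMap ℂ K z) ≤ 1) (z : ℂ) (f : K) :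
    V (z • f) ≤ V f := by
  rw [Algebra.smul_def, map_mul]
  calc _ ≤ 1 * V f := mul_le_mul_left (hV _) _
    _ = _ := one_mul _

lemma valuation_monom_le {ρ : Γ₀} (hρ : ∀ k, V (ξ k) ≤ ρ ^ a k) (γ : Fin (n + 1) → ℕ) :
    V (monom ξ γ) ≤ ρ ^ weight a γ := by
  rw [monom, map_prod, weight, ← Finset.prod_pow_eq_pow_sum]
  refine Finset.prod_le_prod (fun _ _ => zero_le) fun k _ => ?_
  rw [map_pow, pow_mul]
  exact pow_le_pow_left₀ zero_le (hρ k) _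

lemma valuation_monom_eq {ρ : Γ₀} {γ : Fin (n + 1) → ℕ}
    (hρ : ∀ k, γ k ≠ 0 → V (ξ k) = ρ ^ a k) :
    V (monom ξ γ) = ρ ^ weight a γ := by
  rw [monom, map_prod, weight, ← Finset.prod_pow_eq_pow_sum]
  refine Finset.prod_congr rfl fun k _ => ?_
  rw [map_pow, pow_mul]
  by_cases h : γ k = 0
  · rw [h, pow_zero, pow_zero]
  · rw [hρ k h]

/-- The equations of the curve force the pole orders of the coordinate functions to be proportional
to the weights. -/
lemma exists_valuation_eq_pow_of_roots (ha : IsTelescopic a)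
    (hF : ∀ i, aeval ξ (F a lam i) = 0) (hV : ∀ z : ℂ, V (algebraMap ℂ K z) ≤ 1)
    {r : Fin (n + 1) → Γ₀} (hr : ∀ k, V (ξ k) = r k ^ a k) (h1 : ∃ k, 1 < V (ξ k)) :
    ∃ ρ : Γ₀, 1 < ρ ∧ ∀ k, V (ξ k) = ρ ^ a k := by
  -- Here r k is the size of ξ_k per unit of weight. Its maximum ρ bounds all coordinates by
  -- ρ^{a_k}, with equality at k₀; equality has to be spread to all indices.
  obtain ⟨k₀, hk₀⟩ := Finite.exists_max r
  set ρ := r k₀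
  have hle : ∀ k, V (ξ k) ≤ ρ ^ a k := fun k => by
    rw [hr]; exact pow_le_pow_left₀ zero_le (hk₀ k) _
  have hρ : 1 < ρ := by
    obtain ⟨k, hk⟩ := h1
    by_contra! h
    exact absurd (hk.trans_le (hle k)) (not_lt.2 (pow_le_one₀ zero_le h))
  have hρ0 : 0 < ρ := zero_lt_one.trans hρ
  have hlower : ∀ i, V (ξ i.succ ^ ratio a i - monom ξ (ell a i)) <
      ρ ^ (a i.succ * ratio a i) := by
    intro i
    have h := hF i
    rw [F_eq a ha, map_sub, map_sub, map_sum] at h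
    simp_rw [aeval_monomial_eq, one_smul] at h
    rw [sub_eq_zero, Finsupp.single_eq_pi_single, monom_single] at h
    change _ - monom ξ (ell a i) = _ at h
    rw [h]
    refine Valuation.map_sum_lt _ (pow_pos hρ0 _).ne' fun α hα => ?_
    refine (valuation_smul_le hV _ _).trans_lt ((valuation_monom_le hle _).trans_lt ?_)
    exact pow_lt_pow_right₀ hρ (mem_lowerExponents hα).2
  -- If ξ_i attains the bound, so does the monomial x^{ℓ_i}, since their difference x_i^{r_i} -
  -- x^{ℓ_i} is smaller. Then no variable occurring in x^{ℓ_i} can fall short.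
  have hdown : ∀ i : Fin n, V (ξ i.succ) = ρ ^ a i.succ →
      ∀ j, ell a i j ≠ 0 → V (ξ j) = ρ ^ a j := by
    intro i hi j hj
    have h2 : V (monom ξ (ell a i)) = ρ ^ (a i.succ * ratio a i) := by
      have h3 : V (ξ i.succ ^ ratio a i) = ρ ^ (a i.succ * ratio a i) := by
        rw [map_pow, hi, pow_mul]
      rw [← sub_sub_cancel (ξ i.succ ^ ratio a i) (monom ξ (ell a i)),
        Valuation.map_sub_eq_of_lt_left, h3]
      rw [h3]; exact hlower i
    by_contra hne
    have hlt := lt_of_le_of_ne (hle j) hne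
    have h4 : ell a i = Function.update (ell a i) j (ell a i j - 1) + Pi.single j 1 := by
      funext l
      by_cases hl : l = j
      · subst hl; simp; omega
      · simp [hl]
    have h5 := (ha.ell_spec i).2.1
    rw [h4, monom_add, monom_single, pow_one, map_mul] at h2
    rw [h4, weight_add, weight_single, mul_one] at h5
    rw [← h5, pow_add] at h2
    refine absurd h2 (ne_of_lt ?_)
    calc _ ≤ ρ ^ _ * V (ξ j) := mul_le_mul_left (valuation_monom_le hle _) _
      _ < _ := by
        refine mul_lt_mul_of_pos_left hlt (pow_pos hρ0 _)
  -- Descend from k₀: each x^{ℓ_i} contains a previous variable, so the first one is reached.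
  have h0 : V (ξ 0) = ρ ^ a 0 := by
    have key : ∀ k : Fin (n + 1), V (ξ k) = ρ ^ a k → V (ξ 0) = ρ ^ a 0 := by
      intro k
      induction k using WellFoundedLT.induction with
      | _ k ih =>
        refine Fin.cases (fun _ h => h) (fun i ih hi => ?_) k ih
        have h2 : ∃ j, ell a i j ≠ 0 := by
          by_contra! h
          have h3 := (ha.ell_spec i).2.1
          simp only [weight, h, mul_zero, Finset.sum_const_zero] at h3
          exact (Nat.mul_pos (ha.pos _) (ha.ratio_pos i)).ne h3
        obtain ⟨j, hj⟩ := h2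
        refine ih j ?_ (hdown i hi j hj)
        by_contra! hle'
        exact hj ((ha.ell_spec i).2.2 j (Fin.castSucc_lt_succ.trans_le hle'))
    exact key k₀ (hr k₀)
  -- Climb back: once all previous variables attain the bound, so does x^{ℓ_i}, hence x_i^{r_i},
  -- hence x_i.
  refine ⟨ρ, hρ, fun k => ?_⟩
  induction k using WellFoundedLT.induction with
  | _ k ih =>
    refine Fin.cases (fun _ => h0) (fun i ih => ?_) k ih
    have h2 : V (monom ξ (ell a i)) = ρ ^ (a i.succ * ratio a i) := by
      rw [← (ha.ell_spec i).2.1]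
      refine valuation_monom_eq fun j hj => ih j ?_
      by_contra! hle'
      exact hj ((ha.ell_spec i).2.2 j (Fin.castSucc_lt_succ.trans_le hle'))
    have h3 : V (ξ i.succ ^ ratio a i) = ρ ^ (a i.succ * ratio a i) := by
      rw [← sub_add_cancel (ξ i.succ ^ ratio a i) (monom ξ (ell a i)),
        Valuation.map_add_eq_of_lt_right, h2]
      rw [h2]; exact hlower i
    rw [map_pow, pow_mul] at h3
    exact (pow_left_inj₀ zero_le zero_le (ha.ratio_pos i).ne').1 h3

/-- The value group need not contain a_k-th roots of the V(ξ_k). Raising V to the power ∏ a_k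
provides them and does not change the valuation ring. -/
lemma exists_valuation_eq_pow (ha : IsTelescopic a)
    (hF : ∀ i, aeval ξ (F a lam i) = 0) (hV : ∀ z : ℂ, V (algebraMap ℂ K z) ≤ 1)
    (h1 : ∃ k, 1 < V (ξ k)) :
    ∃ (V' : Valuation K Γ₀) (ρ : Γ₀), (∀ f, V' f ≤ 1 ↔ V f ≤ 1) ∧ 1 < ρ ∧
      ∀ k, V' (ξ k) = ρ ^ a k := by
  set A := ∏ k, a k with hA
  have hA0 : A ≠ 0 := Finset.prod_ne_zero_iff.2 fun k _ => (ha.pos k).ne'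
  let V' : Valuation K Γ₀ := V.map (powMonoidWithZeroHom hA0)
    (fun x y h => pow_le_pow_left₀ zero_le h _)
  have hV' : ∀ f, V' f = V f ^ A := fun f => rfl
  have hiff : ∀ f, V' f ≤ 1 ↔ V f ≤ 1 := fun f => by
    rw [hV', pow_le_one_iff_of_nonneg zero_le hA0]
  obtain ⟨ρ, h2, h3⟩ := exists_valuation_eq_pow_of_roots (V := V') ha hF
    (fun z => (hiff _).2 (hV z)) (r := fun k => V (ξ k) ^ (A / a k))
    (fun k => by
      rw [hV', ← pow_mul, Nat.div_mul_cancel (Finset.dvd_prod_of_mem a (Finset.mem_univ k))])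
    (by
      obtain ⟨k, hk⟩ := h1
      exact ⟨k, by rw [← not_le, hiff, not_le]; exact hk⟩)
  exact ⟨V', ρ, hiff, h2, h3⟩

variable {ρ : Γ₀}

/-- The monomials in B have distinct values, so in a vanishing combination the term of largest
weight would dominate all others. -/
lemma linearIndependent_of_valuation (ha : IsTelescopic a)
    (hV : ∀ z : ℂ, V (algebraMap ℂ K z) ≤ 1) (hρ : 1 < ρ) (h : ∀ k, V (ξ k) = ρ ^ a k) :
    LinearIndependent ℂ fun α : B a => monom ξ (α : Fin (n + 1) → ℕ) := by
  classical
  rw [linearIndependent_iff']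
  intro s g hg
  by_contra! hne
  obtain ⟨α₀, hα₀, hg₀⟩ := hne
  obtain ⟨α, hα, hmax⟩ := Finset.exists_max_image (s.filter fun α => g α ≠ 0)
    (fun α => weight a α) ⟨α₀, Finset.mem_filter.2 ⟨hα₀, hg₀⟩⟩
  obtain ⟨hαs, hgα⟩ := Finset.mem_filter.1 hα
  have hw : ∀ β : Fin (n + 1) → ℕ, V (monom ξ β) = ρ ^ weight a β :=
    fun β => valuation_monom_eq fun k _ => h k
  have hρ0 : 0 < ρ := zero_lt_one.trans hρ
  rw [← Finset.add_sum_erase s _ hαs] at hg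
  have h1 : V (g α • monom ξ (α : Fin (n + 1) → ℕ)) = ρ ^ weight a α := by
    rw [Algebra.smul_def, map_mul, valuation_algebraMap_eq_one hV hgα, one_mul, hw]
  have h2 : V (∑ β ∈ s.erase α, g β • monom ξ (β : Fin (n + 1) → ℕ)) < ρ ^ weight a α := by
    refine Valuation.map_sum_lt _ (pow_pos hρ0 _).ne' fun β hβ => ?_
    obtain ⟨hne, hβs⟩ := Finset.mem_erase.1 hβ
    by_cases hgβ : g β = 0
    · rw [hgβ, zero_smul, map_zero]
      exact pow_pos hρ0 _
    · refine (valuation_smul_le hV _ _).trans_lt ?_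
      rw [hw]
      refine pow_lt_pow_right₀ hρ (lt_of_le_of_ne (hmax β (Finset.mem_filter.2 ⟨hβs, hgβ⟩)) ?_)
      exact fun h' => hne (Subtype.ext (ha.weight_injOn β.2 α.2 h'))
  rw [eq_neg_of_add_eq_zero_left hg, Valuation.map_neg] at h1
  exact h2.ne h1

end Valuation

/-! ### The degree as the pole order at infinity. -/

section CurveValuation

set_option linter.unusedSectionVars false

variable {n : ℕ} {a : Fin (n + 1) → ℕ} {lam : Fin n → (Fin (n + 1) → ℕ) → ℂ}
variable {T : Type*} [CommRing T] [Algebra ℂ T] {ξ : Fin (n + 1) → T}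
variable {K : Type*} [Field K] [Algebra ℂ K] [Algebra T K] [IsScalarTower ℂ T K]
variable {Γ₀ : Type*} [LinearOrderedCommGroupWithZero Γ₀] {V : Valuation K Γ₀} {ρ : Γ₀}

lemma algebraMap_monom (α : Fin (n + 1) → ℕ) :
    algebraMap T K (monom ξ α) = monom (fun k => algebraMap T K (ξ k)) α := by
  simp [monom]

lemma valuation_le_of_mem_fil (hV : ∀ z : ℂ, V (algebraMap ℂ K z) ≤ 1)
    (hρ : 1 < ρ) (hξ : ∀ k, V (algebraMap T K (ξ k)) = ρ ^ a k) {e : ℤ} {f : T}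
    (hf : f ∈ fil a ξ e) : V (algebraMap T K f) ≤ ρ ^ e := by
  induction hf using Submodule.span_induction with
  | mem f hf =>
    obtain ⟨γ, hγ, rfl⟩ := hf
    rw [algebraMap_monom, valuation_monom_eq fun k _ => hξ k, ← zpow_natCast]
    exact zpow_le_zpow_right₀ hρ.le hγ
  | zero => simp
  | add f g _ _ hf hg => rw [map_add]; exact Valuation.map_add_le _ hf hg
  | smul z f _ hf =>
    rw [algebra_compatible_smul T, smul_eq_mul, map_mul, ← IsScalarTower.algebraMap_apply,
      ← Algebra.smul_def]
    exact (valuation_smul_le hV _ _).trans hf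

lemma IsCurve.mem_fil_of_lead_eq_zero (h : IsCurve a lam ξ) {e : ℤ} {f : T}
    (hf : HasSymbol h.symbol e f 0) : f ∈ fil a ξ (e - 1) := by
  by_cases h0 : f = 0
  · rw [h0]; exact zero_mem _
  obtain ⟨D, h1, h2⟩ := h.isSeparated f h0
  have hD : D < e := by
    by_contra! hD
    rcases hD.eq_or_lt with hD | hD
    · exact h2 (hD ▸ hf.2)
    · exact h2 (hf.of_lt hD).2
  exact fil_mono ξ (by omega) h1

lemma IsCurve.exists_weight_eq (h : IsCurve a lam ξ) {e : ℤ} {f : T} (hf : h.lead e f ≠ 0) :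
    ∃ α ∈ B a, (weight a α : ℤ) = e := by
  by_contra! hne
  have : h.lead e = 0 := by
    refine h.basis.ext fun α => ?_
    rw [h.basis_apply, h.lead_monom_B α.2, if_neg (hne α α.2), LinearMap.zero_apply]
  exact hf (by rw [this, LinearMap.zero_apply])

/-- Subtracting the leading monomial, whose value is known, leaves an element of lower filtration
and so of strictly smaller value. -/
lemma IsCurve.valuation_eq (h : IsCurve a lam ξ) (hV : ∀ z : ℂ, V (algebraMap ℂ K z) ≤ 1)
    (hρ : 1 < ρ) (hξ : ∀ k, V (algebraMap T K (ξ k)) = ρ ^ a k) {e : ℤ} {f : T} {p : ℂ}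
    (hf : HasSymbol h.symbol e f p) (hp : p ≠ 0) : V (algebraMap T K f) = ρ ^ e := by
  obtain ⟨α, -, hα⟩ := h.exists_weight_eq (e := e) (f := f) (by rw [← hf.2] at hp; exact hp)
  have h1 : HasSymbol h.symbol e (p • monom ξ α) p :=
    ((h.hasSymbol_monom α).smul p).congr hα (by simp)
  have h2 : V (algebraMap T K (p • monom ξ α)) = ρ ^ e := by
    rw [algebra_compatible_smul T, smul_eq_mul, map_mul, map_mul,
      ← IsScalarTower.algebraMap_apply, valuation_algebraMap_eq_one hV hp, one_mul,
      algebraMap_monom, valuation_monom_eq fun k _ => hξ k, ← zpow_natCast, hα]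
  have h3 := valuation_le_of_mem_fil hV hρ hξ
    (h.mem_fil_of_lead_eq_zero ((hf.sub h1).congr rfl (sub_self p)))
  rw [← sub_add_cancel f (p • monom ξ α), map_add, Valuation.map_add_eq_of_lt_right, h2]
  rw [h2]
  exact h3.trans_lt (zpow_lt_zpow_right₀ hρ (by omega))

end CurveValuation

/-! ### Nonsingularity: a generating one-form and the local rings of the affine curve. -/

section Frame

set_option linter.unusedSectionVars false

variable {n : ℕ} {a : Fin (n + 1) → ℕ} {lam : Fin n → (Fin (n + 1) → ℕ) → ℂ}
variable {T : Type*} [CommRing T] [Algebra ℂ T] {ξ : Fin (n + 1) → T}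

/-- On a nonsingular curve, the components of the tangent vector field have no common zero. -/
lemma IsGenericPoint.exists_sum_mul_tangent (hξ : IsGenericPoint a lam ξ)
    (hns : IsNonsingular a lam) : ∃ q : Fin (n + 1) → T, ∑ k, q k * tangent a lam ξ k = 1 := by
  set I : Ideal (MvPolynomial (Fin (n + 1)) ℂ) :=
    Ideal.span (Set.range (F a lam)) ⊔ Ideal.span (Set.range (minors (G a lam)))
  have hI : I = ⊤ := by
    -- If the F_i and the maximal minors did not generate the unit ideal, the Nullstellensatz would
    -- give a point of the curve at which all maximal minors vanish.
    by_contra hI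
    have h1 : zeroLocus ℂ I = ∅ := by
      rw [Set.eq_empty_iff_forall_notMem]
      intro p hp
      rw [mem_zeroLocus_iff] at hp
      have hF : ∀ i, eval p (F a lam i) = 0 := fun i => by
        have := hp _ (Ideal.mem_sup_left (Ideal.subset_span ⟨i, rfl⟩))
        rwa [MvPolynomial.aeval_eq_eval] at this
      obtain ⟨k, hk⟩ := exists_minors_ne_zero _ (hns p hF)
      rw [minors_map] at hk
      have := hp _ (Ideal.mem_sup_right (Ideal.subset_span ⟨k, rfl⟩))
      rw [MvPolynomial.aeval_eq_eval] at this
      exact hk this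
    have h2 := vanishingIdeal_zeroLocus_eq_radical (K := ℂ) I
    rw [h1, vanishingIdeal_empty] at h2
    exact hI (Ideal.radical_eq_top.1 h2.symm)
  have h1 : (1 : MvPolynomial (Fin (n + 1)) ℂ) ∈ I := by rw [hI]; trivial
  obtain ⟨f, hf, g, hg, hfg⟩ := Submodule.mem_sup.1 h1
  obtain ⟨q, rfl⟩ := (Ideal.mem_span_range_iff_exists_fun).1 hg
  refine ⟨fun k => aeval ξ (q k), ?_⟩
  have hf0 : aeval ξ f = 0 := by
    have hle : Ideal.span (Set.range (F a lam)) ≤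
        RingHom.ker (aeval ξ : MvPolynomial (Fin (n + 1)) ℂ →ₐ[ℂ] T) := by
      rw [Ideal.span_le]
      rintro _ ⟨i, rfl⟩
      exact hξ.aeval_F i
    exact hle hf
  have h2 := congrArg (aeval ξ) hfg
  rw [map_add, hf0, zero_add, map_sum, map_one] at h2
  simp_rw [map_mul] at h2
  exact h2

variable (K : Type*) [Field K] [Algebra ℂ K] [Algebra T K] [IsScalarTower ℂ T K]

variable (a lam ξ) in
/-- The tangent vector field of the curve as a derivation, and the one-form without zeros and poles
on the affine curve which is dual to it. -/
structure Frame where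
  δ : Derivation ℂ T T
  δK : Derivation ℂ K K
  η : Ω[K⁄ℂ]
  coeff : Fin (n + 1) → T
  δ_coord : ∀ k, δ (ξ k) = tangent a lam ξ k
  δK_algebraMap : ∀ f, δK (algebraMap T K f) = algebraMap T K (δ f)
  D_eq : ∀ f, D ℂ K f = δK f • η
  η_eq : η = ∑ k, algebraMap T K (coeff k) • D ℂ K (algebraMap T K (ξ k))
  sum_coeff : ∑ k, coeff k * tangent a lam ξ k = 1

/-- Take η = ∑ q_k dx_k with ∑ q_k t_k = 1, where the t_k are the tangent components. The chain rule
puts (dx_k) in the kernel of G, and Cramer's rule gives dx_k = t_k η. -/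
lemma IsGenericPoint.nonempty_frame [IsDomain T] [IsFractionRing T K]
    (hξ : IsGenericPoint a lam ξ) (hns : IsNonsingular a lam) : Nonempty (Frame a lam ξ K) := by
  obtain ⟨q, hq⟩ := hξ.exists_sum_mul_tangent hns
  obtain ⟨δ, hδ⟩ := hξ.exists_derivation
  obtain ⟨δK, hδK⟩ := exists_derivation_of_isLocalization (S' := K) (nonZeroDivisors T) δ
  set ξK : Fin (n + 1) → K := fun k => algebraMap T K (ξ k) with hξK
  have haev : ∀ p, algebraMap T K (aeval (R := ℂ) ξ p) = aeval ξK p := fun p =>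
    (MvPolynomial.aeval_algebraMap_apply K ξ p).symm
  set η : Ω[K⁄ℂ] := ∑ k, algebraMap T K (q k) • D ℂ K (ξK k) with hη
  have hv : ∀ i, ∑ k, (G a lam).map (aeval ξK) i k • D ℂ K (ξK k) = 0 := by
    intro i
    have h1 := derivation_aeval (ξ := ξK) (D ℂ K) (F a lam i)
    rw [← haev, hξ.aeval_F, map_zero, map_zero] at h1
    exact h1.symm
  have htan : ∀ k, minors ((G a lam).map (aeval ξK)) k = algebraMap T K (tangent a lam ξ k) :=
    fun k => by rw [← tangent_eq, tangent, tangent, haev]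
  have hD : ∀ k, D ℂ K (ξK k) = algebraMap T K (tangent a lam ξ k) • η := by
    intro k
    have h1 := sum_smul_eq _ hv (fun l => algebraMap T K (q l)) k
    simp_rw [htan, ← map_mul] at h1
    rw [← map_sum, hq, map_one, one_smul] at h1
    exact h1
  refine ⟨⟨δ, δK, η, q, hδ, hδK, fun f => ?_, rfl, hq⟩⟩
  have h1 : D ℂ K = (LinearMap.toSpanSingleton K (Ω[K⁄ℂ]) η).compDer δK := by
    refine derivation_ext_of_isLocalization (S := T) (nonZeroDivisors T) fun s => ?_
    obtain ⟨p, rfl⟩ := hξ.surjective s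
    change D ℂ K (algebraMap T K (aeval ξ p)) = δK (algebraMap T K (aeval ξ p)) • η
    rw [haev, derivation_aeval, derivation_aeval, Finset.sum_smul]
    refine Finset.sum_congr rfl fun k _ => ?_
    rw [hD, hδK, hδ, smul_assoc]
  exact congrArg (fun d : Derivation ℂ K (Ω[K⁄ℂ]) => d f) h1

namespace Frame

variable {K} (Fr : Frame a lam ξ K)

/-- The coefficient of a one-form with respect to the form `η`. -/
def coord : Ω[K⁄ℂ] →ₗ[K] K := Fr.δK.liftKaehlerDifferential

lemma coord_D (f : K) : Fr.coord (D ℂ K f) = Fr.δK f :=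
  Derivation.liftKaehlerDifferential_comp_D _ _

lemma coord_η : Fr.coord Fr.η = 1 := by
  rw [Fr.η_eq, map_sum]
  simp_rw [map_smul, coord_D, Fr.δK_algebraMap, Fr.δ_coord, smul_eq_mul, ← map_mul]
  rw [← map_sum, Fr.sum_coeff, map_one]

lemma coord_smul_η (w : Ω[K⁄ℂ]) : Fr.coord w • Fr.η = w := by
  have hw : w ∈ Submodule.span K (Set.range (D ℂ K)) := by
    rw [KaehlerDifferential.span_range_derivation]; trivial
  induction hw using Submodule.span_induction with
  | mem w hw =>
    obtain ⟨f, rfl⟩ := hw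
    rw [coord_D, Fr.D_eq]
  | zero => simp
  | add w w' _ _ h h' => rw [map_add, add_smul, h, h']
  | smul z w _ h => rw [map_smul, smul_assoc, h]

end Frame

/-! ### Maximal ideals of the coordinate ring -/

variable {K}

lemma exists_algHom_ker_eq [Algebra.FiniteType ℂ T] (𝔪 : Ideal T) [h𝔪 : 𝔪.IsMaximal] :
    ∃ ev : T →ₐ[ℂ] ℂ, ∀ f, f ∈ 𝔪 ↔ ev f = 0 := by
  let _ : Field (T ⧸ 𝔪) := Ideal.Quotient.field 𝔪
  have : Module.Finite ℂ (T ⧸ 𝔪) := finite_of_finite_type_of_isJacobsonRing ℂ (T ⧸ 𝔪)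
  have hb : Function.Bijective (algebraMap ℂ (T ⧸ 𝔪)) :=
    IsAlgClosed.algebraMap_bijective_of_isIntegral
  refine ⟨((AlgEquiv.ofBijective (Algebra.ofId ℂ (T ⧸ 𝔪)) hb).symm : (T ⧸ 𝔪) →ₐ[ℂ] ℂ).comp
    (Ideal.Quotient.mkₐ ℂ 𝔪), fun f => ?_⟩
  rw [← Ideal.Quotient.eq_zero_iff_mem]
  simp

lemma IsGenericPoint.sub_mem_span (hξ : IsGenericPoint a lam ξ) (ev : T →ₐ[ℂ] ℂ) (f : T) :
    f - algebraMap ℂ T (ev f) ∈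
      Ideal.span (Set.range fun k => ξ k - algebraMap ℂ T (ev (ξ k))) := by
  obtain ⟨p, rfl⟩ := hξ.surjective f
  change aeval ξ p - _ ∈ _
  induction p using MvPolynomial.induction_on with
  | C z => simp
  | add p q hp hq =>
    rw [map_add, map_add, map_add, add_sub_add_comm]
    exact add_mem hp hq
  | mul_X p j hp =>
    have h1 : ξ j - algebraMap ℂ T (ev (ξ j)) ∈
      Ideal.span (Set.range fun k => ξ k - algebraMap ℂ T (ev (ξ k))) :=
      Ideal.subset_span ⟨j, rfl⟩
    have h2 := add_mem (Ideal.mul_mem_left _ (aeval ξ p) h1)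
      (Ideal.mul_mem_left _ (algebraMap ℂ T (ev (ξ j))) hp)
    rw [map_mul, map_mul, map_mul, aeval_X]
    convert h2 using 1
    ring

/-- `f ↦ f - f(q)` modulo the square of the maximal ideal of the point `q`. -/
def evDerivation (ev : T →ₐ[ℂ] ℂ) : Derivation ℂ T (T ⧸ (RingHom.ker ev) ^ 2) :=
  Derivation.mk' ((Ideal.Quotient.mkₐ ℂ ((RingHom.ker ev) ^ 2)).toLinearMap ∘ₗ
    (LinearMap.id - (Algebra.linearMap ℂ T) ∘ₗ ev.toLinearMap)) fun f g => by
    have h1 : ∀ f, f - algebraMap ℂ T (ev f) ∈ RingHom.ker ev := fun f => by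
      simp [RingHom.mem_ker]
    have h2 : (f - algebraMap ℂ T (ev f)) * (g - algebraMap ℂ T (ev g)) ∈ (RingHom.ker ev) ^ 2 := by
      rw [pow_two]; exact Ideal.mul_mem_mul (h1 f) (h1 g)
    rw [Algebra.smul_def, Algebra.smul_def]
    simp only [LinearMap.comp_apply, LinearMap.sub_apply, LinearMap.id_apply,
      AlgHom.toLinearMap_apply, Algebra.linearMap_apply, Ideal.Quotient.mkₐ_eq_mk]
    rw [Ideal.Quotient.algebraMap_eq, ← map_mul (Ideal.Quotient.mk _),
      ← map_mul (Ideal.Quotient.mk _), ← map_add, Ideal.Quotient.eq, ← neg_mem_iff]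
    convert h2 using 1
    rw [map_mul, map_mul]
    ring

lemma evDerivation_apply (ev : T →ₐ[ℂ] ℂ) (f : T) :
    evDerivation ev f = Ideal.Quotient.mk _ (f - algebraMap ℂ T (ev f)) := rfl

lemma IsGenericPoint.finiteType (hξ : IsGenericPoint a lam ξ) : Algebra.FiniteType ℂ T :=
  Algebra.FiniteType.of_surjective (aeval ξ) hξ.surjective

/-- If T were a field it would equal ℂ by the Nullstellensatz, but the first coordinate has positive
degree and is not constant. -/
lemma IsCurve.not_isField (h : IsCurve a lam ξ) : ¬ IsField T := by
  intro hT
  have := h.toIsGenericPoint.finiteType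
  let _ := hT.toField
  have hmax : (⊥ : Ideal T).IsMaximal := Ideal.bot_isMaximal
  obtain ⟨ev, hev⟩ := exists_algHom_ker_eq (⊥ : Ideal T)
  have h1 : ξ 0 - algebraMap ℂ T (ev (ξ 0)) ∈ (⊥ : Ideal T) := by
    rw [hev]; simp
  rw [Ideal.mem_bot, sub_eq_zero, Algebra.algebraMap_eq_smul_one] at h1
  have h2 := h.hasSymbol_coord 0
  rw [h1] at h2
  have h3 := ((HasSymbol.one h.symbol).smul (ev (ξ 0))).of_lt (e' := a 0)
    (by exact_mod_cast h.telescopic.pos 0)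
  exact one_ne_zero (h2.unique h3)

/-- The local rings of a nonsingular affine curve are discrete valuation rings. -/
lemma IsCurve.isDiscreteValuationRing [IsDomain T] (h : IsCurve a lam ξ)
    (hns : IsNonsingular a lam) (𝔪 : Ideal T) [h𝔪 : 𝔪.IsMaximal] (O : Type*) [CommRing O]
    [IsDomain O] [Algebra T O] [IsLocalization.AtPrime O 𝔪] : IsDiscreteValuationRing O := by
  have hξ := h.toIsGenericPoint
  have := hξ.finiteType
  have : IsNoetherianRing T := Algebra.FiniteType.isNoetherianRing ℂ T
  have : IsNoetherianRing O := IsLocalization.isNoetherianRing 𝔪.primeCompl O inferInstance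
  have : IsLocalRing O := IsLocalization.AtPrime.isLocalRing O 𝔪
  have hinj : Function.Injective (algebraMap T O) :=
    IsLocalization.injective O (Ideal.primeCompl_le_nonZeroDivisors 𝔪)
  have hmap : 𝔪.map (algebraMap T O) = IsLocalRing.maximalIdeal O :=
    IsLocalization.AtPrime.map_eq_maximalIdeal 𝔪 O
  have hfield : ¬ IsField O := by
    intro hO
    have h1 := IsLocalRing.isField_iff_maximalIdeal_eq.1 hO
    rw [← hmap, Ideal.map_eq_bot_iff_of_injective hinj] at h1
    refine h.not_isField (Ring.isField_iff_maximal_bot.2 (h1 ▸ h𝔪))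
  refine ((IsDiscreteValuationRing.TFAE O hfield).out 4 0).1 ?_
  obtain ⟨ev, hev⟩ := exists_algHom_ker_eq 𝔪
  have hker : RingHom.ker ev = 𝔪 := by ext f; rw [hev, RingHom.mem_ker]
  set τ : Fin (n + 1) → T := fun k => ξ k - algebraMap ℂ T (ev (ξ k)) with hτ
  have hτm : ∀ k, τ k ∈ 𝔪 := fun k => by rw [hev]; simp [hτ]
  have hspan : 𝔪 = Ideal.span (Set.range τ) := by
    refine le_antisymm (fun f hf => ?_) (Ideal.span_le.2 ?_)
    · have := hξ.sub_mem_span ev f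
      rwa [(hev f).1 hf, map_zero, sub_zero] at this
    · rintro _ ⟨k, rfl⟩
      exact hτm k
  obtain ⟨q, hq⟩ := hξ.exists_sum_mul_tangent hns
  obtain ⟨k₀, hk₀⟩ : ∃ k, tangent a lam ξ k ∉ 𝔪 := by
    by_contra! hall
    refine h𝔪.ne_top (𝔪.eq_top_iff_one.2 ?_)
    rw [← hq]
    exact Submodule.sum_mem _ fun k _ => 𝔪.mul_mem_left _ (hall k)
  -- The vector of the differentials f ↦ f - f(q) modulo 𝔪² is annihilated by G, hence proportional
  -- to the tangent vector. As its k₀-th component is a unit at q, every τ_k is a multiple of τ_{k₀}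
  -- modulo 𝔪².
  have hrel : ∀ k, tangent a lam ξ k₀ * τ k - tangent a lam ξ k * τ k₀ ∈ 𝔪 ^ 2 := by
    intro k
    have h1 := minors_smul_comm _ (hξ.sum_smul_derivation (evDerivation ev)) k₀ k
    rw [← tangent_eq, ← tangent_eq, evDerivation_apply, evDerivation_apply, Algebra.smul_def,
      Algebra.smul_def, Ideal.Quotient.algebraMap_eq, ← map_mul, ← map_mul, Ideal.Quotient.eq,
      hker] at h1
    exact h1
  -- Nakayama's lemma lifts this from 𝔪 / 𝔪² to 𝔪, so the maximal ideal is principal.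
  have hle : IsLocalRing.maximalIdeal O ≤ Ideal.span {algebraMap T O (τ k₀)} := by
    refine Submodule.le_of_le_smul_of_le_jacobson_bot (I := IsLocalRing.maximalIdeal O)
      (IsNoetherian.noetherian _) (IsLocalRing.maximalIdeal_le_jacobson _) ?_
    conv_lhs => rw [← hmap, hspan, Ideal.map_span]
    rw [Ideal.span_le]
    rintro _ ⟨_, ⟨k, rfl⟩, rfl⟩
    have hu : IsUnit (algebraMap T O (tangent a lam ξ k₀)) :=
      IsLocalization.map_units O (⟨_, hk₀⟩ : 𝔪.primeCompl)
    rw [SetLike.mem_coe, ← Ideal.unit_mul_mem_iff_mem _ hu, ← map_mul,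
      ← sub_add_cancel (tangent a lam ξ k₀ * τ k) (tangent a lam ξ k * τ k₀), map_add, map_mul]
    refine add_mem (Ideal.mem_sup_right ?_) (Ideal.mem_sup_left ?_)
    · rw [smul_eq_mul, ← pow_two, ← hmap, ← Ideal.map_pow]
      exact Ideal.mem_map_of_mem _ (hrel k)
    · exact Ideal.mul_mem_left _ _ (Ideal.mem_span_singleton_self _)
  refine ⟨⟨algebraMap T O (τ k₀), le_antisymm hle ?_⟩⟩
  rw [Submodule.span_le, Set.singleton_subset_iff]
  rw [← hmap]
  exact Ideal.mem_map_of_mem _ (hτm k₀)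

end Frame

/-! ### Holomorphic forms and the genus. -/

section HolomorphicForms

set_option linter.unusedSectionVars false

variable {n : ℕ} {a : Fin (n + 1) → ℕ} {lam : Fin n → (Fin (n + 1) → ℕ) → ℂ}
variable {T : Type*} [CommRing T] [Algebra ℂ T] {ξ : Fin (n + 1) → T}
variable {K : Type} [Field K] [Algebra ℂ K] [Algebra T K] [IsScalarTower ℂ T K]

lemma Point.mem_holomorphicAt_iff (p : Point K) (w : Ω[K⁄ℂ]) :
    w ∈ p.holomorphicAt ↔ w ∈ Submodule.span p.ring {w : Ω[K⁄ℂ] | ∃ h ∈ p.ring, w = D ℂ K h} :=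
  Iff.rfl

lemma Point.smul_D_mem_holomorphicAt (p : Point K) {f h : K} (hf : f ∈ p.ring) (hh : h ∈ p.ring) :
    f • D ℂ K h ∈ p.holomorphicAt := by
  rw [Point.mem_holomorphicAt_iff]
  exact Submodule.smul_mem _ (⟨f, hf⟩ : p.ring) (Submodule.subset_span ⟨h, hh, rfl⟩)

namespace Frame

variable (Fr : Frame a lam ξ K)

lemma smul_η_mem_holomorphicAt {p : Point K} (hp : ∀ f : T, algebraMap T K f ∈ p.ring) {f : K}
    (hf : f ∈ p.ring) : f • Fr.η ∈ p.holomorphicAt := by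
  rw [Fr.η_eq, Finset.smul_sum]
  refine Submodule.sum_mem _ fun k _ => ?_
  rw [smul_smul]
  exact p.smul_D_mem_holomorphicAt (mul_mem hf (hp _)) (hp _)

/-- The coefficient of a form that is holomorphic at `p` lies in every `p.ring`-module containing
the derivatives of the functions that are holomorphic at `p`. -/
lemma coord_induction {p : Point K} {S : K → Prop} (h0 : S 0)
    (hadd : ∀ f g, S f → S g → S (f + g)) (hmul : ∀ f ∈ p.ring, ∀ g, S g → S (f * g))
    (hD : ∀ h ∈ p.ring, S (Fr.δK h)) {w : Ω[K⁄ℂ]} (hw : w ∈ p.holomorphicAt) :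
    S (Fr.coord w) := by
  rw [Point.mem_holomorphicAt_iff] at hw
  induction hw using Submodule.span_induction with
  | mem w hw =>
    obtain ⟨h, hh, rfl⟩ := hw
    rw [coord_D]
    exact hD h hh
  | zero => rwa [map_zero]
  | add w w' _ _ h h' => rw [map_add]; exact hadd _ _ h h'
  | smul z w _ h =>
    have h1 : Fr.coord (z • w) = z * Fr.coord w := by
      rw [← smul_eq_mul, ← map_smul]; rfl
    rw [h1]
    exact hmul _ z.2 _ h

lemma δK_div [IsFractionRing T K] {f g : T} (hg : g ≠ 0) [IsDomain T] :
    Fr.δK (algebraMap T K f / algebraMap T K g) =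
      algebraMap T K (g * Fr.δ f - f * Fr.δ g) / algebraMap T K g ^ 2 := by
  have hg' : algebraMap T K g ≠ 0 := by
    rwa [Ne, FaithfulSMul.algebraMap_eq_zero_iff]
  rw [Derivation.leibniz_div, Fr.δK_algebraMap, Fr.δK_algebraMap]
  simp only [map_sub, map_mul, smul_eq_mul]
  field_simp

end Frame

variable [IsDomain T] [IsFractionRing T K]

/-- A form that is holomorphic on the nonsingular affine curve has a regular coefficient. -/
lemma Frame.coord_mem_range (Fr : Frame a lam ξ K) (h : IsCurve a lam ξ)
    (hns : IsNonsingular a lam) {w : Ω[K⁄ℂ]}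
    (hw : ∀ p : Point K, (∀ f : T, algebraMap T K f ∈ p.ring) → w ∈ p.holomorphicAt) :
    ∃ f : T, algebraMap T K f = Fr.coord w := by
  -- T is the intersection of its localizations at maximal ideals, and each of these is the local
  -- ring of a point of the affine curve.
  have h1 := MaximalSpectrum.iInf_localization_eq_bot T K
  suffices h2 : Fr.coord w ∈ (⊥ : Subalgebra T K) from Algebra.mem_bot.1 h2
  rw [← h1, Algebra.mem_iInf]
  intro v
  have hle := v.asIdeal.primeCompl_le_nonZeroDivisors
  set O := Localization.subalgebra.ofField K v.asIdeal.primeCompl hle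
  have hmem : ∀ f : K, f ∈ O ↔ ∃ s t : T, t ∉ v.asIdeal ∧
      f = algebraMap T K s * (algebraMap T K t)⁻¹ := by
    intro f
    rw [← SetLike.mem_coe]
    change f ∈ {x : K | _} ↔ _
    constructor
    · rintro ⟨s, t, ht, rfl⟩; exact ⟨s, t, ht, rfl⟩
    · rintro ⟨s, t, ht, rfl⟩; exact ⟨s, t, ht, rfl⟩
  have hv := v.isMaximal
  have : IsLocalization.AtPrime O v.asIdeal :=
    Localization.subalgebra.isLocalization_ofField K v.asIdeal.primeCompl hle
  have hdvr : IsDiscreteValuationRing O := h.isDiscreteValuationRing hns v.asIdeal O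
  have hfrac : IsFractionRing O K :=
    Localization.subalgebra.isFractionRing_ofField K v.asIdeal.primeCompl hle
  let p : Point K :=
    { ring := O.restrictScalars ℂ
      isDomain := inferInstanceAs (IsDomain O)
      isDiscreteValuationRing := hdvr
      isFractionRing := hfrac }
  have hp : ∀ f, f ∈ p.ring ↔ f ∈ O := fun f => Iff.rfl
  rw [← hp]
  -- Each localization is stable under the derivation by the quotient rule, so it contains the
  -- coefficients of all forms that are holomorphic there.
  refine Fr.coord_induction (p := p) (S := fun f => f ∈ p.ring) (zero_mem _)
    (fun _ _ => add_mem) (fun f hf g hg => mul_mem hf hg) ?_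
    (hw p fun f => O.algebraMap_mem f)
  intro f hf
  rw [hp, hmem] at hf ⊢
  obtain ⟨s, t, ht, rfl⟩ := hf
  have ht0 : t ≠ 0 := fun h0 => ht (h0 ▸ v.asIdeal.zero_mem)
  rw [← div_eq_mul_inv, Fr.δK_div ht0]
  refine ⟨t * Fr.δ s - s * Fr.δ t, t ^ 2, fun h2 => ht (hv.isPrime.mem_of_pow_mem 2 h2), ?_⟩
  rw [div_eq_mul_inv, map_pow]

/-- A valuation of the points at infinity, measured with the weights. -/
lemma Point.exists_valuation (ha : IsTelescopic a) (hξ : IsGenericPoint a lam ξ) {p : Point K}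
    (hp : ¬ ∀ f : T, algebraMap T K f ∈ p.ring) :
    ∃ (Γ₀ : Type) (_ : LinearOrderedCommGroupWithZero Γ₀) (V : Valuation K Γ₀) (ρ : Γ₀),
      (∀ f, V f ≤ 1 ↔ f ∈ p.ring) ∧ 1 < ρ ∧ ∀ k, V (algebraMap T K (ξ k)) = ρ ^ a k := by
  let V := ValuationRing.valuation p.ring K
  have hV : ∀ f, V f ≤ 1 ↔ f ∈ p.ring := by
    intro f
    rw [← Valuation.mem_integer_iff, ValuationRing.mem_integer_iff]
    exact ⟨fun ⟨b, hb⟩ => hb ▸ b.2, fun hf => ⟨⟨f, hf⟩, rfl⟩⟩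
  have haev : ∀ q, algebraMap T K (aeval (R := ℂ) ξ q) = aeval (fun k => algebraMap T K (ξ k)) q :=
    fun q => (MvPolynomial.aeval_algebraMap_apply K ξ q).symm
  obtain ⟨V', ρ, h1, h2, h3⟩ := exists_valuation_eq_pow (lam := lam) (V := V)
    (ξ := fun k => algebraMap T K (ξ k)) ha
    (fun i => by rw [← haev, hξ.aeval_F, map_zero])
    (fun z => by rw [hV]; exact p.ring.algebraMap_mem z)
    -- Some coordinate function has a pole at p, since otherwise all of T would be holomorphic
    -- there.
    (by
      by_contra! hall
      refine hp fun f => ?_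
      obtain ⟨q, rfl⟩ := hξ.surjective f
      rw [haev]
      induction q using MvPolynomial.induction_on with
      | C z => rw [aeval_C]; exact p.ring.algebraMap_mem z
      | add q r hq hr => rw [map_add]; exact add_mem hq hr
      | mul_X q k hq => rw [map_mul, aeval_X]; exact mul_mem hq ((hV _).1 (hall k)))
  exact ⟨_, _, V', ρ, fun f => (h1 f).trans (hV f), h2, h3⟩

section AtInfinity

lemma Frame.hasSymbol_δ (Fr : Frame a lam ξ K) (h : IsCurve a lam ξ) {e : ℤ} {f : T} {z : ℂ}
    (hf : HasSymbol h.symbol e f z) :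
    HasSymbol h.symbol (e + frob a) (Fr.δ f) (e * z) :=
  IsCurve.hasSymbol_derivation (fun k => by rw [Fr.δ_coord]; exact h.hasSymbol_tangent k) hf

variable {Γ₀ : Type} [LinearOrderedCommGroupWithZero Γ₀] {V : Valuation K Γ₀} {ρ : Γ₀}
  {p : Point K}

/-- A quotient τ of monomials of weights `frob a + 1` and `frob a + 2` vanishes to first order at
infinity, and δ(τ) has degree exactly `frob a - 1`. Hence f η = (f / δ(τ)) dτ with a holomorphic
coefficient. -/
lemma Frame.smul_η_mem_holomorphicAt_of_mem_fil
    (Fr : Frame a lam ξ K) (h : IsCurve a lam ξ) (hV : ∀ f, V f ≤ 1 ↔ f ∈ p.ring) (hρ : 1 < ρ)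
    (hξ : ∀ k, V (algebraMap T K (ξ k)) = ρ ^ a k) {f : T} (hf : f ∈ fil a ξ (frob a - 1)) :
    algebraMap T K f • Fr.η ∈ p.holomorphicAt := by
  have hρ0 : ρ ≠ 0 := (zero_lt_one.trans hρ).ne'
  have hVC : ∀ z : ℂ, V (algebraMap ℂ K z) ≤ 1 := fun z => by
    rw [hV]; exact p.ring.algebraMap_mem z
  have ha := h.telescopic
  obtain ⟨α, hα, hwα⟩ := ha.exists_mem_B_weight_frob_add_one
  obtain ⟨β, hβ, hwβ⟩ : ∃ β ∈ B a, (weight a β : ℤ) = frob a + 2 := by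
    rw [ha.exists_iff_not_exists]
    rintro ⟨β, -, hβ⟩
    omega
  have hsα := h.hasSymbol_monom α
  have hsβ := h.hasSymbol_monom β
  rw [hwα] at hsα
  rw [hwβ] at hsβ
  have hvα := h.valuation_eq hVC hρ hξ hsα one_ne_zero
  have hvβ := h.valuation_eq hVC hρ hξ hsβ one_ne_zero
  have hβ0 : monom ξ β ≠ 0 := fun h0 => by
    rw [h0, map_zero, map_zero] at hvβ
    exact zpow_ne_zero _ hρ0 hvβ.symm
  set τ := algebraMap T K (monom ξ α) / algebraMap T K (monom ξ β) with hτ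
  have hτp : τ ∈ p.ring := by
    rw [← hV, hτ, map_div₀, hvα, hvβ, ← zpow_sub₀ hρ0]
    exact zpow_le_one_of_nonpos₀ hρ.le (by omega)
  -- The leading coefficient is (c + 1) - (c + 2) = -1 with c = `frob a`, so there is no
  -- cancellation. Dividing by the square of the denominator lowers the degree 3c + 3 by 2(c + 2),
  -- to c - 1.
  have hsymb : HasSymbol h.symbol (3 * frob a + 3)
      (monom ξ β * Fr.δ (monom ξ α) - monom ξ α * Fr.δ (monom ξ β)) (-1) := by
    refine ((hsβ.mul (Fr.hasSymbol_δ h hsα)).congr ?_ rfl).sub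
      ((hsα.mul (Fr.hasSymbol_δ h hsβ)).congr ?_ rfl) |>.congr rfl ?_
    · ring
    · ring
    · push_cast; ring
  have hvδ : V (Fr.δK τ) = ρ ^ (frob a - 1) := by
    rw [hτ, Fr.δK_div hβ0, map_div₀, map_pow, hvβ,
      h.valuation_eq hVC hρ hξ hsymb (neg_ne_zero.2 one_ne_zero), ← zpow_natCast, ← zpow_mul,
      ← zpow_sub₀ hρ0]
    congr 1
    push_cast
    ring
  have hδ0 : Fr.δK τ ≠ 0 := fun h0 => by
    rw [h0, map_zero] at hvδ
    exact zpow_ne_zero _ hρ0 hvδ.symm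
  have h1 : algebraMap T K f • Fr.η = (algebraMap T K f / Fr.δK τ) • D ℂ K τ := by
    rw [Fr.D_eq, smul_smul, div_mul_cancel₀ _ hδ0]
  rw [h1]
  refine p.smul_D_mem_holomorphicAt ?_ hτp
  rw [← hV, map_div₀, hvδ]
  exact div_le_one_of_le₀ (valuation_le_of_mem_fil hVC hρ hξ hf) zero_le

/-- The point is that δ(s / t) has degree at most `frob a - 1` for every quotient that is
holomorphic at infinity. If s has smaller degree than t this is the general bound; if the degrees
agree, the leading terms of t δ(s) - s δ(t) cancel. -/
lemma Frame.mem_fil_of_mem_holomorphicAt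
    (Fr : Frame a lam ξ K) (h : IsCurve a lam ξ) (hV : ∀ f, V f ≤ 1 ↔ f ∈ p.ring) (hρ : 1 < ρ)
    (hξ : ∀ k, V (algebraMap T K (ξ k)) = ρ ^ a k) {f : T}
    (hf : algebraMap T K f • Fr.η ∈ p.holomorphicAt) : f ∈ fil a ξ (frob a - 1) := by
  have hρ0 : ρ ≠ 0 := (zero_lt_one.trans hρ).ne'
  have hVC : ∀ z : ℂ, V (algebraMap ℂ K z) ≤ 1 := fun z => by
    rw [hV]; exact p.ring.algebraMap_mem z
  have h1 : V (Fr.coord (algebraMap T K f • Fr.η)) ≤ ρ ^ (frob a - 1) := by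
    refine Fr.coord_induction (p := p) (S := fun g => V g ≤ ρ ^ (frob a - 1)) ?_
      (fun _ _ => Valuation.map_add_le _) (fun g hg g' hg' => ?_) ?_ hf
    · simp
    · rw [map_mul]
      calc V g * V g' ≤ 1 * ρ ^ (frob a - 1) := mul_le_mul' ((hV g).2 hg) hg'
        _ = _ := one_mul _
    · intro g hg
      obtain ⟨s, t, ht, rfl⟩ := IsFractionRing.div_surjective (A := T) g
      have ht0 := nonZeroDivisors.ne_zero ht
      by_cases hs0 : s = 0
      · simp [hs0]
      obtain ⟨i, hi, hi0⟩ := h.isSeparated s hs0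
      obtain ⟨j, hj, hj0⟩ := h.isSeparated t ht0
      have hsi : HasSymbol h.symbol i s _ := ⟨hi, rfl⟩
      have hsj : HasSymbol h.symbol j t _ := ⟨hj, rfl⟩
      have hvt := h.valuation_eq hVC hρ hξ hsj hj0
      have hij : i ≤ j := by
        by_contra! hij
        rw [← hV, map_div₀, h.valuation_eq hVC hρ hξ hsi hi0, hvt, ← zpow_sub₀ hρ0] at hg
        exact absurd hg (not_le.2 (one_lt_zpow₀ hρ (by omega)))
      have hsymb := (((hsj.mul (Fr.hasSymbol_δ h hsi)).congr
          (show j + (i + frob a) = i + j + frob a by ring) rfl).sub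
        ((hsi.mul (Fr.hasSymbol_δ h hsj)).congr
          (show i + (j + frob a) = i + j + frob a by ring) rfl))
      have hmem : t * Fr.δ s - s * Fr.δ t ∈ fil a ξ (2 * j + frob a - 1) := by
        rcases hij.eq_or_lt with rfl | hij
        · refine fil_mono ξ (by omega) (h.mem_fil_of_lead_eq_zero (hsymb.congr rfl ?_))
          ring
        · exact fil_mono ξ (by omega) hsymb.1
      rw [Fr.δK_div ht0, map_div₀, map_pow, hvt, ← zpow_natCast, ← zpow_mul,
        div_le_iff₀ (zpow_pos (zero_lt_one.trans hρ) _), ← zpow_add₀ hρ0]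
      refine (valuation_le_of_mem_fil hVC hρ hξ hmem).trans (le_of_eq ?_)
      congr 1
      push_cast
      ring
  rw [map_smul, Fr.coord_η, smul_eq_mul, mul_one] at h1
  by_cases hf0 : f = 0
  · rw [hf0]; exact zero_mem _
  obtain ⟨D, hD, hD0⟩ := h.isSeparated f hf0
  rw [h.valuation_eq hVC hρ hξ ⟨hD, rfl⟩ hD0] at h1
  exact fil_mono ξ ((zpow_le_zpow_iff_right₀ hρ).1 h1) hD

end AtInfinity

/-- The holomorphic forms are the `f η` with `f` of pole order less than the Frobenius number. -/
lemma Frame.mem_holomorphicForms_iff (Fr : Frame a lam ξ K) (h : IsCurve a lam ξ)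
    (hns : IsNonsingular a lam) (hinfty : ∃ p : Point K, ¬ ∀ f : T, algebraMap T K f ∈ p.ring)
    (w : Ω[K⁄ℂ]) : w ∈ holomorphicForms K ↔
      ∃ f ∈ fil a ξ (frob a - 1), algebraMap T K f • Fr.η = w := by
  rw [holomorphicForms, Submodule.mem_iInf]
  constructor
  · intro hw
    obtain ⟨f, hf⟩ := Fr.coord_mem_range h hns fun p _ => hw p
    have hfw : algebraMap T K f • Fr.η = w := by rw [hf, Fr.coord_smul_η]
    obtain ⟨p, hp⟩ := hinfty
    obtain ⟨Γ₀, _, V, ρ, hV, hρ, hξ⟩ := p.exists_valuation h.telescopic h.toIsGenericPoint hp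
    exact ⟨f, Fr.mem_fil_of_mem_holomorphicAt h hV hρ hξ (hfw ▸ hw p), hfw⟩
  · rintro ⟨f, hf, rfl⟩ p
    by_cases hp : ∀ f : T, algebraMap T K f ∈ p.ring
    · exact Fr.smul_η_mem_holomorphicAt hp (hp f)
    · obtain ⟨Γ₀, _, V, ρ, hV, hρ, hξ⟩ := p.exists_valuation h.telescopic h.toIsGenericPoint hp
      exact Fr.smul_η_mem_holomorphicAt_of_mem_fil h hV hρ hξ hf

lemma Frame.genus_eq (Fr : Frame a lam ξ K) (h : IsCurve a lam ξ)
    (hns : IsNonsingular a lam) (hinfty : ∃ p : Point K, ¬ ∀ f : T, algebraMap T K f ∈ p.ring) :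
    genus K = Module.finrank ℂ (fil a ξ (frob a - 1)) := by
  let L : T →ₗ[ℂ] Ω[K⁄ℂ] :=
    ((LinearMap.toSpanSingleton K (Ω[K⁄ℂ]) Fr.η).restrictScalars ℂ).comp
      (IsScalarTower.toAlgHom ℂ T K).toLinearMap
  have hL : ∀ f, L f = algebraMap T K f • Fr.η := fun f => rfl
  have hinj : Function.Injective L := by
    intro f g hfg
    have := congrArg Fr.coord hfg
    simp only [hL, map_smul, Fr.coord_η, smul_eq_mul, mul_one] at this
    exact IsFractionRing.injective T K this
  have hmap : holomorphicForms K = (fil a ξ (frob a - 1)).map L := by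
    ext w
    rw [Fr.mem_holomorphicForms_iff h hns hinfty, Submodule.mem_map]
    rfl
  rw [genus, hmap, ← (Submodule.equivMapOfInjective L hinj _).finrank_eq]

end HolomorphicForms

/-! ### The enumeration of B, and the weights of φ_g and φ_{g+1}. -/

section Enumeration

variable {n : ℕ} {a : Fin (n + 1) → ℕ} {lam : Fin n → (Fin (n + 1) → ℕ) → ℂ}
variable {T : Type*} [CommRing T] [Algebra ℂ T] {ξ : Fin (n + 1) → T}

/-- Pole orders need not be computed: this monotonicity suffices to compare the given enumeration
with the one by weights. -/
lemma Point.poleOrder_le_of_mul {K : Type} [Field K] [Algebra ℂ K] (p : Point K) {f g : K}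
    (hf : f ∈ p.ring) : p.poleOrder (f * g) ≤ p.poleOrder g := by
  obtain ⟨s, t, ht, rfl⟩ := IsFractionRing.div_surjective (A := p.ring) g
  have ht0 := nonZeroDivisors.ne_zero ht
  -- The infimum of the empty set of naturals is 0, so the set must be seen to be nonempty: the
  -- ideal generated by the denominator of g is a power of the maximal ideal.
  have hne : {k : ℕ | ∀ u ∈ IsLocalRing.maximalIdeal p.ring ^ k,
      (u : K) * (algebraMap p.ring K s / algebraMap p.ring K t) ∈ p.ring}.Nonempty := by
    have h1 := ((IsDiscreteValuationRing.TFAE p.ring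
      (IsDiscreteValuationRing.not_isField p.ring)).out 0 6).1
      (inferInstance : IsDiscreteValuationRing p.ring)
    obtain ⟨k, hk⟩ := h1 (Ideal.span {t}) (by rwa [Ne, Ideal.span_singleton_eq_bot])
    refine ⟨k, fun u hu => ?_⟩
    rw [← hk, Ideal.mem_span_singleton'] at hu
    obtain ⟨v, rfl⟩ := hu
    have ht1 : algebraMap p.ring K t ≠ 0 := by
      rwa [Ne, FaithfulSMul.algebraMap_eq_zero_iff]
    have h2 : ((v * t : p.ring) : K) * (algebraMap p.ring K s / algebraMap p.ring K t) =
        (v * s : p.ring) := by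
      change (v : K) * algebraMap p.ring K t * _ = v * algebraMap p.ring K s
      field_simp
    rw [h2]
    exact (v * s).2
  refine Nat.sInf_le fun u hu => ?_
  rw [mul_left_comm]
  exact mul_mem hf (Nat.sInf_mem hne u hu)

/-- An enumeration of `B` by the pole orders at infinity is the enumeration by the weights. -/
lemma Point.strictMono_weight {K : Type} [Field K] [Algebra ℂ K] {ζ : Fin (n + 1) → K}
    {Γ₀ : Type} [LinearOrderedCommGroupWithZero Γ₀] {V : Valuation K Γ₀} {ρ : Γ₀} {p : Point K}
    (hV : ∀ f, V f ≤ 1 ↔ f ∈ p.ring) (hρ : 1 < ρ) (hζ : ∀ k, V (ζ k) = ρ ^ a k)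
    {φ : ℕ → Fin (n + 1) → ℕ} (hφ : StrictMono fun i => p.poleOrder (monom ζ (φ i))) :
    StrictMono fun i => weight a (φ i) := by
  intro i j hij
  by_contra! hle
  refine absurd (hφ hij) (not_lt.2 ?_)
  have hw : ∀ γ : Fin (n + 1) → ℕ, V (monom ζ γ) = ρ ^ weight a γ :=
    fun γ => valuation_monom_eq fun k _ => hζ k
  have hρ0 : ρ ≠ 0 := (zero_lt_one.trans hρ).ne'
  have h0 : monom ζ (φ i) ≠ 0 := fun h0 => by
    have := hw (φ i)
    rw [h0, map_zero] at this
    exact pow_ne_zero _ hρ0 this.symm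
  simp only
  rw [← div_mul_cancel₀ (monom ζ (φ j)) h0]
  apply p.poleOrder_le_of_mul
  rw [← hV, map_div₀, hw, hw]
  exact div_le_one_of_le₀ (pow_le_pow_right₀ hρ.le hle) zero_le

/-- The weights `frob a - 1` and `frob a + 1` are taken and `frob a` is not, so they are
consecutive. The monomials up to the first of them are a basis of the coefficients of the
holomorphic forms, so j + 1 will be the genus. -/
lemma IsCurve.exists_enumeration_index (h : IsCurve a lam ξ) {φ : ℕ → Fin (n + 1) → ℕ}
    (hrange : Set.range φ = B a) (hmono : StrictMono fun i => weight a (φ i)) :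
    ∃ j, (weight a (φ j) : ℤ) = frob a - 1 ∧ (weight a (φ (j + 1)) : ℤ) = frob a + 1 ∧
      Module.finrank ℂ (fil a ξ (frob a - 1)) = j + 1 := by
  have hB : ∀ i, φ i ∈ B a := fun i => hrange ▸ Set.mem_range_self i
  obtain ⟨α, hα, hwα⟩ := h.telescopic.exists_mem_B_weight_frob_sub_one
  obtain ⟨β, hβ, hwβ⟩ := h.telescopic.exists_mem_B_weight_frob_add_one
  rw [← hrange] at hα hβ
  obtain ⟨j, rfl⟩ := hα
  obtain ⟨j', rfl⟩ := hβ
  have hlt : ∀ {i i'}, weight a (φ i) < weight a (φ i') ↔ i < i' := fun {i i'} => hmono.lt_iff_lt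
  have h1 : j < j' := hlt.1 (by omega)
  have h2 : j' = j + 1 := by
    by_contra hne
    have h3 := hlt.2 (show j < j + 1 by omega)
    have h4 := hlt.2 (show j + 1 < j' by omega)
    exact h.telescopic.weight_ne_frob (hB (j + 1)) (by omega)
  subst h2
  refine ⟨j, hwα, hwβ, ?_⟩
  have hset : monom ξ '' {γ | γ ∈ B a ∧ (weight a γ : ℤ) ≤ frob a - 1} =
      Set.range fun i : Fin (j + 1) => monom ξ (φ i) := by
    ext f
    constructor
    · rintro ⟨γ, ⟨hγ, hγ'⟩, rfl⟩
      rw [← hrange] at hγ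
      obtain ⟨i, rfl⟩ := hγ
      have hi : ¬ j < i := fun hi => by have := hlt.2 hi; omega
      exact ⟨⟨i, by omega⟩, rfl⟩
    · rintro ⟨i, rfl⟩
      refine ⟨φ i, ⟨hB i, ?_⟩, rfl⟩
      rw [← hwα]
      exact_mod_cast hmono.monotone (Nat.le_of_lt_succ i.2)
  have hli : LinearIndependent ℂ fun i : Fin (j + 1) => monom ξ (φ i) := by
    refine h.linearIndependent.comp (fun i : Fin (j + 1) => (⟨φ i, hB i⟩ : B a)) ?_
    intro i i' hii
    have : φ i = φ i' := congrArg Subtype.val hii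
    exact Fin.ext (hmono.injective (by simp only [this]))
  rw [h.toIsGenericPoint.fil_eq_span h.telescopic, hset, finrank_span_eq_card hli, Fintype.card_fin]

end Enumeration

/-! ### The Hilbert series of the semigroup -/

section Hilbert

variable {n : ℕ} {a : Fin (n + 1) → ℕ}

variable (a) in
/-- The generating function of the weights of the `α ∈ B` with `α_1 = 0`. -/
def hilbertNumerator : Polynomial ℂ :=
  ∏ i : Fin n, ∑ l ∈ Finset.range (ratio a i), (Polynomial.X ^ a i.succ) ^ l

open Classical in
-- Expanding the product gives one power of the variable for each exponent, and no power occurs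
-- twice because weights are injective on B.
lemma IsTelescopic.coeff_hilbertNumerator (ha : IsTelescopic a) (k : ℕ) :
    (hilbertNumerator a).coeff k =
      if ∃ α ∈ B a, α 0 = 0 ∧ weight a α = k then 1 else 0 := by
  have hw : ∀ f : Fin n → ℕ, weight a (Fin.cons 0 f : Fin (n + 1) → ℕ) =
      ∑ i, a i.succ * f i := by
    intro f
    rw [weight, Fin.sum_univ_succ]
    simp
  have hB : ∀ f ∈ Fintype.piFinset fun i => Finset.range (ratio a i),
      (Fin.cons 0 f : Fin (n + 1) → ℕ) ∈ B a := by
    intro f hf i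
    simpa using (Fintype.mem_piFinset.1 hf i)
  rw [hilbertNumerator, Finset.prod_univ_sum, Polynomial.finsetSum_coeff]
  have h1 : ∀ f : Fin n → ℕ, (∏ i, (Polynomial.X ^ a i.succ : Polynomial ℂ) ^ f i).coeff k =
      if weight a (Fin.cons 0 f : Fin (n + 1) → ℕ) = k then 1 else 0 := by
    intro f
    simp_rw [← pow_mul]
    rw [Finset.prod_pow_eq_pow_sum, Polynomial.coeff_X_pow, hw]
    exact if_congr eq_comm rfl rfl
  simp_rw [h1]
  split_ifs with h
  · obtain ⟨α, hα, hα0, hαk⟩ := h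
    have hcons : (Fin.cons 0 (fun i : Fin n => α i.succ) : Fin (n + 1) → ℕ) = α := by
      rw [← hα0]; exact Fin.cons_self_tail α
    rw [Finset.sum_eq_single (fun i => α i.succ)]
    · rw [hcons, if_pos hαk]
    · intro f hf hne
      refine if_neg fun hk => hne ?_
      have h2 := ha.weight_injOn (hB f hf) hα (hk.trans hαk.symm)
      rw [← h2]
      funext i
      simp
    · intro hn
      exact absurd (Fintype.mem_piFinset.2 fun i => Finset.mem_range.2 (hα i)) hn
  · refine Finset.sum_eq_zero fun f hf => if_neg fun hk => h ⟨_, hB f hf, ?_, hk⟩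
    simp

open Classical in
variable (a) in
/-- The generating function of the weights of the elements of `B`. -/
def hilbertSeries : PowerSeries ℂ :=
  PowerSeries.mk fun k => if ∃ α ∈ B a, weight a α = k then 1 else 0

/-- The first entry of an exponent in B is unrestricted. Multiplying by 1 - u^{a_1} removes the
exponents whose first entry is positive. -/
lemma IsTelescopic.one_sub_mul_hilbertSeries (ha : IsTelescopic a) :
    (1 - PowerSeries.X ^ a 0) * hilbertSeries a = (hilbertNumerator a : PowerSeries ℂ) := by
  classical
  ext k
  rw [sub_mul, one_mul, map_sub, PowerSeries.coeff_X_pow_mul', Polynomial.coeff_coe,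
    ha.coeff_hilbertNumerator, hilbertSeries, PowerSeries.coeff_mk, PowerSeries.coeff_mk]
  have hadd : ∀ β ∈ B a, β + Pi.single 0 1 ∈ B a ∧
      weight a (β + Pi.single 0 1) = weight a β + a 0 := by
    intro β hβ
    refine ⟨fun i => ?_, by rw [weight_add, weight_single, mul_one]⟩
    simpa using hβ i
  have hprev : (if a 0 ≤ k then if ∃ α ∈ B a, weight a α = k - a 0 then (1 : ℂ) else 0 else 0) =
      if ∃ β ∈ B a, weight a (β + Pi.single 0 1) = k then 1 else 0 := by
    rw [← ite_and]
    refine if_congr ⟨?_, ?_⟩ rfl rfl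
    · rintro ⟨hk, β, hβ, hβk⟩
      exact ⟨β, hβ, by rw [(hadd β hβ).2]; omega⟩
    · rintro ⟨β, hβ, hβk⟩
      rw [(hadd β hβ).2] at hβk
      exact ⟨by omega, β, hβ, by omega⟩
  rw [hprev]
  by_cases h : ∃ α ∈ B a, weight a α = k
  · obtain ⟨α, hα, hαk⟩ := h
    rw [if_pos ⟨α, hα, hαk⟩]
    by_cases h0 : α 0 = 0
    · rw [if_neg, sub_zero, if_pos ⟨α, hα, h0, hαk⟩]
      rintro ⟨β, hβ, hβk⟩
      have h3 := ha.weight_injOn (hadd β hβ).1 hα (hβk.trans hαk.symm)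
      rw [← h3] at h0
      simp at h0
    · have h1 : α - Pi.single 0 1 ∈ B a := fun i => by simpa using hα i
      have h2 : α - Pi.single 0 1 + Pi.single 0 1 = α := by
        funext j
        by_cases hj : j = 0
        · subst hj; simp; omega
        · simp [hj]
      rw [if_pos ⟨_, h1, by rw [h2, hαk]⟩, sub_self, if_neg]
      rintro ⟨β, hβ, hβ0, hβk⟩
      rw [ha.weight_injOn hβ hα (hβk.trans hαk.symm)] at hβ0
      exact h0 hβ0
  · rw [if_neg h, if_neg, sub_zero, if_neg]
    · rintro ⟨α, hα, -, hαk⟩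
      exact h ⟨α, hα, hαk⟩
    · rintro ⟨β, hβ, hβk⟩
      exact h ⟨_, (hadd β hβ).1, hβk⟩

/-- Substituting N = (1 - u^{a_1}) E, with E the series of the semigroup, the factor (1 - u^{a_1})^2
cancels and p = u^{c+1} E' + c E - u E' remains. Then use E_1 = 0 and E_{c+1} = 1. -/
lemma IsTelescopic.coeff_eq_neg_one (ha : IsTelescopic a) {c : ℕ} (hc : frob a = c)
    {p : Polynomial ℂ}
    (hp : (1 - Polynomial.X ^ a 0) ^ 2 * p =
      (1 - Polynomial.X ^ a 0) *
          (Polynomial.X ^ (c + 1) * Polynomial.derivative (hilbertNumerator a))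
        + (a 0 : ℂ) • Polynomial.X ^ (a 0 + c) * hilbertNumerator a
        - ((Polynomial.X ^ a 0 - 1) * (((c + a 0 : ℕ) : ℂ) • hilbertNumerator a -
            Polynomial.X * Polynomial.derivative (hilbertNumerator a))
          + (a 0 : ℂ) • hilbertNumerator a)) :
    p.coeff (c + 1) = -1 := by
  classical
  obtain ⟨b, hb⟩ : ∃ b, a 0 = b + 1 := ⟨a 0 - 1, by have := ha.pos 0; omega⟩
  set E := hilbertSeries a with hE
  have h1 := ha.one_sub_mul_hilbertSeries
  have h2 : (Polynomial.derivative (hilbertNumerator a) : PowerSeries ℂ) =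
      (1 - PowerSeries.X ^ a 0) * PowerSeries.derivative ℂ E -
        (a 0 : PowerSeries ℂ) * PowerSeries.X ^ b * E := by
    rw [← PowerSeries.derivative_coe, ← h1, Derivation.leibniz, map_sub, Derivation.leibniz_pow,
      Derivation.map_one_eq_zero, PowerSeries.derivative_X, hb]
    simp only [smul_eq_mul, nsmul_eq_mul, Nat.add_sub_cancel]
    ring
  have h3 := congrArg (fun q : Polynomial ℂ => (q : PowerSeries ℂ)) hp
  simp only [Polynomial.coe_mul, Polynomial.coe_sub, Polynomial.coe_add, Polynomial.coe_pow,
    Polynomial.coe_one, Polynomial.coe_X, Polynomial.coe_smul] at h3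
  rw [h2, ← h1] at h3
  have h4 : (1 - PowerSeries.X ^ a 0 : PowerSeries ℂ) ≠ 0 := by
    intro h0
    have := congrArg (PowerSeries.coeff 0) h0
    rw [map_sub, PowerSeries.coeff_X_pow, if_neg (ha.pos 0).ne] at this
    simp at this
  have h5 : (p : PowerSeries ℂ) = PowerSeries.X ^ (c + 1) * PowerSeries.derivative ℂ E
      + (c : PowerSeries ℂ) * E - PowerSeries.X * PowerSeries.derivative ℂ E := by
    refine mul_left_cancel₀ (pow_ne_zero 2 h4) (h3.trans ?_)
    simp only [PowerSeries.smul_eq_C_mul, map_natCast, hb]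
    push_cast
    ring
  have hcE : ∀ k, PowerSeries.coeff k E = if ∃ α ∈ B a, weight a α = k then 1 else 0 :=
    fun k => PowerSeries.coeff_mk _ _
  have hE1 : PowerSeries.coeff 1 E = 0 := by
    rw [hcE, if_neg]
    rintro ⟨α, -, hα⟩
    exact ha.weight_ne_one α hα
  have hEc : PowerSeries.coeff (c + 1) E = 1 := by
    rw [hcE, if_pos]
    obtain ⟨α, hα, hw⟩ := ha.exists_mem_B_weight_frob_add_one
    exact ⟨α, hα, by omega⟩
  rw [← Polynomial.coeff_coe, h5, map_sub, map_add, PowerSeries.coeff_X_pow_mul', if_pos le_rfl,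
    Nat.sub_self, PowerSeries.coeff_succ_X_mul, ← map_natCast (PowerSeries.C (R := ℂ)),
    PowerSeries.coeff_C_mul, PowerSeries.coeff_derivative, PowerSeries.coeff_derivative, hE1, hEc]
  ring

end Hilbert

/-! ### Divided differences -/

section DividedDifference

variable {n : ℕ} {A Γ : Type*} [CommRing A] [Algebra ℂ A] [CommRing Γ] [Algebra ℂ Γ]

/-- The divided difference of the monomial `x ^ α` in the `j`-th variable. -/
def monomDiff (u v : Fin (n + 1) → A) (j : Fin (n + 1)) (α : Fin (n + 1) → ℕ) : A :=
  (∏ k ∈ Finset.Iio j, v k ^ α k) * (∏ k ∈ Finset.Ioi j, u k ^ α k) *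
    ∑ l ∈ Finset.range (α j), u j ^ l * v j ^ (α j - 1 - l)

/-- The divided difference
`(p(v_1,…,v_{j-1},u_j,u_{j+1},…) - p(v_1,…,v_{j-1},v_j,u_{j+1},…)) / (u_j - v_j)`. -/
def dividedDiff (u v : Fin (n + 1) → A) (j : Fin (n + 1)) :
    MvPolynomial (Fin (n + 1)) ℂ →ₗ[ℂ] A :=
  (basisMonomials (Fin (n + 1)) ℂ).constr ℂ fun α => monomDiff u v j α

lemma dividedDiff_monomial (u v : Fin (n + 1) → A) (j : Fin (n + 1)) (α : Fin (n + 1) →₀ ℕ)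
    (z : ℂ) : dividedDiff u v j (monomial α z) = z • monomDiff u v j α := by
  have h1 : monomial α z = z • (basisMonomials (Fin (n + 1)) ℂ) α := by
    rw [coe_basisMonomials, smul_monomial, smul_eq_mul, mul_one]
  rw [h1, map_smul, dividedDiff, Module.Basis.constr_basis]

lemma dividedDiff_mul_sub (u v : Fin (n + 1) → A) (j : Fin (n + 1))
    (p : MvPolynomial (Fin (n + 1)) ℂ) :
    dividedDiff u v j p * (u j - v j) =
      aeval (fun k => if k < j then v k else u k) p -
        aeval (fun k => if k ≤ j then v k else u k) p := by
  have hprod : ∀ w : Fin (n + 1) → A, ∏ k, w k =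
      (∏ k ∈ Finset.Iio j, w k) * (∏ k ∈ Finset.Ioi j, w k) * w j := by
    intro w
    have h1 : (Finset.univ : Finset (Fin (n + 1))) =
        insert j (Finset.Iio j ∪ Finset.Ioi j) := by
      ext k
      simp only [Finset.mem_univ, Finset.mem_insert, Finset.mem_union, Finset.mem_Iio,
        Finset.mem_Ioi, true_iff]
      rcases lt_trichotomy k j with h | h | h <;> simp [h]
    rw [h1, Finset.prod_insert (by simp), Finset.prod_union, mul_comm]
    rw [Finset.disjoint_left]
    intro k hk hk'
    exact absurd (Finset.mem_Iio.1 hk) (not_lt.2 (Finset.mem_Ioi.1 hk').le)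
  induction p using MvPolynomial.induction_on' with
  | monomial α z =>
    have h1 : ∀ w : Fin (n + 1) → A, (aeval w) (monomial α z) = z • ∏ k, w k ^ α k := by
      intro w
      rw [aeval_monomial, Algebra.smul_def, Finsupp.prod_fintype _ _ fun _ => pow_zero _]
    rw [dividedDiff_monomial, h1, h1, ← smul_sub, smul_mul_assoc, hprod, hprod, monomDiff,
      mul_assoc, (Commute.all (u j) (v j)).geom_sum₂_mul]
    congr 1
    have h2 : ∏ k ∈ Finset.Iio j, (if k < j then v k else u k) ^ α k =
        ∏ k ∈ Finset.Iio j, v k ^ α k :=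
      Finset.prod_congr rfl fun k hk => by rw [if_pos (Finset.mem_Iio.1 hk)]
    have h3 : ∏ k ∈ Finset.Iio j, (if k ≤ j then v k else u k) ^ α k =
        ∏ k ∈ Finset.Iio j, v k ^ α k :=
      Finset.prod_congr rfl fun k hk => by rw [if_pos (Finset.mem_Iio.1 hk).le]
    have h4 : ∏ k ∈ Finset.Ioi j, (if k < j then v k else u k) ^ α k =
        ∏ k ∈ Finset.Ioi j, u k ^ α k :=
      Finset.prod_congr rfl fun k hk => by rw [if_neg (not_lt.2 (Finset.mem_Ioi.1 hk).le)]
    have h5 : ∏ k ∈ Finset.Ioi j, (if k ≤ j then v k else u k) ^ α k =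
        ∏ k ∈ Finset.Ioi j, u k ^ α k :=
      Finset.prod_congr rfl fun k hk => by rw [if_neg (not_le.2 (Finset.mem_Ioi.1 hk))]
    rw [h2, h3, h4, h5, if_neg (lt_irrefl j), if_pos le_rfl]
    ring
  | add p q hp hq => rw [map_add, map_add, map_add, add_mul, hp, hq]; ring

lemma map_dividedDiff {A' : Type*} [CommRing A'] [Algebra ℂ A'] (f : A →ₐ[ℂ] A')
    (u v : Fin (n + 1) → A) (j : Fin (n + 1)) (p : MvPolynomial (Fin (n + 1)) ℂ) :
    f (dividedDiff u v j p) = dividedDiff (fun k => f (u k)) (fun k => f (v k)) j p := by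
  induction p using MvPolynomial.induction_on' with
  | monomial α z =>
    rw [dividedDiff_monomial, dividedDiff_monomial, map_smul, monomDiff, monomDiff]
    simp only [map_mul, map_prod, map_sum, map_pow]
  | add p q hp hq => rw [map_add, map_add, map_add, hp, hq]

variable {a : Fin (n + 1) → ℕ} {σ : Symbol A Γ} {u v : Fin (n + 1) → A} {u' v' : Fin (n + 1) → Γ}

lemma hasSymbol_monomDiff (hu : ∀ k, HasSymbol σ (a k) (u k) (u' k))
    (hv : ∀ k, HasSymbol σ (a k) (v k) (v' k)) (j : Fin (n + 1)) (α : Fin (n + 1) → ℕ) :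
    HasSymbol σ (weight a α - a j) (monomDiff u v j α) (monomDiff u' v' j α) := by
  have h1 : HasSymbol σ (∑ k ∈ Finset.Iio j, (α k : ℤ) * a k) (∏ k ∈ Finset.Iio j, v k ^ α k)
      (∏ k ∈ Finset.Iio j, v' k ^ α k) := HasSymbol.prod fun k _ => (hv k).pow _
  have h2 : HasSymbol σ (∑ k ∈ Finset.Ioi j, (α k : ℤ) * a k) (∏ k ∈ Finset.Ioi j, u k ^ α k)
      (∏ k ∈ Finset.Ioi j, u' k ^ α k) := HasSymbol.prod fun k _ => (hu k).pow _
  -- For α_j = 0 the sum is empty and the degree is negative, which is harmless because 0 belongs to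
  -- every degree.
  have h3 : HasSymbol σ (((α j : ℤ) - 1) * a j)
      (∑ l ∈ Finset.range (α j), u j ^ l * v j ^ (α j - 1 - l))
      (∑ l ∈ Finset.range (α j), u' j ^ l * v' j ^ (α j - 1 - l)) := by
    refine HasSymbol.sum fun l hl => (((hu j).pow l).mul ((hv j).pow _)).congr ?_ rfl
    have hl := Finset.mem_range.1 hl
    rw [← add_mul]
    congr 1
    omega
  refine ((h1.mul h2).mul h3).congr ?_ rfl
  have h4 : (weight a α : ℤ) = ∑ k ∈ Finset.Iio j, (α k : ℤ) * a k +
      ∑ k ∈ Finset.Ioi j, (α k : ℤ) * a k + α j * a j := by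
    have h5 : (Finset.univ : Finset (Fin (n + 1))) =
        insert j (Finset.Iio j ∪ Finset.Ioi j) := by
      ext k
      simp only [Finset.mem_univ, Finset.mem_insert, Finset.mem_union, Finset.mem_Iio,
        Finset.mem_Ioi, true_iff]
      rcases lt_trichotomy k j with h | h | h <;> simp [h]
    have h6 : Disjoint (Finset.Iio j) (Finset.Ioi j) := by
      rw [Finset.disjoint_left]
      intro k hk hk'
      exact absurd (Finset.mem_Iio.1 hk) (not_lt.2 (Finset.mem_Ioi.1 hk').le)
    rw [weight, h5, Finset.sum_insert (by simp), Finset.sum_union h6]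
    push_cast
    simp_rw [mul_comm]
    ring
  rw [h4]
  ring

variable (lam : Fin n → (Fin (n + 1) → ℕ) → ℂ)

variable (a) in
/-- The matrix of the divided differences of the equations of the curve. -/
def diffMatrix (u v : Fin (n + 1) → A) : Matrix (Fin n) (Fin n) A :=
  Matrix.of fun i j => dividedDiff u v j.succ (F a lam i)

/-- Since x^{ℓ_i} involves only previous variables, the matrix of leading terms is lower triangular,
with the divided differences of the x_i^{r_i} on the diagonal. -/
lemma hasSymbol_det_diffMatrix (ha : IsTelescopic a) (hu : ∀ k, HasSymbol σ (a k) (u k) (u' k))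
    (hv : ∀ k, HasSymbol σ (a k) (v k) (v' k)) :
    HasSymbol σ (frob a + a 0) (diffMatrix a lam u v).det
      (∏ i : Fin n, ∑ l ∈ Finset.range (ratio a i),
        u' i.succ ^ l * v' i.succ ^ (ratio a i - 1 - l)) := by
  let M : Matrix (Fin n) (Fin n) Γ := Matrix.of fun i j =>
    monomDiff u' v' j.succ (Pi.single i.succ (ratio a i)) - monomDiff u' v' j.succ (ell a i)
  have h1 : ∀ i j : Fin n, HasSymbol σ ((a i.succ * ratio a i : ℕ) - a j.succ)
      (diffMatrix a lam u v i j) (M i j) := by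
    intro i j
    rw [diffMatrix, Matrix.of_apply, F_eq a ha, map_sub, map_sub, map_sum]
    simp_rw [dividedDiff_monomial, one_smul]
    have h2 := hasSymbol_monomDiff (a := a) hu hv j.succ (Pi.single i.succ (ratio a i))
    have h3 := hasSymbol_monomDiff (a := a) hu hv j.succ (ell a i)
    rw [weight_single] at h2
    rw [(ha.ell_spec i).2.1] at h3
    have h4 : ∀ α ∈ lowerExponents a i, HasSymbol σ ((a i.succ * ratio a i : ℕ) - a j.succ)
        (lam i α • monomDiff u v j.succ α) 0 := by
      intro α hα
      refine ((hasSymbol_monomDiff hu hv j.succ α).smul _).of_lt ?_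
      have := (mem_lowerExponents hα).2
      omega
    rw [Finsupp.single_eq_pi_single]
    refine ((h2.sub h3).sub (HasSymbol.sum h4)).congr rfl ?_
    rw [Finset.sum_const_zero, sub_zero]
    rfl
  have hdet : M.det = ∏ i : Fin n, ∑ l ∈ Finset.range (ratio a i),
        u' i.succ ^ l * v' i.succ ^ (ratio a i - 1 - l) := by
    have h0 : ∀ i j : Fin n, i ≤ j → monomDiff u' v' j.succ (ell a i) = 0 := by
      intro i j hij
      have h2 : ell a i j.succ = 0 := (ha.ell_spec i).2.2 _ (by
        rw [Fin.lt_def, Fin.val_castSucc, Fin.val_succ]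
        rw [Fin.le_def] at hij
        omega)
      rw [monomDiff, h2, Finset.range_zero, Finset.sum_empty, mul_zero]
    rw [Matrix.det_of_isLowerTriangular]
    · refine Finset.prod_congr rfl fun i _ => ?_
      have h5 : ∀ (s : Finset (Fin (n + 1))) (w : Fin (n + 1) → Γ), i.succ ∉ s →
          ∏ k ∈ s, w k ^ (Pi.single i.succ (ratio a i) : Fin (n + 1) → ℕ) k = 1 := by
        intro s w hs
        refine Finset.prod_eq_one fun k hk => ?_
        rw [Pi.single_eq_of_ne (fun h : k = i.succ => hs (h ▸ hk)), pow_zero]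
      simp only [M, Matrix.of_apply]
      rw [h0 i i le_rfl, sub_zero, monomDiff, h5 _ _ (by simp), h5 _ _ (by simp),
        Pi.single_eq_same, one_mul, one_mul]
    · intro i j hij
      have hij : i < j := hij
      have h1 : j.succ ≠ i.succ := fun h => hij.ne' (Fin.succ_injective _ h)
      simp only [M, Matrix.of_apply]
      rw [h0 i j hij.le, sub_zero, monomDiff, Pi.single_eq_of_ne h1, Finset.range_zero,
        Finset.sum_empty, mul_zero]
  rw [← hdet]
  refine (HasSymbol.det h1).congr ?_ rfl
  rw [frob]
  simp only [mul_sub, Finset.sum_sub_distrib, mul_one]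
  push_cast
  ring

end DividedDifference

/-! ### The field of functions of two points -/

section TensorProductDomain

set_option linter.unusedSectionVars false

variable {T K : Type*} [CommRing T] [IsDomain T] [Algebra ℂ T] [Field K] [Algebra ℂ K]
  [Algebra T K] [IsScalarTower ℂ T K] [IsFractionRing T K]

variable (T K) in
/-- The inclusion of the functions that are regular in both points. -/
def mapTensor : T ⊗[ℂ] T →ₐ[ℂ] K ⊗[ℂ] K :=
  Algebra.TensorProduct.map (IsScalarTower.toAlgHom ℂ T K) (IsScalarTower.toAlgHom ℂ T K)

lemma mapTensor_tmul (f g : T) :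
    mapTensor T K (f ⊗ₜ g) = algebraMap T K f ⊗ₜ algebraMap T K g := rfl

lemma mapTensor_injective : Function.Injective (mapTensor T K) :=
  TensorProduct.map_injective_of_flat_flat
    (IsScalarTower.toAlgHom ℂ T K).toLinearMap (IsScalarTower.toAlgHom ℂ T K).toLinearMap
    (IsFractionRing.injective T K) (IsFractionRing.injective T K)

lemma exists_tmul_mul_eq_mapTensor (z : K ⊗[ℂ] K) :
    ∃ d e : T, d ≠ 0 ∧ e ≠ 0 ∧ ∃ w, mapTensor T K (d ⊗ₜ e) * z = mapTensor T K w := by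
  induction z with
  | zero => exact ⟨1, 1, one_ne_zero, one_ne_zero, 0, by simp⟩
  | tmul f g =>
    obtain ⟨r, d, hd, rfl⟩ := IsFractionRing.div_surjective (A := T) f
    obtain ⟨s, e, he, rfl⟩ := IsFractionRing.div_surjective (A := T) g
    have hd' : algebraMap T K d ≠ 0 := by
      rw [Ne, FaithfulSMul.algebraMap_eq_zero_iff]; exact nonZeroDivisors.ne_zero hd
    have he' : algebraMap T K e ≠ 0 := by
      rw [Ne, FaithfulSMul.algebraMap_eq_zero_iff]; exact nonZeroDivisors.ne_zero he
    refine ⟨d, e, nonZeroDivisors.ne_zero hd, nonZeroDivisors.ne_zero he, r ⊗ₜ s, ?_⟩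
    rw [mapTensor_tmul, mapTensor_tmul, Algebra.TensorProduct.tmul_mul_tmul,
      mul_div_cancel₀ _ hd', mul_div_cancel₀ _ he']
  | add z z' h h' =>
    obtain ⟨d, e, hd, he, w, hw⟩ := h
    obtain ⟨d', e', hd', he', w', hw'⟩ := h'
    refine ⟨d * d', e * e', mul_ne_zero hd hd', mul_ne_zero he he',
      d' ⊗ₜ e' * w + d ⊗ₜ e * w', ?_⟩
    rw [← Algebra.TensorProduct.tmul_mul_tmul, map_add, map_mul, map_mul, map_mul, ← hw, ← hw']
    ring

lemma isUnit_tmul {f g : K} (hf : f ≠ 0) (hg : g ≠ 0) : IsUnit (f ⊗ₜ[ℂ] g) :=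
  IsUnit.of_mul_eq_one (f⁻¹ ⊗ₜ g⁻¹) (by
    rw [Algebra.TensorProduct.tmul_mul_tmul, mul_inv_cancel₀ hf, mul_inv_cancel₀ hg,
      Algebra.TensorProduct.one_def])

lemma isUnit_mapTensor_tmul {d e : T} (hd : d ≠ 0) (he : e ≠ 0) :
    IsUnit (mapTensor T K (d ⊗ₜ e)) :=
  have h : ∀ {f : T}, f ≠ 0 → algebraMap T K f ≠ 0 := fun hf => by
    rwa [Ne, FaithfulSMul.algebraMap_eq_zero_iff]
  isUnit_tmul (h hd) (h he)

variable (T) in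
-- Up to units d ⊗ e, every element of K ⊗ K comes from T ⊗ T.
lemma isDomain_tensorProduct_of_noZeroDivisors (hT : NoZeroDivisors (T ⊗[ℂ] T)) :
    IsDomain (K ⊗[ℂ] K) := by
  have h1 : NoZeroDivisors (K ⊗[ℂ] K) := by
    refine ⟨fun {z z'} h => ?_⟩
    obtain ⟨d, e, hd, he, w, hw⟩ := exists_tmul_mul_eq_mapTensor (T := T) z
    obtain ⟨d', e', hd', he', w', hw'⟩ := exists_tmul_mul_eq_mapTensor (T := T) z'
    have h2 : w * w' = 0 := by
      apply mapTensor_injective (T := T) (K := K)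
      rw [map_mul, ← hw, ← hw', mul_mul_mul_comm, h, mul_zero, map_zero]
    rcases mul_eq_zero.1 h2 with h3 | h3
    · left
      rwa [h3, map_zero, (isUnit_mapTensor_tmul hd he).mul_right_eq_zero] at hw
    · right
      rwa [h3, map_zero, (isUnit_mapTensor_tmul hd' he').mul_right_eq_zero] at hw'
  exact NoZeroDivisors.to_isDomain _

end TensorProductDomain

/-! ### Derivations of a tensor product acting on one factor. -/

section TensorDerivation

variable {A A' : Type*} [CommRing A] [Algebra ℂ A] [CommRing A'] [Algebra ℂ A']

variable (A) in
/-- The derivation `id ⊗ δ`. -/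
def derivationRight (δ : Derivation ℂ A' A') : Derivation ℂ (A ⊗[ℂ] A') (A ⊗[ℂ] A') :=
  Derivation.mk' (LinearMap.lTensor A (δ : A' →ₗ[ℂ] A')) fun z w => by
    induction z with
    | zero => simp
    | add z z' h h' =>
      simp only [add_mul, map_add, smul_eq_mul, mul_add] at h h' ⊢
      rw [h, h']
      ring
    | tmul f g =>
      induction w with
      | zero => simp
      | add w w' h h' =>
        simp only [add_mul, map_add, smul_eq_mul, mul_add] at h h' ⊢
        rw [h, h']
        ring
      | tmul f' g' =>
        simp only [Algebra.TensorProduct.tmul_mul_tmul, LinearMap.lTensor_tmul, smul_eq_mul,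
          Derivation.coeFn_coe, Derivation.leibniz, TensorProduct.tmul_add]
        rw [mul_comm f' f]

variable (A') in
/-- The derivation `δ ⊗ id`. -/
def derivationLeft (δ : Derivation ℂ A A) : Derivation ℂ (A ⊗[ℂ] A') (A ⊗[ℂ] A') :=
  Derivation.mk' (LinearMap.rTensor A' (δ : A →ₗ[ℂ] A)) fun z w => by
    induction z with
    | zero => simp
    | add z z' h h' =>
      simp only [add_mul, map_add, smul_eq_mul, mul_add] at h h' ⊢
      rw [h, h']
      ring
    | tmul f g =>
      induction w with
      | zero => simp
      | add w w' h h' =>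
        simp only [add_mul, map_add, smul_eq_mul, mul_add] at h h' ⊢
        rw [h, h']
        ring
      | tmul f' g' =>
        simp only [Algebra.TensorProduct.tmul_mul_tmul, LinearMap.rTensor_tmul, smul_eq_mul,
          Derivation.coeFn_coe, Derivation.leibniz, TensorProduct.add_tmul]
        rw [mul_comm g' g]

lemma derivationRight_tmul (δ : Derivation ℂ A' A') (f : A) (g : A') :
    derivationRight A δ (f ⊗ₜ g) = f ⊗ₜ δ g := rfl

lemma derivationLeft_tmul (δ : Derivation ℂ A A) (f : A) (g : A') :
    derivationLeft A' δ (f ⊗ₜ g) = δ f ⊗ₜ g := rfl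

end TensorDerivation

/-! ### Coefficients of two-forms by means of partial derivatives. -/

section EvalForm

variable {K L : Type} [CommRing K] [Algebra ℂ K] [CommRing L] [Algebra ℂ L]

lemma evalForm_D (P : K →ₐ[ℂ] L) (S : Subalgebra ℂ L) (f : K) :
    evalForm P S (D ℂ K f) = D S L (P f) := by
  let _ : Algebra K L := P.toRingHom.toAlgebra
  have : IsScalarTower ℂ K L := IsScalarTower.of_algebraMap_eq fun z => (P.commutes z).symm
  have : SMulCommClass S K L := ⟨fun s k l => by simp only [Algebra.smul_def, mul_left_comm]⟩
  exact KaehlerDifferential.map_D ℂ S K L f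

lemma evalForm_smul (P : K →ₐ[ℂ] L) (S : Subalgebra ℂ L) (f : K) (w : Ω[K⁄ℂ]) :
    evalForm P S (f • w) = P f • evalForm P S w := by
  let _ : Algebra K L := P.toRingHom.toAlgebra
  have : IsScalarTower ℂ K L := IsScalarTower.of_algebraMap_eq fun z => (P.commutes z).symm
  have : SMulCommClass S K L := ⟨fun s k l => by simp only [Algebra.smul_def, mul_left_comm]⟩
  exact (KaehlerDifferential.map ℂ S K L).map_smul f w

lemma prodForm_smul_smul (P Q : K →ₐ[ℂ] L) (f g : K) (u v : Ω[K⁄ℂ]) :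
    prodForm P Q (f • u) (g • v) = (P f * Q g) • prodForm P Q u v := by
  rw [prodForm, evalForm_smul, evalForm_smul, TensorProduct.smul_tmul_smul, prodForm]

/-- A derivation which vanishes on a subalgebra is linear over it. -/
def derivationOver (S : Subalgebra ℂ L) (d : Derivation ℂ L L) (h : ∀ s ∈ S, d s = 0) :
    Derivation S L L where
  toFun := d
  map_add' := map_add d
  map_smul' s f := by
    rw [Subalgebra.smul_def, smul_eq_mul, Derivation.leibniz, h s s.2, smul_zero, add_zero]
    rfl
  map_one_eq_zero' := d.map_one_eq_zero
  leibniz' := d.leibniz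

/-- The partial derivatives on the functions of two points which belong to the derivation `δ`. -/
structure PartialDerivations (P Q : K →ₐ[ℂ] L) (δ : Derivation ℂ K K) where
  fst : Derivation ℂ L L
  snd : Derivation ℂ L L
  fst_P : ∀ f, fst (P f) = P (δ f)
  fst_Q : ∀ f, fst (Q f) = 0
  snd_P : ∀ f, snd (P f) = 0
  snd_Q : ∀ f, snd (Q f) = Q (δ f)

namespace PartialDerivations

variable {P Q : K →ₐ[ℂ] L} {δ : Derivation ℂ K K} (d : PartialDerivations P Q δ)

/-- The partial derivative in the first point, with values in the coefficients. -/
def liftFst : Ω[L⁄Q.range] →ₗ[L] L :=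
  (derivationOver Q.range d.fst (by rintro _ ⟨f, rfl⟩; exact d.fst_Q f)).liftKaehlerDifferential

/-- The partial derivative in the second point, with values in the coefficients. -/
def liftSnd : Ω[L⁄P.range] →ₗ[L] L :=
  (derivationOver P.range d.snd (by rintro _ ⟨f, rfl⟩; exact d.snd_P f)).liftKaehlerDifferential

lemma liftFst_D (f : L) : d.liftFst (D Q.range L f) = d.fst f :=
  Derivation.liftKaehlerDifferential_comp_D _ _

lemma liftSnd_D (f : L) : d.liftSnd (D P.range L f) = d.snd f :=
  Derivation.liftKaehlerDifferential_comp_D _ _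

lemma form_induction {S : Ω[K⁄ℂ] → Prop} (h0 : S 0) (hadd : ∀ u v, S u → S v → S (u + v))
    (hsmul : ∀ (f : K) u, S u → S (f • u)) (hD : ∀ f, S (D ℂ K f)) (w : Ω[K⁄ℂ]) : S w := by
  have hw : w ∈ Submodule.span K (Set.range (D ℂ K)) := by
    rw [KaehlerDifferential.span_range_derivation]; trivial
  induction hw using Submodule.span_induction with
  | mem w hw => obtain ⟨f, rfl⟩ := hw; exact hD f
  | zero => exact h0
  | add u v _ _ hu hv => exact hadd u v hu hv
  | smul f u _ hu => exact hsmul f u hu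

lemma liftFst_evalForm (w : Ω[K⁄ℂ]) :
    d.liftFst (evalForm P Q.range w) = P (δ.liftKaehlerDifferential w) := by
  induction w using form_induction with
  | h0 => simp
  | hadd u v hu hv => simp only [map_add, hu, hv]
  | hsmul f u hu => rw [evalForm_smul, map_smul, map_smul, hu, smul_eq_mul, smul_eq_mul, map_mul]
  | hD f => rw [evalForm_D, liftFst_D, d.fst_P, Derivation.liftKaehlerDifferential_comp_D]

lemma liftSnd_evalForm (w : Ω[K⁄ℂ]) :
    d.liftSnd (evalForm Q P.range w) = Q (δ.liftKaehlerDifferential w) := by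
  induction w using form_induction with
  | h0 => simp
  | hadd u v hu hv => simp only [map_add, hu, hv]
  | hsmul f u hu => rw [evalForm_smul, map_smul, map_smul, hu, smul_eq_mul, smul_eq_mul, map_mul]
  | hD f => rw [evalForm_D, liftSnd_D, d.snd_Q, Derivation.liftKaehlerDifferential_comp_D]

/-- The coefficient of a two-form. -/
def coeff : TwoForm P Q →ₗ[L] L :=
  LinearMap.mul' L L ∘ₗ TensorProduct.map d.liftFst d.liftSnd

lemma coeff_prodForm (u v : Ω[K⁄ℂ]) : d.coeff (prodForm P Q u v) =
    P (δ.liftKaehlerDifferential u) * Q (δ.liftKaehlerDifferential v) := by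
  rw [prodForm, coeff, LinearMap.comp_apply, TensorProduct.map_tmul, LinearMap.mul'_apply,
    liftFst_evalForm, liftSnd_evalForm]

lemma coeff_dQ (f : L) (u : Ω[K⁄ℂ]) :
    d.coeff (dQ P Q f u) = P (δ.liftKaehlerDifferential u) * d.snd f := by
  rw [dQ, coeff, LinearMap.comp_apply, TensorProduct.map_tmul, LinearMap.mul'_apply,
    liftFst_evalForm, liftSnd_D]

lemma coeff_comm_prodForm (u v : Ω[K⁄ℂ]) :
    d.coeff (TensorProduct.comm L _ _ (prodForm Q P u v)) =
      P (δ.liftKaehlerDifferential v) * Q (δ.liftKaehlerDifferential u) := by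
  rw [prodForm, TensorProduct.comm_tmul, coeff, LinearMap.comp_apply, TensorProduct.map_tmul,
    LinearMap.mul'_apply, liftFst_evalForm, liftSnd_evalForm]

lemma coeff_comm_dQ (f : L) (u : Ω[K⁄ℂ]) :
    d.coeff (TensorProduct.comm L _ _ (dQ Q P f u)) =
      d.fst f * Q (δ.liftKaehlerDifferential u) := by
  rw [dQ, TensorProduct.comm_tmul, coeff, LinearMap.comp_apply, TensorProduct.map_tmul,
    LinearMap.mul'_apply, liftFst_D, liftSnd_evalForm]

end PartialDerivations

end EvalForm

section Partial

variable {K L : Type} [CommRing K] [Algebra ℂ K] [CommRing L] [Algebra ℂ L]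
  [Algebra (K ⊗[ℂ] K) L] [IsScalarTower ℂ (K ⊗[ℂ] K) L] [IsFractionRing (K ⊗[ℂ] K) L]

lemma nonempty_partialDerivations {P Q : K →ₐ[ℂ] L}
    (hP : ∀ f, P f = algebraMap (K ⊗[ℂ] K) L (f ⊗ₜ 1))
    (hQ : ∀ f, Q f = algebraMap (K ⊗[ℂ] K) L (1 ⊗ₜ f)) (δ : Derivation ℂ K K) :
    Nonempty (PartialDerivations P Q δ) := by
  obtain ⟨d, hd⟩ := exists_derivation_of_isLocalization (S' := L)
    (nonZeroDivisors (K ⊗[ℂ] K)) (derivationLeft K δ)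
  obtain ⟨d', hd'⟩ := exists_derivation_of_isLocalization (S' := L)
    (nonZeroDivisors (K ⊗[ℂ] K)) (derivationRight K δ)
  refine ⟨⟨d, d', fun f => ?_, fun f => ?_, fun f => ?_, fun f => ?_⟩⟩
  · rw [hP, hd, derivationLeft_tmul, hP]
  · rw [hQ, hd, derivationLeft_tmul, Derivation.map_one_eq_zero, TensorProduct.zero_tmul, map_zero]
  · rw [hP, hd', derivationRight_tmul, Derivation.map_one_eq_zero, TensorProduct.tmul_zero,
      map_zero]
  · rw [hQ, hd', derivationRight_tmul, hQ]

end Partial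

/-! ### The leading coefficient of the symmetry defect -/

section SymmetryDefect

variable {n : ℕ} {a : Fin (n + 1) → ℕ} {lam : Fin n → (Fin (n + 1) → ℕ) → ℂ}
variable {T : Type*} [CommRing T] [Algebra ℂ T] {ξ : Fin (n + 1) → T}

lemma IsTelescopic.one_sub_X_pow_ne_zero (ha : IsTelescopic a) (k : Fin (n + 1)) :
    (1 - Polynomial.X ^ a k : Polynomial ℂ) ≠ 0 := by
  intro h0
  have h1 := congrArg (Polynomial.coeff · 0) h0
  simp only [Polynomial.coeff_sub, Polynomial.coeff_X_pow, Polynomial.coeff_one_zero,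
    if_neg (ha.pos k).ne] at h1
  simp at h1

namespace IsCurve

variable (h : IsCurve a lam ξ)

lemma hasSymbol_coord_tmul_one (k : Fin (n + 1)) :
    HasSymbol h.symbol₂ (a k) (ξ k ⊗ₜ 1) (1 : Polynomial ℂ) :=
  (h.hasSymbol_tmul (h.hasSymbol_coord k) (HasSymbol.one h.symbol)).congr (add_zero _) (by simp)

lemma hasSymbol_one_tmul_coord (k : Fin (n + 1)) :
    HasSymbol h.symbol₂ (a k) (1 ⊗ₜ ξ k) (Polynomial.X ^ a k : Polynomial ℂ) :=
  (h.hasSymbol_tmul (HasSymbol.one h.symbol) (h.hasSymbol_coord k)).congr (zero_add _) (by simp)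

/-- Its leading term is 1 - u^{a_k}. -/
lemma coord_tmul_sub_ne_zero (h : IsCurve a lam ξ) (k : Fin (n + 1)) :
    ξ k ⊗ₜ[ℂ] 1 - 1 ⊗ₜ ξ k ≠ (0 : T ⊗[ℂ] T) := by
  intro h0
  have h1 := (h.hasSymbol_coord_tmul_one k).sub (h.hasSymbol_one_tmul_coord k)
  rw [h0] at h1
  exact h.telescopic.one_sub_X_pow_ne_zero k (h1.unique (HasSymbol.zero _ _))

/-- If `A` is the symmetry defect of a two-form with the singular part of `Ω`, its coefficient at
the two monomials of the weights next to the Frobenius number is `-1`. -/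
lemma repr_symmetryDefect {δ : Derivation ℂ T T} (hδ : ∀ k, δ (ξ k) = tangent a lam ξ k)
    {A : T ⊗[ℂ] T}
    (hA : (ξ 0 ⊗ₜ 1 - 1 ⊗ₜ ξ 0) * derivationRight T δ
          (diffMatrix a lam (fun k => ξ k ⊗ₜ[ℂ] (1 : T)) (fun k => (1 : T) ⊗ₜ ξ k)).det
        + (1 ⊗ₜ tangent a lam ξ 0) *
          (diffMatrix a lam (fun k => ξ k ⊗ₜ[ℂ] (1 : T)) (fun k => (1 : T) ⊗ₜ ξ k)).det
        - ((1 ⊗ₜ ξ 0 - ξ 0 ⊗ₜ 1) * derivationLeft T δ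
          (diffMatrix a lam (fun k => (1 : T) ⊗ₜ ξ k) (fun k => ξ k ⊗ₜ[ℂ] (1 : T))).det
        + (tangent a lam ξ 0 ⊗ₜ 1) *
          (diffMatrix a lam (fun k => (1 : T) ⊗ₜ ξ k) (fun k => ξ k ⊗ₜ[ℂ] (1 : T))).det)
      = (ξ 0 ⊗ₜ 1 - 1 ⊗ₜ ξ 0) ^ 2 * A)
    {α β : B a} (hα : (weight a α : ℤ) = frob a - 1) (hβ : (weight a β : ℤ) = frob a + 1) :
    h.basis₂.repr A (α, β) = -1 := by
  have ha := h.telescopic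
  obtain ⟨c, hc⟩ : ∃ c : ℕ, frob a = c := ⟨(frob a).toNat, by have := ha.frob_pos; omega⟩
  have hδs : ∀ k, HasSymbol h.symbol (a k + frob a) (δ (ξ k)) (a k : ℂ) := fun k => by
    rw [hδ]; exact h.hasSymbol_tangent k
  have hu := h.hasSymbol_coord_tmul_one
  have hv := h.hasSymbol_one_tmul_coord
  have hH : HasSymbol h.symbol₂ (frob a + a 0)
      (diffMatrix a lam (fun k => ξ k ⊗ₜ[ℂ] (1 : T)) (fun k => (1 : T) ⊗ₜ ξ k)).det
      (hilbertNumerator a) := by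
    refine (hasSymbol_det_diffMatrix lam ha hu hv).congr rfl ?_
    refine Finset.prod_congr rfl fun i _ => ?_
    rw [← Finset.sum_range_reflect]
    refine Finset.sum_congr rfl fun l hl => ?_
    rw [one_pow, one_mul, Nat.sub_sub_self (by have := Finset.mem_range.1 hl; omega)]
  have hH' : HasSymbol h.symbol₂ (frob a + a 0)
      (diffMatrix a lam (fun k => (1 : T) ⊗ₜ ξ k) (fun k => ξ k ⊗ₜ[ℂ] (1 : T))).det
      (hilbertNumerator a) := by
    refine (hasSymbol_det_diffMatrix lam ha hv hu).congr rfl ?_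
    refine Finset.prod_congr rfl fun i _ => ?_
    exact Finset.sum_congr rfl fun l _ => by rw [one_pow, mul_one]
  have h1 := ((hu 0).sub (hv 0)).mul (hasSymbol_lTensor hδs (by omega) hH)
  have h2 := (h.hasSymbol_tmul (HasSymbol.one h.symbol) (h.hasSymbol_tangent 0)).mul hH
  have h3 := ((hv 0).sub (hu 0)).mul (hasSymbol_rTensor hδs hH')
  have h4 := (h.hasSymbol_tmul (h.hasSymbol_tangent 0) (HasSymbol.one h.symbol)).mul hH'
  -- All four terms have total degree 2 a_1 + 2c, so the leading term of (x_1 - y_1)^2 A is read off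
  -- in that degree.
  have h5 := ((h1.congr (e' := 2 * a 0 + 2 * c) (by rw [hc]; ring) rfl).add
      (h2.congr (by rw [hc]; ring) rfl)).sub
    ((h3.congr (by rw [hc]; ring) rfl).add (h4.congr (by rw [hc]; ring) rfl))
  change HasSymbol _ _ ((ξ 0 ⊗ₜ 1 - 1 ⊗ₜ ξ 0) * derivationRight T δ _ + _ -
    ((1 ⊗ₜ ξ 0 - ξ 0 ⊗ₜ 1) * derivationLeft T δ _ + _)) _ at h5
  rw [hA] at h5
  -- Dividing by (x_1 - y_1)^2, with leading term (1 - u^{a_1})^2, isolates the part p of A in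
  -- degree 2c.
  obtain ⟨p, hp, hpr⟩ := HasSymbol.dvd_of_isSeparated h.isSeparated₂
    ((((hu 0).sub (hv 0)).pow 2).congr (e' := 2 * a 0) (by push_cast; ring) rfl)
    (pow_ne_zero 2 (ha.one_sub_X_pow_ne_zero 0)) h5
  have h6 : p.coeff (c + 1) = -1 := by
    refine ha.coeff_eq_neg_one hc (hpr.trans ?_)
    have e1 : (frob a).toNat = c := by omega
    have e2 : ((a 0 : ℤ) + frob a).toNat = a 0 + c := by omega
    rw [e1, e2, Int.toNat_zero, pow_zero, one_mul, mul_one, hc]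
    simp only [smul_mul_assoc, one_mul]
    push_cast
    ring
  have h7 := h.coeff_lead₂ A (α, β)
  have h8 : (weight a β : ℕ) = c + 1 := by omega
  -- The two weights c - 1 and c + 1 add up to 2c, the degree of p, so the wanted coefficient is
  -- that of u^{c+1}.
  have h9 : (weight a α : ℤ) + weight a β = 2 * c := by omega
  simp only at h7
  rw [h9, h8] at h7
  rw [← h7]
  change (h.symbol₂.top _ A).coeff _ = _
  rw [hp.2, h6]

/-- The coefficients with respect to the basis of the products of monomials determine an element. -/
lemma repr_comm (s : T ⊗[ℂ] T) (p : B a × B a) :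
    h.basis₂.repr (TensorProduct.comm ℂ T T s) p = h.basis₂.repr s p.swap := by
  have h1 : h.basis₂.coord p ∘ₗ (TensorProduct.comm ℂ T T).toLinearMap =
      h.basis₂.coord p.swap := by
    refine h.basis₂.ext fun q => ?_
    have h2 : TensorProduct.comm ℂ T T (h.basis₂ q) = h.basis₂ q.swap := by
      rw [h.basis₂_apply, h.basis₂_apply, TensorProduct.comm_tmul]
      rfl
    rw [LinearMap.comp_apply, LinearEquiv.coe_coe, h2, Module.Basis.coord_apply,
      Module.Basis.coord_apply, Module.Basis.repr_self, Module.Basis.repr_self,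
      Finsupp.single_apply, Finsupp.single_apply]
    exact if_congr ⟨fun e => by rw [← e, Prod.swap_swap], fun e => by rw [e, Prod.swap_swap]⟩
      rfl rfl
  exact congrArg (fun f => f s) h1

lemma repr_tmul (f g : T) (p : B a × B a) :
    h.basis₂.repr (f ⊗ₜ g) p = h.basis.repr f p.1 * h.basis.repr g p.2 := by
  rw [basis₂, Module.Basis.tensorProduct_repr_tmul_apply, smul_eq_mul, mul_comm]

lemma expansion_apply {s : T ⊗[ℂ] T} {c : ((Fin (n + 1) → ℕ) × (Fin (n + 1) → ℕ)) →₀ ℂ}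
    (hc : ∀ p ∈ c.support, p.1 ∈ B a ∧ p.2 ∈ B a)
    (hs : (c.sum fun p z => z • (monom ξ p.1 ⊗ₜ[ℂ] monom ξ p.2)) = s) (p : B a × B a) :
    c (p.1, p.2) = h.basis₂.repr s p := by
  classical
  have h1 : ∀ q ∈ c.support, h.basis₂.repr (monom ξ q.1 ⊗ₜ[ℂ] monom ξ q.2) p =
      if q = ((p.1 : Fin (n + 1) → ℕ), (p.2 : Fin (n + 1) → ℕ)) then 1 else 0 := by
    intro q hq
    have h2 := h.basis₂_apply (⟨q.1, (hc q hq).1⟩, ⟨q.2, (hc q hq).2⟩)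
    simp only at h2
    rw [← h2, Module.Basis.repr_self, Finsupp.single_apply]
    refine if_congr ⟨?_, ?_⟩ rfl rfl
    · rintro rfl; rfl
    · rintro rfl; rfl
  rw [← hs, Finsupp.sum, map_sum, Finsupp.finsetSum_apply,
    Finset.sum_congr rfl fun q hq => by
      rw [map_smul, Finsupp.smul_apply, h1 q hq, smul_eq_mul, mul_ite, mul_one, mul_zero],
    Finset.sum_ite_eq']
  split_ifs with h3
  · rfl
  · exact Finsupp.notMem_support_iff.1 h3

/-- An element of `T ⊗ T` has a unique expansion in the products of the monomials. -/
lemma existsUnique_expansion (h : IsCurve a lam ξ) (s : T ⊗[ℂ] T) :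
    ∃! c : ((Fin (n + 1) → ℕ) × (Fin (n + 1) → ℕ)) →₀ ℂ,
      (∀ p ∈ c.support, p.1 ∈ B a ∧ p.2 ∈ B a) ∧
        (c.sum fun p z => z • (monom ξ p.1 ⊗ₜ[ℂ] monom ξ p.2)) = s := by
  classical
  let ι : B a × B a → (Fin (n + 1) → ℕ) × (Fin (n + 1) → ℕ) := fun p => (p.1, p.2)
  refine ⟨(h.basis₂.repr s).mapDomain ι, ⟨fun p hp => ?_, ?_⟩, ?_⟩
  · obtain ⟨q, -, rfl⟩ := Finset.mem_image.1 (Finsupp.mapDomain_support hp)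
    exact ⟨q.1.2, q.2.2⟩
  · refine (Finsupp.sum_mapDomain_index (by simp) (by simp [add_smul])).trans ?_
    conv_rhs => rw [← h.basis₂.linearCombination_repr s, Finsupp.linearCombination_apply]
    simp_rw [h.basis₂_apply]
    rfl
  · rintro c ⟨hc, hs⟩
    ext q
    by_cases hq : q.1 ∈ B a ∧ q.2 ∈ B a
    · have h1 := h.expansion_apply hc hs (⟨q.1, hq.1⟩, ⟨q.2, hq.2⟩)
      have h2 : Function.Injective ι := fun p p' hp => by
        rw [Prod.ext_iff] at hp
        exact Prod.ext (Subtype.ext hp.1) (Subtype.ext hp.2)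
      exact h1.trans (Finsupp.mapDomain_apply h2 _ (⟨q.1, hq.1⟩, ⟨q.2, hq.2⟩)).symm
    · rw [Finsupp.notMem_support_iff.1 fun h' => hq (hc q h'), Finsupp.mapDomain_of_notMem_range]
      rintro ⟨p, rfl⟩
      exact hq ⟨p.1.2, p.2.2⟩

end IsCurve

end SymmetryDefect

/-! ### Two-forms with regular coefficients -/

section TwoPoints

set_option linter.unusedSectionVars false

variable {n : ℕ} {a : Fin (n + 1) → ℕ} {lam : Fin n → (Fin (n + 1) → ℕ) → ℂ}
variable {T : Type*} [CommRing T] [Algebra ℂ T] {ξ : Fin (n + 1) → T}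

lemma aeval_sub_mul_inverse {L : Type*} [Field L] [Algebra ℂ L] {u v : Fin (n + 1) → L}
    {j : Fin (n + 1)} (h : u j ≠ v j) (p : MvPolynomial (Fin (n + 1)) ℂ) :
    (aeval (fun k => if k < j then v k else u k) p -
        aeval (fun k => if k ≤ j then v k else u k) p) * Ring.inverse (u j - v j) =
      dividedDiff u v j p := by
  rw [← dividedDiff_mul_sub, mul_assoc, Ring.mul_inverse_cancel, mul_one]
  exact (sub_ne_zero.2 h).isUnit

variable [IsDomain T]
variable {K L : Type} [Field K] [Algebra ℂ K] [Algebra T K] [IsScalarTower ℂ T K]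
  [IsFractionRing T K] [Field L] [Algebra ℂ L]

variable (T) in
/-- The regular functions of two points as functions of the points `P` and `Q`. -/
def evalTensor (P Q : K →ₐ[ℂ] L) : T ⊗[ℂ] T →ₐ[ℂ] L :=
  Algebra.TensorProduct.productMap (P.comp (IsScalarTower.toAlgHom ℂ T K))
    (Q.comp (IsScalarTower.toAlgHom ℂ T K))

variable {P Q : K →ₐ[ℂ] L}

lemma evalTensor_tmul (f g : T) :
    evalTensor T P Q (f ⊗ₜ g) = P (algebraMap T K f) * Q (algebraMap T K g) := rfl

lemma evalTensor_tmul_one (f : T) : evalTensor T P Q (f ⊗ₜ 1) = P (algebraMap T K f) := by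
  rw [evalTensor_tmul, map_one, map_one, mul_one]

lemma evalTensor_one_tmul (f : T) : evalTensor T P Q (1 ⊗ₜ f) = Q (algebraMap T K f) := by
  rw [evalTensor_tmul, map_one, map_one, one_mul]

lemma evalTensor_injective [Algebra (K ⊗[ℂ] K) L] [IsScalarTower ℂ (K ⊗[ℂ] K) L]
    [IsFractionRing (K ⊗[ℂ] K) L]
    (hP : ∀ f, P f = algebraMap (K ⊗[ℂ] K) L (f ⊗ₜ 1))
    (hQ : ∀ f, Q f = algebraMap (K ⊗[ℂ] K) L (1 ⊗ₜ f)) :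
    Function.Injective (evalTensor T P Q) := by
  have h1 : evalTensor T P Q =
      (IsScalarTower.toAlgHom ℂ (K ⊗[ℂ] K) L).comp (mapTensor T K) := by
    ext f
    · simp only [AlgHom.comp_apply, Algebra.TensorProduct.includeLeft_apply]
      change evalTensor T P Q (f ⊗ₜ 1) = algebraMap (K ⊗[ℂ] K) L (mapTensor T K (f ⊗ₜ 1))
      rw [evalTensor_tmul_one, hP, mapTensor_tmul, map_one]
    · change evalTensor T P Q (1 ⊗ₜ f) = algebraMap (K ⊗[ℂ] K) L (mapTensor T K (1 ⊗ₜ f))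
      rw [evalTensor_one_tmul, hQ, mapTensor_tmul, map_one]
  rw [h1]
  exact (IsFractionRing.injective (K ⊗[ℂ] K) L).comp mapTensor_injective

lemma evalTensor_diffMatrix (u v : Fin (n + 1) → T ⊗[ℂ] T) :
    evalTensor T P Q (diffMatrix a lam u v).det =
      (diffMatrix a lam (fun k => evalTensor T P Q (u k))
        (fun k => evalTensor T P Q (v k))).det := by
  rw [AlgHom.map_det]
  congr 1
  ext i j
  exact map_dividedDiff (evalTensor T P Q) u v j.succ (F a lam i)

variable (Fr : Frame a lam ξ K) (d : PartialDerivations P Q Fr.δK)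

lemma snd_evalTensor (z : T ⊗[ℂ] T) :
    d.snd (evalTensor T P Q z) = evalTensor T P Q (derivationRight T Fr.δ z) := by
  induction z with
  | zero => simp
  | add s t hs ht => rw [map_add, map_add, map_add, map_add, hs, ht]
  | tmul f g =>
    rw [derivationRight_tmul, evalTensor_tmul, evalTensor_tmul, Derivation.leibniz, d.snd_P,
      d.snd_Q, Fr.δK_algebraMap, smul_zero, add_zero, smul_eq_mul]

lemma fst_evalTensor (z : T ⊗[ℂ] T) :
    d.fst (evalTensor T P Q z) = evalTensor T P Q (derivationLeft T Fr.δ z) := by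
  induction z with
  | zero => simp
  | add s t hs ht => rw [map_add, map_add, map_add, map_add, hs, ht]
  | tmul f g =>
    rw [derivationLeft_tmul, evalTensor_tmul, evalTensor_tmul, Derivation.leibniz, d.fst_P,
      d.fst_Q, Fr.δK_algebraMap, smul_zero, zero_add, smul_eq_mul, mul_comm]

/-- The shape of the coefficient of Ω: only t = x_1 - y_1 and the determinant f depend on the point
in which δ differentiates, and the factor g is cancelled by that of dx_1. -/
lemma derivation_mul_inverse {L : Type*} [Field L] [Algebra ℂ L] (δ : Derivation ℂ L L)
    {f t g g' : L} (ht : t ≠ 0) (hg : g ≠ 0) (hδg : δ g = 0) (hδt : δ t = -g') :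
    g * δ (f * Ring.inverse (t * g)) = (t * δ f + g' * f) / t ^ 2 := by
  rw [Ring.inverse_eq_inv', ← div_eq_mul_inv, Derivation.leibniz_div, Derivation.leibniz, hδg, hδt]
  simp only [smul_eq_mul]
  field_simp
  ring

variable {ι : Type*} [Fintype ι] {u w : ι → Ω[K⁄ℂ]} {U W : ι → T}

lemma coeff_sum_prodForm (hU : ∀ i, algebraMap T K (U i) = Fr.coord (u i))
    (hW : ∀ i, algebraMap T K (W i) = Fr.coord (w i)) :
    d.coeff (∑ i, prodForm P Q (u i) (w i)) = evalTensor T P Q (∑ i, U i ⊗ₜ W i) := by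
  rw [map_sum, map_sum]
  refine Finset.sum_congr rfl fun i _ => ?_
  rw [d.coeff_prodForm, evalTensor_tmul, hU, hW]
  rfl

lemma coeff_comm_sum_prodForm (hU : ∀ i, algebraMap T K (U i) = Fr.coord (u i))
    (hW : ∀ i, algebraMap T K (W i) = Fr.coord (w i)) :
    d.coeff (TensorProduct.comm L _ _ (∑ i, prodForm Q P (u i) (w i))) =
      evalTensor T P Q (TensorProduct.comm ℂ T T (∑ i, U i ⊗ₜ W i)) := by
  rw [map_sum, map_sum, map_sum, map_sum]
  refine Finset.sum_congr rfl fun i _ => ?_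
  rw [d.coeff_comm_prodForm, TensorProduct.comm_tmul, evalTensor_tmul, hU, hW]
  rfl

lemma Frame.liftKaehlerDifferential_D_coord (k : Fin (n + 1)) :
    Fr.δK.liftKaehlerDifferential (D ℂ K (algebraMap T K (ξ k))) =
      algebraMap T K (tangent a lam ξ k) := by
  rw [Derivation.liftKaehlerDifferential_comp_D, Fr.δK_algebraMap, Fr.δ_coord]

/-- Two-forms are compared through their coefficients: one direction applies the partial
derivatives, and the other uses that dx_k is a nonzero multiple of η and hence generates the
one-forms. -/
lemma sum_prodForm_eq_iff (hU : ∀ i, algebraMap T K (U i) = Fr.coord (u i))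
    (hW : ∀ i, algebraMap T K (W i) = Fr.coord (w i)) {k : Fin (n + 1)}
    (hk : tangent a lam ξ k ≠ 0) (Y : L) (hd : Nonempty (PartialDerivations P Q Fr.δK)) :
    ∑ i, prodForm P Q (u i) (w i) =
        (Y * Ring.inverse (P (algebraMap T K (tangent a lam ξ k)) *
            Q (algebraMap T K (tangent a lam ξ k)))) •
          prodForm P Q (D ℂ K (algebraMap T K (ξ k))) (D ℂ K (algebraMap T K (ξ k))) ↔
      Y = evalTensor T P Q (∑ i, U i ⊗ₜ W i) := by
  obtain ⟨d⟩ := hd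
  set γ := algebraMap T K (tangent a lam ξ k) with hγ
  have hγ0 : γ ≠ 0 := by rwa [hγ, Ne, FaithfulSMul.algebraMap_eq_zero_iff]
  have hPQ : P γ * Q γ ≠ 0 := by
    refine mul_ne_zero ?_ ?_ <;> rwa [Ne, map_eq_zero]
  have hη : Fr.η = γ⁻¹ • D ℂ K (algebraMap T K (ξ k)) := by
    rw [Fr.D_eq, Fr.δK_algebraMap, Fr.δ_coord, ← hγ, smul_smul, inv_mul_cancel₀ hγ0, one_smul]
  constructor
  · intro h
    have h1 := congrArg d.coeff h
    rw [coeff_sum_prodForm Fr d hU hW, map_smul, d.coeff_prodForm,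
      Fr.liftKaehlerDifferential_D_coord, ← hγ, smul_eq_mul, mul_assoc,
      Ring.inverse_mul_cancel _ hPQ.isUnit, mul_one] at h1
    exact h1.symm
  · rintro rfl
    rw [map_sum, Finset.sum_mul, Finset.sum_smul]
    refine Finset.sum_congr rfl fun i _ => ?_
    rw [← Fr.coord_smul_η (u i), ← Fr.coord_smul_η (w i), ← hU, ← hW, hη, smul_smul, smul_smul,
      prodForm_smul_smul, evalTensor_tmul, Ring.inverse_eq_inv']
    congr 1
    simp only [map_mul, map_inv₀, mul_inv]
    ring

/-- The symmetry of the two-form as an identity between regular functions of two points. -/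
lemma symmetryDefect_eq (h : IsCurve a lam ξ)
    (hinj : Function.Injective (evalTensor T P Q))
    (hU : ∀ i, algebraMap T K (U i) = Fr.coord (u i))
    (hW : ∀ i, algebraMap T K (W i) = Fr.coord (w i))
    (hsymm : dQ P Q ((diffMatrix a lam (fun k => P (algebraMap T K (ξ k)))
            (fun k => Q (algebraMap T K (ξ k)))).det *
          Ring.inverse ((P (algebraMap T K (ξ 0)) - Q (algebraMap T K (ξ 0))) *
            P (algebraMap T K (tangent a lam ξ 0)))) (D ℂ K (algebraMap T K (ξ 0)))
        + ∑ i, prodForm P Q (u i) (w i) =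
      TensorProduct.comm L _ _ (dQ Q P ((diffMatrix a lam (fun k => Q (algebraMap T K (ξ k)))
            (fun k => P (algebraMap T K (ξ k)))).det *
          Ring.inverse ((Q (algebraMap T K (ξ 0)) - P (algebraMap T K (ξ 0))) *
            Q (algebraMap T K (tangent a lam ξ 0)))) (D ℂ K (algebraMap T K (ξ 0)))
        + ∑ i, prodForm Q P (u i) (w i))) (hd : Nonempty (PartialDerivations P Q Fr.δK))
    (h0 : tangent a lam ξ 0 ≠ 0) :
    (ξ 0 ⊗ₜ 1 - 1 ⊗ₜ ξ 0) * derivationRight T Fr.δ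
          (diffMatrix a lam (fun k => ξ k ⊗ₜ[ℂ] (1 : T)) (fun k => (1 : T) ⊗ₜ ξ k)).det
        + (1 ⊗ₜ tangent a lam ξ 0) *
          (diffMatrix a lam (fun k => ξ k ⊗ₜ[ℂ] (1 : T)) (fun k => (1 : T) ⊗ₜ ξ k)).det
        - ((1 ⊗ₜ ξ 0 - ξ 0 ⊗ₜ 1) * derivationLeft T Fr.δ
          (diffMatrix a lam (fun k => (1 : T) ⊗ₜ ξ k) (fun k => ξ k ⊗ₜ[ℂ] (1 : T))).det
        + (tangent a lam ξ 0 ⊗ₜ 1) *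
          (diffMatrix a lam (fun k => (1 : T) ⊗ₜ ξ k) (fun k => ξ k ⊗ₜ[ℂ] (1 : T))).det)
      = (ξ 0 ⊗ₜ 1 - 1 ⊗ₜ ξ 0) ^ 2 *
        (TensorProduct.comm ℂ T T (∑ i, U i ⊗ₜ W i) - ∑ i, U i ⊗ₜ W i) := by
  obtain ⟨d⟩ := hd
  apply hinj
  have ht := (map_ne_zero_iff _ hinj).2 (h.coord_tmul_sub_ne_zero 0)
  have hγ0 : algebraMap T K (tangent a lam ξ 0) ≠ 0 := by
    rwa [Ne, FaithfulSMul.algebraMap_eq_zero_iff]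
  rw [map_sub, evalTensor_tmul_one, evalTensor_one_tmul] at ht
  have ht' : Q (algebraMap T K (ξ 0)) - P (algebraMap T K (ξ 0)) ≠ 0 := by
    rw [← neg_sub]; exact neg_ne_zero.2 ht
  have hPγ : P (algebraMap T K (tangent a lam ξ 0)) ≠ 0 := by rwa [Ne, map_eq_zero]
  have hQγ : Q (algebraMap T K (tangent a lam ξ 0)) ≠ 0 := by rwa [Ne, map_eq_zero]
  have h1 := congrArg d.coeff hsymm
  rw [map_add, map_add, map_add, d.coeff_dQ, d.coeff_comm_dQ, Fr.liftKaehlerDifferential_D_coord,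
    coeff_sum_prodForm Fr d hU hW, coeff_comm_sum_prodForm Fr d hU hW,
    derivation_mul_inverse d.snd ht hPγ (d.snd_P _)
      (g' := Q (algebraMap T K (tangent a lam ξ 0)))
      (by rw [map_sub, d.snd_P, d.snd_Q, zero_sub, Fr.δK_algebraMap, Fr.δ_coord]),
    mul_comm (d.fst _), derivation_mul_inverse d.fst ht' hQγ (d.fst_Q _)
      (g' := P (algebraMap T K (tangent a lam ξ 0)))
      (by rw [map_sub, d.fst_P, d.fst_Q, zero_sub, Fr.δK_algebraMap, Fr.δ_coord])] at h1
  simp only [map_sub, map_add, map_mul, map_pow, ← snd_evalTensor Fr d, ← fst_evalTensor Fr d,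
    evalTensor_diffMatrix, evalTensor_tmul_one, evalTensor_one_tmul]
  generalize evalTensor T P Q _ = A1 at h1 ⊢
  generalize evalTensor T P Q _ = A2 at h1 ⊢
  -- Interchanging the points changes the sign of x_1 - y_1, so both sides have the same squared
  -- denominator.
  have h2 : (Q (algebraMap T K (ξ 0)) - P (algebraMap T K (ξ 0))) ^ 2 =
    (P (algebraMap T K (ξ 0)) - Q (algebraMap T K (ξ 0))) ^ 2 := by ring
  rw [h2] at h1
  field_simp at h1
  linear_combination h1

end TwoPoints

/-! ### The expansion of the second-kind part of the two-form -/

section Expansion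

variable {n : ℕ} {a : Fin (n + 1) → ℕ} {lam : Fin n → (Fin (n + 1) → ℕ) → ℂ}
variable {T : Type*} [CommRing T] [IsDomain T] [Algebra ℂ T] {ξ : Fin (n + 1) → T}
variable {K : Type} [Field K] [Algebra ℂ K] [Algebra T K] [IsScalarTower ℂ T K]
  [IsFractionRing T K]

set_option linter.unusedSectionVars false in
-- Independence of the monomials in B is checked in K, where the valuation of a point at infinity
-- separates them.
lemma IsGenericPoint.isCurve (hξ : IsGenericPoint a lam ξ) (ha : IsTelescopic a) {p : Point K}
    (hp : ¬ ∀ f : T, algebraMap T K f ∈ p.ring) : IsCurve a lam ξ := by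
  refine ⟨hξ, ha, ?_⟩
  obtain ⟨Γ₀, _, V, ρ, hV, hρ, h⟩ := Point.exists_valuation ha hξ hp
  have h1 := linearIndependent_of_valuation ha
    (fun z => (hV _).2 (p.ring.algebraMap_mem z)) hρ h
  refine LinearIndependent.of_comp (IsScalarTower.toAlgHom ℂ T K).toLinearMap ?_
  convert h1 using 1
  funext α
  exact algebraMap_monom _

variable (a lam) in
/-- The one-form `du_i`. -/
def firstKindForm (ζ : Fin (n + 1) → K) (φ : ℕ → Fin (n + 1) → ℕ) {g : ℕ} (i : Fin g) : Ω[K⁄ℂ] :=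
  -((monom ζ (φ (g - 1 - i)) * Ring.inverse (aeval ζ (detG a lam 0))) • D ℂ K (ζ 0))

variable {L : Type} [Field L] [Algebra ℂ L] [Algebra (K ⊗[ℂ] K) L]
  [IsScalarTower ℂ (K ⊗[ℂ] K) L] [IsFractionRing (K ⊗[ℂ] K) L]

variable (a lam) in
/-- The coefficient of `dx_1` in `Ω(P,Q)`. -/
def singularCoeff (ζ : Fin (n + 1) → K) (P Q : K →ₐ[ℂ] L) : L :=
  (Matrix.of fun i j : Fin n =>
    (aeval (fun k => if k < j.succ then Q (ζ k) else P (ζ k)) (F a lam i)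
      - aeval (fun k => if k ≤ j.succ then Q (ζ k) else P (ζ k)) (F a lam i))
      * Ring.inverse (P (ζ j.succ) - Q (ζ j.succ))).det *
    Ring.inverse ((P (ζ 0) - Q (ζ 0)) * P (aeval ζ (detG a lam 0)))

set_option linter.unusedSectionVars false in
lemma singularCoeff_eq {ζ : Fin (n + 1) → K} {P Q : K →ₐ[ℂ] L} (h : ∀ k, P (ζ k) ≠ Q (ζ k)) :
    singularCoeff a lam ζ P Q =
      (diffMatrix a lam (fun k => P (ζ k)) (fun k => Q (ζ k))).det *
        Ring.inverse ((P (ζ 0) - Q (ζ 0)) * P (aeval ζ (detG a lam 0))) := by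
  rw [singularCoeff]
  congr 2
  ext i j
  exact aeval_sub_mul_inverse (u := fun k => P (ζ k)) (v := fun k => Q (ζ k)) (h _) _

/-- The whole argument for any presentation T of the coordinate ring with fraction field K. The
coefficients are those of s in the product basis, and the normalization comes from the symmetry
defect of s. -/
theorem IsCurve.expansion (h : IsCurve a lam ξ) (hns : IsNonsingular a lam) {p : Point K}
    (hp : ¬ ∀ f : T, algebraMap T K f ∈ p.ring) {ζ : Fin (n + 1) → K}
    (hζ : ∀ k, ζ k = algebraMap T K (ξ k)) {φ : ℕ → Fin (n + 1) → ℕ}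
    (hrange : Set.range φ = B a) (hmono : StrictMono fun i => p.poleOrder (monom ζ (φ i)))
    {g : ℕ} (hg : g = genus K) {w : Fin g → Ω[K⁄ℂ]}
    (hw : ∀ i, ∀ q : Point K, (∀ f : T, algebraMap T K f ∈ q.ring) → w i ∈ q.holomorphicAt)
    {P Q : K →ₐ[ℂ] L} (hP : ∀ f, P f = algebraMap (K ⊗[ℂ] K) L (f ⊗ₜ 1))
    (hQ : ∀ f, Q f = algebraMap (K ⊗[ℂ] K) L (1 ⊗ₜ f))
    (hsymm : dQ P Q (singularCoeff a lam ζ P Q) (D ℂ K (ζ 0)) +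
        ∑ i, prodForm P Q (firstKindForm a lam ζ φ i) (w i) =
      TensorProduct.comm L _ _ (dQ Q P (singularCoeff a lam ζ Q P) (D ℂ K (ζ 0)) +
        ∑ i, prodForm Q P (firstKindForm a lam ζ φ i) (w i)))
    {E : (((Fin (n + 1) → ℕ) × (Fin (n + 1) → ℕ)) →₀ ℂ) → Prop}
    (hE : ∀ c, E c ↔ (∀ p ∈ c.support, p.1 ∈ B a ∧ p.2 ∈ B a) ∧
      ∑ i, prodForm P Q (firstKindForm a lam ζ φ i) (w i) =
        ((c.sum fun p z => z • (P (monom ζ p.1) * Q (monom ζ p.2))) *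
          Ring.inverse (P (aeval ζ (detG a lam 0)) * Q (aeval ζ (detG a lam 0)))) •
          prodForm P Q (D ℂ K (ζ 0)) (D ℂ K (ζ 0))) :
    (∃! c, E c) ∧ ∀ c, E c → c (φ (g - 1), φ g) = 1 := by
  have ha := h.telescopic
  have hξ := h.toIsGenericPoint
  obtain ⟨Fr⟩ := hξ.nonempty_frame K hns
  obtain ⟨Γ₀, _, V, ρ, hV, hρ, hVξ⟩ := Point.exists_valuation ha hξ hp
  obtain rfl : ζ = fun k => algebraMap T K (ξ k) := funext hζ
  obtain ⟨j, hj, hj', hfin⟩ := h.exists_enumeration_index hrange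
    (Point.strictMono_weight hV hρ hVξ hmono)
  -- In particular g ≥ 1, so the truncated subtraction in `φ (g - 1)` is a genuine one.
  obtain rfl : g = j + 1 := by rw [hg, Fr.genus_eq h hns ⟨p, hp⟩, hfin]
  have hB : ∀ i, φ i ∈ B a := fun i => hrange ▸ Set.mem_range_self i
  have hdet : aeval (fun k => algebraMap T K (ξ k)) (detG a lam 0) =
      algebraMap T K (tangent a lam ξ 0) := by
    rw [tangent_zero]
    exact MvPolynomial.aeval_algebraMap_apply K ξ _
  have h0 : tangent a lam ξ 0 ≠ 0 := by
    intro h0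
    have h1 := h.hasSymbol_tangent 0
    rw [h0] at h1
    exact (Nat.cast_ne_zero.2 (ha.pos 0).ne') (h1.unique (HasSymbol.zero _ _))
  have hγ0 : algebraMap T K (tangent a lam ξ 0) ≠ 0 := by
    rwa [Ne, FaithfulSMul.algebraMap_eq_zero_iff]
  choose W hW using fun i => Fr.coord_mem_range h hns (hw i)
  -- Since det G_1 is the first tangent component, dx_1 / det G_1 = η, and the coefficient of du_i
  -- is minus a monomial.
  have hU : ∀ i : Fin (j + 1), algebraMap T K (-monom ξ (φ (j + 1 - 1 - i))) =
      Fr.coord (firstKindForm a lam (fun k => algebraMap T K (ξ k)) φ i) := by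
    intro i
    rw [firstKindForm, hdet, map_neg, map_neg, map_smul, Fr.coord_D, Fr.δK_algebraMap, Fr.δ_coord,
      smul_eq_mul, mul_assoc, Ring.inverse_mul_cancel _ hγ0.isUnit, mul_one, algebraMap_monom]
  have hd := nonempty_partialDerivations hP hQ Fr.δK
  have hinj : Function.Injective (evalTensor T P Q) := evalTensor_injective hP hQ
  have hne : ∀ k, P (algebraMap T K (ξ k)) ≠ Q (algebraMap T K (ξ k)) := by
    intro k
    have h1 := (map_ne_zero_iff _ hinj).2 (h.coord_tmul_sub_ne_zero k)
    rw [map_sub, evalTensor_tmul_one, evalTensor_one_tmul] at h1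
    exact sub_ne_zero.1 h1
  set s : T ⊗[ℂ] T := ∑ i : Fin (j + 1), (-monom ξ (φ (j + 1 - 1 - i))) ⊗ₜ W i with hs
  have hE' : ∀ c, E c ↔ (∀ p ∈ c.support, p.1 ∈ B a ∧ p.2 ∈ B a) ∧
      (c.sum fun p z => z • (monom ξ p.1 ⊗ₜ[ℂ] monom ξ p.2)) = s := by
    intro c
    have h1 : evalTensor T P Q (c.sum fun p z => z • (monom ξ p.1 ⊗ₜ[ℂ] monom ξ p.2)) =
        c.sum fun p z => z • (P (monom (fun k => algebraMap T K (ξ k)) p.1) *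
          Q (monom (fun k => algebraMap T K (ξ k)) p.2)) := by
      rw [Finsupp.sum, Finsupp.sum, map_sum]
      refine Finset.sum_congr rfl fun q _ => ?_
      rw [map_smul, evalTensor_tmul, algebraMap_monom, algebraMap_monom]
    rw [hE, hdet, sum_prodForm_eq_iff Fr hU hW h0 _ hd, ← hs, ← hinj.eq_iff, h1]
  rw [singularCoeff_eq hne, singularCoeff_eq fun k => (hne k).symm, hdet] at hsymm
  have hdef := h.repr_symmetryDefect Fr.δ_coord
    (symmetryDefect_eq Fr h hinj hU hW hsymm hd h0) (α := ⟨φ j, hB j⟩) (β := ⟨φ (j + 1), hB _⟩)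
    hj hj'
  -- In s the monomials in P are φ_1, …, φ_g of the usual numbering, so φ_{g+1}, which is `φ (j +
  -- 1)`, does not occur there.
  have hzero : h.basis₂.repr s (⟨φ (j + 1), hB _⟩, ⟨φ j, hB j⟩) = 0 := by
    rw [hs, map_sum, Finsupp.finsetSum_apply]
    refine Finset.sum_eq_zero fun i _ => ?_
    have h1 := h.basis_apply ⟨φ (j + 1 - 1 - i), hB _⟩
    simp only at h1
    rw [h.repr_tmul, ← h1, map_neg, Finsupp.neg_apply, Module.Basis.repr_self,
      Finsupp.single_eq_of_ne, neg_zero, zero_mul]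
    intro h2
    have h3 : φ (j + 1) = φ (j + 1 - 1 - i) := congrArg Subtype.val h2
    have h4 := hmono.injective (a₁ := j + 1) (a₂ := j + 1 - 1 - i) (by simp only [h3])
    omega
  refine ⟨?_, fun c hc => ?_⟩
  · simp_rw [hE']
    exact h.existsUnique_expansion s
  · obtain ⟨hc, hcs⟩ := (hE' c).1 hc
    have h1 := h.expansion_apply hc hcs (⟨φ j, hB j⟩, ⟨φ (j + 1), hB _⟩)
    rw [map_sub, Finsupp.sub_apply, h.repr_comm, Prod.swap_prod_mk, hzero, zero_sub] at hdef
    rw [Nat.add_sub_cancel]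
    exact h1.trans (neg_injective hdef)

end Expansion

/-! ### The coordinate ring as a presentation of the curve. -/

section CoordRing

variable {n : ℕ} (a : Fin (n + 1) → ℕ) (lam : Fin n → (Fin (n + 1) → ℕ) → ℂ)

lemma isGenericPoint_coordRing :
    IsGenericPoint a lam fun k => (Ideal.Quotient.mk _ (X k) : CoordRing a lam) := by
  have h1 : ∀ p, aeval (fun k => (Ideal.Quotient.mk _ (X k) : CoordRing a lam)) p =
      Ideal.Quotient.mk (Ideal.span (Set.range (F a lam))) p := by
    intro p
    have h2 := MvPolynomial.aeval_unique (Ideal.Quotient.mkₐ ℂ (Ideal.span (Set.range (F a lam))))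
    exact (congrArg (fun f => f p) h2).symm
  refine ⟨fun i => ?_, fun p hp => ?_, fun f => ?_⟩
  · rw [h1]
    exact Ideal.Quotient.eq_zero_iff_mem.2 (Ideal.subset_span ⟨i, rfl⟩)
  · rw [h1] at hp
    exact Ideal.Quotient.eq_zero_iff_mem.1 hp
  · obtain ⟨p, rfl⟩ := Ideal.Quotient.mk_surjective f
    exact ⟨p, h1 p⟩

end CoordRing

end Telescopic

end

theorem proposition3p2 {n : ℕ} (a : Fin (n + 1) → ℕ) (ha : Telescopic.IsTelescopic a)
    (lam : Fin n → (Fin (n + 1) → ℕ) → ℂ) (hns : Telescopic.IsNonsingular a lam)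
    (infty : Telescopic.Point (Telescopic.FunField a lam))
    (hinfty : ¬ Telescopic.IsAffinePoint a lam infty)
    (φ : ℕ → Fin (n + 1) → ℕ) (hφ : Telescopic.IsEnumeration a lam infty φ)
    (g : ℕ) (hg : g = Telescopic.genus (Telescopic.FunField a lam))
    (dr : Fin g → Ω[Telescopic.FunField a lam⁄ℂ])
    (hdr : ∀ i, dr i ∈ Telescopic.formsWithPoleOnlyAtInfinity a lam)
    (hsymm : Telescopic.OmegaHatSymmetric φ dr) :
    (∃! c, Telescopic.IsExpansion φ dr c) ∧
      ∀ c, Telescopic.IsExpansion φ dr c → c (φ (g - 1), φ g) = 1 := by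
  -- A priori `FunField` is only a total ring of fractions. It is a domain because it is also the
  -- fraction ring of the discrete valuation ring at infinity.
  have hK : IsDomain (Telescopic.FunField a lam) := IsFractionRing.isDomain infty.ring
  have hT : IsDomain (Telescopic.CoordRing a lam) :=
    (IsFractionRing.injective (Telescopic.CoordRing a lam) (Telescopic.FunField a lam)).isDomain
  have h := (Telescopic.isGenericPoint_coordRing a lam).isCurve ha (p := infty) hinfty
  -- Leading terms with values in ℂ[u] exclude zero divisors in the product, so `FunField₂` is a
  -- field.
  have hKK : IsDomain (Telescopic.FunField a lam ⊗[ℂ] Telescopic.FunField a lam) :=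
    Telescopic.isDomain_tensorProduct_of_noZeroDivisors (Telescopic.CoordRing a lam)
      h.isSeparated₂.noZeroDivisors
  refine h.expansion (p := infty) (ζ := Telescopic.x a lam) (L := Telescopic.FunField₂ a lam)
    (P := Telescopic.fstPt a lam) (Q := Telescopic.sndPt a lam) (w := dr)
    hns hinfty (fun _ => rfl) hφ.range_eq hφ.strictMono hg ?_ (fun _ => rfl) (fun _ => rfl)
    hsymm (fun _ => Iff.rfl)
  intro i q hq
  have h1 := hdr i
  rw [Telescopic.formsWithPoleOnlyAtInfinity, Submodule.mem_iInf] at h1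
  exact (Submodule.mem_iInf _).1 (h1 q) hq
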